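/- A quadratic form on a finite abelian $2$-group $G$ is a map $q\colon G\to\mathbb{Q}/\mathbb{Z}$ with $q(nx)=n^2q(x)$ for all $n\in\mathbb{Z}$, $x\in G$, such that $\lambda_q(x,y)=q(x+y)-q(x)-q(y)$ is bilinear and its adjoint $G\to\mathrm{Hom}(G,\mathbb{Q}/\mathbb{Z})$ is bijective. Isomorphism classes of such forms constitute a commutative monoid $\mathfrak{Q}$ under orthogonal sum. Let $\overline{\mathbb{Z}}_8=\mathbb{Z}/8\cup\{\infty\}$, where $\infty$ is absorbing for addition. A tableau is a map $T=(r,s)\colon\mathbb{N}\to\mathbb{N}\times\overline{\mathbb{Z}}_8$; tableaux are added pointwise. To $q$ one associates the tableau $T_q=(\rho,\sigma)$: $\rho_0=0$ and, for $k\ge1$, $\rho_k$ is the rank of the free $\mathbb{Z}/2^k$-module $G_k$ in a decomposition $G=\bigoplus_{k\ge1}G_k$; with $\Gamma_0=\sum_{x\in G}e^{2\pi i q(x)}$ and $\Gamma_k=\sum_{x\in G}e^{\pi i 2^k\lambda_q(x,x)}$ for $k\ge1$, one puts $\sigma_k=\infty$ if $\Gamma_k=0$, and otherwise $\sigma_k\in\mathbb{Z}/8$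 is the argument of $\Gamma_k$, that is, $\Gamma_k/|\Gamma_k|=e^{2\pi i\sigma_k/8}$. An index $m$ is called regular for $T$ if $r(m)=0$ or $s(m)\neq\infty$. **Theorem.** The tableaux $T=(r,s)\colon\mathbb{N}\to\mathbb{N}\times\overline{\mathbb{Z}}_8$ of finite support with $r(0)=0$, $s(0)\in\mathbb{Z}/8$ that satisfy the conditions (1)–(4) below form a submonoid of the monoid of tableaux. For every $q$ the tableau $T_q$ is well defined (in particular, $\Gamma_k/|\Gamma_k|$ is an eighth root of unity whenever $\Gamma_k\ne0$), and $q\mapsto T_q$ induces an isomorphism of $\mathfrak{Q}$ onto this submonoid. 1. $r(m)$ is even for every regular $m$. 2. $s(m)\equiv\sum_{k\ge m+1}r(k)\pmod 2$ for every regular $m$ (in particular, $s(m)\ne\infty$). 3. $s(m)+s(m+1)\equiv2\sum_{k\ge m+2}r(k)\pmod 4$ whenever $m$ and $m+1$ are regular. 4. Let $I=\{m+1,\dots,n-1\}$ be a nonempty interval of integers whose delimiters $m,n\in\mathbb{N}$ are both regular. Then, in $\mathbb{Z}/8$: - if $I$ has an odd number of elements and $r=0$ on $I$, then $s(m)-s(n)=0$;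 - if $I=\{k\}$ and $T(k)=(1,\infty)$, then $s(m)-s(n)\in\{1,-1\}$; - if $I=\{k\}$ and $T(k)=(2,\infty)$, then $s(m)-s(n)\in\{0,2,-2\}$; - if $I$ has an odd number of elements and all elements of $I$ are regular, then $s(m)-s(n)\in\{0,4\}$. -/

import Mathlib

universe u

noncomputable section

/-- The group `ℚ/ℤ`. -/
abbrev QmodZ : Type := AddCircle (1 : ℚ)

theorem expQmodZ_periodic :
    Function.Periodic (fun t : ℚ => Complex.exp (2 * Real.pi * Complex.I * (t : ℂ))) (1 : ℚ) := by
  intro t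
  have h : (2 * Real.pi * Complex.I * ((t + 1 : ℚ) : ℂ) : ℂ)
      = 2 * Real.pi * Complex.I * (t : ℂ) + 2 * Real.pi * Complex.I := by
    push_cast
    ring
  simp only [h, Complex.exp_periodic _]

/-- The character `ℚ/ℤ → ℂ`, `t ↦ exp (2πi t)`. -/
def expQmodZ (t : QmodZ) : ℂ := expQmodZ_periodic.lift t

/-- A (homogeneous, nondegenerate) quadratic form on a finite abelian `2`-group `G`.
A `QuadraticMap ℤ G QmodZ` is a map `q : G → ℚ/ℤ` with `q (n x) = n² q x` for all integers `n`
and with `(x, y) ↦ q (x + y) - q x - q y` bilinear; this symmetric bilinear form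
`form.polarBilin` is required to have a bijective adjoint `G → Hom (G, ℚ/ℤ)`. -/
structure QuadTwoGroup : Type (u + 1) where
  /-- the underlying group -/
  G : Type u
  [grp : AddCommGroup G]
  [fin : Finite G]
  card_eq : ∃ n : ℕ, Nat.card G = 2 ^ n
  /-- the quadratic form -/
  form : QuadraticMap ℤ G QmodZ
  nondegenerate : Function.Bijective form.polarBilin

namespace QuadTwoGroup

attribute [instance] QuadTwoGroup.grp QuadTwoGroup.fin

/-- The associated linking pairing `λ_q (x, y) = q (x + y) - q x - q y`. -/
def linking (q : QuadTwoGroup.{u}) (x y : q.G) : QmodZ := QuadraticMap.polar q.form x y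

/-- Two quadratic forms are isomorphic if a group isomorphism carries one to the other. -/
instance setoid : Setoid QuadTwoGroup.{u} where
  r p q := p.form.Equivalent q.form
  iseqv := ⟨fun p => .refl p.form, fun h => h.symm, fun h h' => h.trans h'⟩

/-- The orthogonal sum `(q ⊕ q') (x, x') = q x + q' x'`. -/
def orthSum (p q : QuadTwoGroup.{u}) : QuadTwoGroup.{u} where
  G := p.G × q.G
  card_eq := by
    obtain ⟨m, hm⟩ := p.card_eq
    obtain ⟨n, hn⟩ := q.card_eq
    exact ⟨m + n, by rw [Nat.card_prod, hm, hn, pow_add]⟩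
  form := p.form.prod q.form
  nondegenerate := by
    have key : ∀ a b : p.G × q.G, (p.form.prod q.form).polarBilin a b
        = p.form.polarBilin a.1 b.1 + q.form.polarBilin a.2 b.2 := by
      intro a b
      simp only [QuadraticMap.polarBilin_apply_apply, QuadraticMap.polar,
        QuadraticMap.prod_apply, Prod.fst_add, Prod.snd_add]
      abel
    constructor
    · intro a a' h
      have h1 : p.form.polarBilin a.1 = p.form.polarBilin a'.1 := by
        ext x
        have := LinearMap.congr_fun h (x, 0)
        simpa only [key, map_zero, add_zero] using this
      have h2 : q.form.polarBilin a.2 = q.form.polarBilin a'.2 := by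
        ext x
        have := LinearMap.congr_fun h (0, x)
        simpa only [key, map_zero, zero_add] using this
      exact Prod.ext (p.nondegenerate.1 h1) (q.nondegenerate.1 h2)
    · intro f
      obtain ⟨a, ha⟩ := p.nondegenerate.2 (f.comp (LinearMap.inl ℤ p.G q.G))
      obtain ⟨b, hb⟩ := q.nondegenerate.2 (f.comp (LinearMap.inr ℤ p.G q.G))
      refine ⟨(a, b), LinearMap.ext fun x => ?_⟩
      rw [key, ha, hb, LinearMap.comp_apply, LinearMap.comp_apply, ← map_add]
      simp

/-- The quadratic form on the trivial group. -/
def trivial : QuadTwoGroup.{u} where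
  G := PUnit.{u + 1}
  card_eq := ⟨0, by simp⟩
  form := 0
  nondegenerate := by
    refine ⟨fun _ _ _ => rfl, fun f => ⟨0, ?_⟩⟩
    ext x
    rw [Subsingleton.elim x 0, map_zero, map_zero]

end QuadTwoGroup

/-- The set of isomorphism classes of quadratic forms on finite `2`-groups. -/
def QuadClass : Type (u + 1) := Quotient QuadTwoGroup.setoid.{u}

/-- The isomorphism class of a quadratic form. -/
def QuadTwoGroup.cls (q : QuadTwoGroup.{u}) : QuadClass.{u} := Quotient.mk _ q

/-- The orthogonal sum of isomorphism classes. -/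
instance QuadClass.instAdd : Add QuadClass.{u} where
  add := Quotient.map₂ QuadTwoGroup.orthSum
    (fun _ _ h _ _ h' => QuadraticMap.Equivalent.prod h h')

instance QuadClass.instZero : Zero QuadClass.{u} where
  zero := QuadTwoGroup.trivial.cls

/-- The monoid structure on isomorphism classes given by orthogonal sum. -/
instance QuadClass.instAddCommMonoid : AddCommMonoid QuadClass.{u} where
  add_assoc := by
    rintro ⟨a⟩ ⟨b⟩ ⟨c⟩
    exact Quotient.sound ⟨{ LinearEquiv.prodAssoc ℤ a.G b.G c.G with
      map_app' := fun x => (add_assoc (a.form x.1.1) (b.form x.1.2) (c.form x.2)).symm }⟩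
  zero_add := by
    rintro ⟨a⟩
    exact Quotient.sound ⟨{ LinearEquiv.uniqueProd (R := ℤ) (M := a.G) (M₂ := PUnit.{u + 1}) with
      map_app' := fun x => (zero_add (a.form x.2)).symm }⟩
  add_zero := by
    rintro ⟨a⟩
    exact Quotient.sound ⟨{ LinearEquiv.prodUnique (R := ℤ) (M := a.G) (M₂ := PUnit.{u + 1}) with
      map_app' := fun x => (add_zero (a.form x.1)).symm }⟩
  add_comm := by
    rintro ⟨a⟩ ⟨b⟩
    exact Quotient.sound ⟨QuadraticMap.IsometryEquiv.prodComm a.form b.form⟩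
  nsmul := nsmulRec

/-- `ℤ/8 ∪ {∞}`, with `∞ = ⊤` absorbing for addition. -/
abbrev Z8bar : Type := WithTop (ZMod 8)

/-- The monoid (under pointwise addition) of tableaux `m ↦ (r m, s m)`. -/
abbrev Tableau : Type := ℕ → ℕ × Z8bar

/-- `IsEighthArg z a`: either `z = 0` and `a = ∞`, or `z ≠ 0`, `z / |z|` is an eighth root of
unity, and `a ∈ ℤ/8` is the argument of `z`, i.e. `z / |z| = exp (2πi a / 8)`. -/
def IsEighthArg (z : ℂ) (a : Z8bar) : Prop :=
  (z = 0 ∧ a = ⊤) ∨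
    (z ≠ 0 ∧ ∃ j : ZMod 8, a = (j : Z8bar) ∧
      z / (‖z‖ : ℂ) = Complex.exp (2 * Real.pi * Complex.I * (j.val : ℂ) / 8))

namespace QuadTwoGroup

/-- The Gauss sums of `q`: at index `0` it is `γ(q) = ∑ exp (2πi q(x))`, and at an index `m ≥ 1` it
is `Γ_m(λ_q) = ∑ exp (πi 2^m λ_q(x, x))`, where `πi 2^m = 2πi 2^(m-1)`. -/
def gaussSum (q : QuadTwoGroup.{u}) : ℕ → ℂ
  | 0 => ∑ᶠ x : q.G, expQmodZ (q.form x)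
  | k + 1 => ∑ᶠ x : q.G, expQmodZ (2 ^ k • q.linking x x)

/-- `T = (r, s)` is the tableau of invariants of `q`: `r 0 = 0`; for `k ≥ 1` the number `r k` is the
rank of the free `ℤ/2^k`-module `G_k` in a decomposition of `G` as the direct sum of the `G_k`
(the summand for `k = 0` is trivial); and `s k` is the argument of the `k`-th Gauss sum. -/
structure HasTableau (q : QuadTwoGroup.{u}) (T : Tableau) : Prop where
  rank_zero : (T 0).1 = 0
  rank : Nonempty (q.G ≃+ DirectSum ℕ (fun k => Fin (T k).1 → ZMod (2 ^ k)))
  signature : ∀ k, IsEighthArg (q.gaussSum k) (T k).2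

end QuadTwoGroup

namespace Tableau

/-- The formal rank `r m`. -/
def r (T : Tableau) (m : ℕ) : ℕ := (T m).1

/-- The formal signature `s m`. -/
def s (T : Tableau) (m : ℕ) : Z8bar := (T m).2

/-- `m` is regular for `T` if `r m = 0` or `s m ≠ ∞`. -/
def Regular (T : Tableau) (m : ℕ) : Prop := T.r m = 0 ∨ T.s m ≠ ⊤

/-- `∑_{k ≥ m} r k` (a finite sum for a tableau of finite support). -/
def tailRank (T : Tableau) (m : ℕ) : ℕ := ∑ᶠ k ∈ Set.Ici m, T.r k

/-! In the four types below the extracted tableau is the restriction of `T` to the interval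
`{m + 1, …, m + l}` of length `l ≥ 1`; its left delimiter is `m` and its right delimiter is
`m + l + 1`. -/

/-- Odd length and all ranks zero. -/
def TypeT0 (T : Tableau) (m l : ℕ) : Prop :=
  Odd l ∧ ∀ k, m + 1 ≤ k → k ≤ m + l → T.r k = 0

/-- Length one, with the single entry `(1, ∞)`. -/
def TypeT1 (T : Tableau) (m l : ℕ) : Prop :=
  l = 1 ∧ T.r (m + 1) = 1 ∧ T.s (m + 1) = ⊤

/-- Length one, with the single entry `(2, ∞)`. -/
def TypeT2 (T : Tableau) (m l : ℕ) : Prop :=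
  l = 1 ∧ T.r (m + 1) = 2 ∧ T.s (m + 1) = ⊤

/-- Odd length and all indices regular. -/
def TypeT3 (T : Tableau) (m l : ℕ) : Prop :=
  Odd l ∧ ∀ k, m + 1 ≤ k → k ≤ m + l → T.Regular k

/-- Finite tableaux with `r 0 = 0` and `s 0 ∈ ℤ/8` which satisfy the conditions (1)-(4). -/
structure Admissible (T : Tableau) : Prop where
  finite : (Function.support T).Finite
  rank_zero : T.r 0 = 0
  signature_zero : T.s 0 ≠ ⊤
  /-- (1) `r m` is even for every regular `m`. -/
  cond1 : ∀ m, T.Regular m → Even (T.r m)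
  /-- (2) `s m = ∑_{k ≥ m+1} r k (mod 2)` for every regular `m`; in particular `s m ≠ ∞`. -/
  cond2 : ∀ m, T.Regular m → ∃ a : ZMod 8, T.s m = (a : Z8bar) ∧
    ZMod.castHom (show 2 ∣ 8 by norm_num) (ZMod 2) a = (T.tailRank (m + 1) : ZMod 2)
  /-- (3) `s m + s (m+1) = 2 ∑_{k ≥ m+2} r k (mod 4)` for all regular `m`, `m + 1`. -/
  cond3 : ∀ m, T.Regular m → T.Regular (m + 1) →
    ∃ a b : ZMod 8, T.s m = (a : Z8bar) ∧ T.s (m + 1) = (b : Z8bar) ∧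
      ZMod.castHom (show 4 ∣ 8 by norm_num) (ZMod 4) (a + b)
        = (2 * T.tailRank (m + 2) : ZMod 4)
  /-- (4) the condition on the difference of the signatures at regular delimiters. -/
  cond4 : ∀ m l, 1 ≤ l → T.Regular m → T.Regular (m + l + 1) →
    ∃ a b : ZMod 8, T.s m = (a : Z8bar) ∧ T.s (m + l + 1) = (b : Z8bar) ∧
      (T.TypeT0 m l → a - b = 0) ∧
      (T.TypeT1 m l → a - b = 1 ∨ a - b = -1) ∧
      (T.TypeT2 m l → a - b = 0 ∨ a - b = 2 ∨ a - b = -2) ∧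
      (T.TypeT3 m l → a - b = 0 ∨ a - b = 4)

end Tableau

end

/-! Every form is an orthogonal sum of cyclic forms `n x² / 2^(k+2)` on `ℤ/2^(k+1)`, `n` odd, and of
even planes `(α x² + υ xy + β y²) / 2^(k+1)`, `υ` odd (`exists_gen_emb`, `Emb.exists_cls_eq_add`).
Only `n` modulo 8 and the parity of `αβ` matter, so a class is given by a multiset of symbols `Gen`,
each carrying a level `k`, a bit `f`, and a sign if it is cyclic. A symbol of level `k` contributes
to the rank at index `k + 1`.

Tableaux are additive: Gauss sums multiply, and ranks are determined by torsion counts. A cyclic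
symbol has signature `∞` at index `k + 1`, `±1 + 4f(k + m)` at `m ≤ k`, and `0` beyond; a plane has
`4f(k + m + 1)` at `m ≤ k` and `0` beyond. Hence, where no odd symbol intervenes, moving the index
by one changes the signature by the total parity `symE4`, which is four times the number of set
bits.

Injectivity. Choose representatives without odd and even symbols on a common level
(`exists_isPure_symCls_eq`). If index 1 is regular, the total parity is read off from the signatures
at 0 and 1; otherwise it can be changed at will, because `n` and `n + 4` give the same form on
`ℤ/2`. So one may assume equal parities (`Sim`). The relations between symbols on the same level, or
on levels at distance 1 or 2, give moves that transport signs and bits. Comparing signatures at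
regular indices shows that these moves always produce a common symbol of lowest level
(`exists_common`). It cancels (`Sim.of_cons`), and induction on the number of symbols finishes
(`symCls_eq_of_sim`).

Surjectivity. The conditions are additive (`Adm.add`) and hold for symbols, so all tableaux of forms
are admissible. Conversely, an admissible tableau is realized recursively over the levels. The
predicate `Good` states what the part above index `k` must satisfy for a prescribed signature at `k`
and a prescribed total parity; a suitable choice of symbols on level `k` reduces the problem at `k`
to that at `k + 1` (`Adm.exists_realizes`). -/

noncomputable section

/-! ### Dyadic elements of `ℚ/ℤ` -/

/-- The class of `n / 2 ^ k` in `ℚ/ℤ`, as an additive function of `n`. -/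
def dyadic (k : ℕ) : ℤ →+ QmodZ :=
  (QuotientAddGroup.mk' (AddSubgroup.zmultiples (1 : ℚ))).comp
    ((AddMonoidHom.mulRight ((2 : ℚ) ^ k)⁻¹).comp (Int.castAddHom ℚ))

theorem dyadic_apply (k : ℕ) (n : ℤ) : dyadic k n = (((n : ℚ) / 2 ^ k : ℚ) : QmodZ) := rfl

theorem dyadic_eq_zero_iff (k : ℕ) (n : ℤ) : dyadic k n = 0 ↔ (2 : ℤ) ^ k ∣ n := by
  rw [dyadic_apply, AddCircle.coe_eq_zero_iff]
  have h2 : (2 : ℚ) ^ k ≠ 0 := by positivity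
  constructor
  · rintro ⟨m, hm⟩
    refine ⟨m, ?_⟩
    rw [zsmul_eq_mul, mul_one, eq_div_iff h2] at hm
    have : (m * 2 ^ k : ℤ) = n := by exact_mod_cast hm
    rw [← this, mul_comm]
  · rintro ⟨m, rfl⟩
    refine ⟨m, ?_⟩
    push_cast
    field_simp
    simp

theorem dyadic_eq_iff (k : ℕ) (m n : ℤ) : dyadic k m = dyadic k n ↔ (2 : ℤ) ^ k ∣ m - n := by
  rw [← sub_eq_zero, ← map_sub, dyadic_eq_zero_iff]

theorem dyadic_succ_two_mul (k : ℕ) (n : ℤ) : dyadic (k + 1) (2 * n) = dyadic k n := by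
  rw [dyadic_apply, dyadic_apply]
  congr 1
  push_cast
  field_simp
  ring

theorem dyadic_add_pow_mul (k j : ℕ) (n : ℤ) : dyadic (k + j) (2 ^ j * n) = dyadic k n := by
  rw [dyadic_apply, dyadic_apply]
  congr 1
  push_cast
  field_simp
  ring

theorem zsmul_dyadic (k : ℕ) (z n : ℤ) : z • dyadic k n = dyadic k (z * n) := by
  rw [← map_zsmul, smul_eq_mul]

theorem nsmul_dyadic (k : ℕ) (z : ℕ) (n : ℤ) : z • dyadic k n = dyadic k (z * n) := by
  rw [← map_nsmul, nsmul_eq_mul]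

theorem exists_dyadic_of_nsmul_eq_zero {k : ℕ} {t : QmodZ} (h : 2 ^ k • t = 0) :
    ∃ n : ℤ, t = dyadic k n := by
  obtain ⟨t, rfl⟩ := QuotientAddGroup.mk_surjective t
  change 2 ^ k • ((t : ℚ) : QmodZ) = 0 at h
  rw [← AddCircle.coe_nsmul, AddCircle.coe_eq_zero_iff] at h
  obtain ⟨n, hn⟩ := h
  refine ⟨n, ?_⟩
  rw [dyadic_apply]
  change ((t : ℚ) : QmodZ) = _
  congr 1
  simp only [zsmul_eq_mul, mul_one, nsmul_eq_mul, Nat.cast_pow, Nat.cast_ofNat] at hn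
  rw [hn]
  field_simp

/-! ### Calculus of quadratic forms and orthogonal splitting -/

namespace QuadTwoGroup

theorem linking_eq (q : QuadTwoGroup.{u}) (x y : q.G) :
    q.linking x y = q.form (x + y) - q.form x - q.form y := rfl

theorem form_add (q : QuadTwoGroup.{u}) (x y : q.G) :
    q.form (x + y) = q.form x + q.form y + q.linking x y := by
  rw [linking_eq]; abel

theorem form_zsmul (q : QuadTwoGroup.{u}) (n : ℤ) (x : q.G) :
    q.form (n • x) = (n * n) • q.form x := q.form.map_smul n x

theorem linking_comm (q : QuadTwoGroup.{u}) (x y : q.G) : q.linking x y = q.linking y x :=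
  QuadraticMap.polar_comm _ _ _

theorem linking_add_left (q : QuadTwoGroup.{u}) (x y z : q.G) :
    q.linking (x + y) z = q.linking x z + q.linking y z := QuadraticMap.polar_add_left _ _ _ _

theorem linking_add_right (q : QuadTwoGroup.{u}) (x y z : q.G) :
    q.linking x (y + z) = q.linking x y + q.linking x z := QuadraticMap.polar_add_right _ _ _ _

theorem linking_sub_left (q : QuadTwoGroup.{u}) (x y z : q.G) :
    q.linking (x - y) z = q.linking x z - q.linking y z := QuadraticMap.polar_sub_left _ _ _ _

theorem linking_zsmul_left (q : QuadTwoGroup.{u}) (n : ℤ) (x y : q.G) :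
    q.linking (n • x) y = n • q.linking x y := QuadraticMap.polar_smul_left _ _ _ _

theorem linking_zsmul_right (q : QuadTwoGroup.{u}) (n : ℤ) (x y : q.G) :
    q.linking x (n • y) = n • q.linking x y := QuadraticMap.polar_smul_right _ _ _ _

theorem linking_self (q : QuadTwoGroup.{u}) (x : q.G) : q.linking x x = 2 • q.form x :=
  QuadraticMap.polar_self _ _

theorem linking_zero_left (q : QuadTwoGroup.{u}) (x : q.G) : q.linking 0 x = 0 :=
  QuadraticMap.polar_zero_left _ _

theorem linking_zero_right (q : QuadTwoGroup.{u}) (x : q.G) : q.linking x 0 = 0 :=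
  QuadraticMap.polar_zero_right _ _

theorem eq_zero_of_linking (q : QuadTwoGroup.{u}) {x : q.G} (h : ∀ y, q.linking x y = 0) :
    x = 0 := by
  apply q.nondegenerate.1
  ext y
  rw [map_zero]
  exact h y

theorem exists_linking_eq (q : QuadTwoGroup.{u}) (f : q.G →+ QmodZ) :
    ∃ x, ∀ y, q.linking x y = f y := by
  obtain ⟨x, hx⟩ := q.nondegenerate.2 f.toIntLinearMap
  exact ⟨x, fun y => LinearMap.congr_fun hx y⟩

theorem nondegenerate_of {G : Type*} [AddCommGroup G] (Q : QuadraticMap ℤ G QmodZ)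
    (h₁ : ∀ x, (∀ y, QuadraticMap.polar Q x y = 0) → x = 0)
    (h₂ : ∀ f : G →+ QmodZ, ∃ x, ∀ y, QuadraticMap.polar Q x y = f y) :
    Function.Bijective Q.polarBilin := by
  constructor
  · rw [injective_iff_map_eq_zero]
    intro x hx
    exact h₁ x fun y => LinearMap.congr_fun hx y
  · intro f
    obtain ⟨x, hx⟩ := h₂ f.toAddMonoidHom
    exact ⟨x, LinearMap.ext hx⟩

theorem cls_eq_of_equiv {p q : QuadTwoGroup.{u}} (e : p.G ≃+ q.G)
    (h : ∀ x, q.form (e x) = p.form x) : p.cls = q.cls :=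
  Quotient.sound ⟨{ e.toIntLinearEquiv with map_app' := h }⟩

theorem exists_equiv_of_cls_eq {p q : QuadTwoGroup.{u}} (h : p.cls = q.cls) :
    ∃ e : p.G ≃+ q.G, ∀ x, q.form (e x) = p.form x := by
  obtain ⟨e⟩ := Quotient.exact h
  exact ⟨e.toLinearEquiv.toAddEquiv, e.map_app'⟩

theorem cls_orthSum (p q : QuadTwoGroup.{u}) : (p.orthSum q).cls = p.cls + q.cls := rfl

theorem cls_trivial : (trivial : QuadTwoGroup.{u}).cls = 0 := rfl

/-- An element of an orthogonal sum, given by its components. -/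
def pair {p q : QuadTwoGroup.{u}} (x : p.G) (y : q.G) : (p.orthSum q).G := (x, y)

theorem orthSum_form {p q : QuadTwoGroup.{u}} (x : p.G) (y : q.G) :
    (p.orthSum q).form (pair x y) = p.form x + q.form y := rfl

theorem pair_add_pair {p q : QuadTwoGroup.{u}} (x x' : p.G) (y y' : q.G) :
    pair x y + pair x' y' = pair (x + x') (y + y') := rfl

theorem orthSum_linking {p q : QuadTwoGroup.{u}} (x x' : p.G) (y y' : q.G) :
    (p.orthSum q).linking (pair x y) (pair x' y') = p.linking x x' + q.linking y y' := by
  rw [linking_eq, pair_add_pair, orthSum_form, orthSum_form, orthSum_form, linking_eq, linking_eq]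
  abel

theorem nsmul_pair_eq_zero {p q : QuadTwoGroup.{u}} {x : p.G} {y : q.G} {n : ℕ} (hx : n • x = 0)
    (hy : n • y = 0) : n • pair x y = 0 := Prod.ext hx hy

/-- An isometric homomorphism of quadratic forms. -/
structure Emb (p q : QuadTwoGroup.{u}) where
  /-- the underlying homomorphism -/
  hom : p.G →+ q.G
  map_form : ∀ x, q.form (hom x) = p.form x

namespace Emb

variable {p p' q : QuadTwoGroup.{u}}

theorem map_linking (f : Emb p q) (x y : p.G) :
    q.linking (f.hom x) (f.hom y) = p.linking x y := by
  rw [linking_eq, linking_eq, ← map_add, f.map_form, f.map_form, f.map_form]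

/-- Pairings are preserved, so a kernel element pairs to zero with all of `p`, which is
nondegenerate. -/
theorem injective (f : Emb p q) : Function.Injective f.hom := by
  rw [injective_iff_map_eq_zero]
  intro x hx
  apply p.eq_zero_of_linking
  intro y
  rw [← f.map_linking, hx, linking_zero_left]

theorem cls_eq (f : Emb p q) (h : Nat.card p.G = Nat.card q.G) : p.cls = q.cls := by
  have hb : Function.Bijective f.hom :=
    (Nat.bijective_iff_injective_and_card _).2 ⟨f.injective, h⟩
  exact cls_eq_of_equiv (AddEquiv.ofBijective f.hom hb) f.map_form

/-- The orthogonal sum of two isometric homomorphisms with orthogonal images. -/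
def sum (f : Emb p q) (g : Emb p' q) (h : ∀ x y, q.linking (f.hom x) (g.hom y) = 0) :
    Emb (p.orthSum p') q where
  hom := f.hom.coprod g.hom
  map_form := by
    rintro ⟨x, y⟩
    change q.form (f.hom x + g.hom y) = p.form x + p'.form y
    rw [form_add, h, f.map_form, g.map_form, add_zero]

/-- A nondegenerate subform splits off. -/
theorem exists_cls_eq_add (f : Emb p q) :
    ∃ c : QuadTwoGroup.{u}, q.cls = p.cls + c.cls ∧ Nat.card q.G = Nat.card p.G * Nat.card c.G := by
  let H : AddSubgroup q.G :=
    { carrier := {y | ∀ x, q.linking (f.hom x) y = 0}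
      add_mem' := fun {a b} ha hb x => by rw [linking_add_right, ha x, hb x, add_zero]
      zero_mem' := fun x => linking_zero_right _ _
      neg_mem' := fun {a} ha x => by
        have := q.linking_zsmul_right (-1) (f.hom x) a
        rw [neg_one_zsmul, ha x, smul_zero] at this
        exact this }
  -- The functional `y ↦ λ(g, f y)` on `p` is represented by some `x`; subtracting the image of `x`
  -- moves `g` into the orthogonal complement `H`.
  have hproj : ∀ g : q.G, ∃ x : p.G, g - f.hom x ∈ H := by
    intro g
    obtain ⟨x, hx⟩ := p.exists_linking_eq
      (AddMonoidHom.mk' (fun x => q.linking g (f.hom x))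
        (fun a b => by rw [map_add, linking_add_right]))
    refine ⟨x, fun y => ?_⟩
    rw [linking_comm, linking_sub_left, f.map_linking, hx]
    exact sub_self _
  have hmeet : ∀ x : p.G, f.hom x ∈ H → x = 0 := by
    intro x hx
    apply p.eq_zero_of_linking
    intro y
    rw [linking_comm, ← f.map_linking]
    exact hx y
  let φ : p.G × H →+ q.G := f.hom.coprod H.subtype
  have hφ : ∀ x h, φ (x, h) = f.hom x + h := fun _ _ => rfl
  have hbij : Function.Bijective φ := by
    constructor
    · rw [injective_iff_map_eq_zero]
      rintro ⟨x, h⟩ hx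
      rw [hφ] at hx
      have hx0 : x = 0 := by
        apply hmeet
        rw [eq_neg_of_add_eq_zero_left hx]
        exact H.neg_mem h.2
      subst hx0
      rw [map_zero, zero_add] at hx
      ext
      · rfl
      · exact hx
    · intro g
      obtain ⟨x, hx⟩ := hproj g
      exact ⟨(x, ⟨_, hx⟩), by rw [hφ]; exact add_sub_cancel _ _⟩
  let Φ : p.G × H ≃+ q.G := AddEquiv.ofBijective φ hbij
  have hcard : Nat.card q.G = Nat.card p.G * Nat.card H := by
    rw [← Nat.card_prod]; exact (Nat.card_congr Φ.toEquiv).symm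
  let Q : QuadraticMap ℤ H QmodZ := q.form.comp H.subtype.toIntLinearMap
  have hQ : ∀ x y : H, QuadraticMap.polar Q x y = q.linking x y := fun x y => rfl
  let c : QuadTwoGroup.{u} :=
    { G := H
      card_eq := by
        obtain ⟨n, hn⟩ := q.card_eq
        have : Nat.card H ∣ 2 ^ n := by rw [← hn, hcard]; exact dvd_mul_left _ _
        obtain ⟨m, -, hm⟩ := (Nat.dvd_prime_pow Nat.prime_two).1 this
        exact ⟨m, hm⟩
      form := Q
      nondegenerate := by
        apply nondegenerate_of
        · intro x hx
          have : (x : q.G) = 0 := by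
            apply q.eq_zero_of_linking
            intro y
            obtain ⟨⟨a, b⟩, rfl⟩ := hbij.2 y
            rw [hφ, linking_add_right, linking_comm, x.2 a, zero_add, ← hQ]
            exact hx b
          exact Subtype.ext this
        · intro g
          -- Extend the functional by zero on the image of `p`; the component in `H` of a
          -- representing element represents it on `H`.
          obtain ⟨z, hz⟩ := q.exists_linking_eq
            ((g.comp (AddMonoidHom.snd p.G H)).comp Φ.symm.toAddMonoidHom)
          obtain ⟨⟨a, b⟩, rfl⟩ := hbij.2 z
          refine ⟨b, fun y => ?_⟩
          have h1 := hz (φ (0, y))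
          have h2 : Φ.symm (φ (0, y)) = (0, y) := Φ.symm_apply_apply (0, y)
          rw [hφ, hφ, map_zero, zero_add, linking_add_left, y.2 a, zero_add] at h1
          rw [hQ, h1]
          change g (Φ.symm (y : q.G)).2 = g y
          rw [hφ, map_zero, zero_add] at h2
          rw [h2] }
  refine ⟨c, ?_, hcard⟩
  rw [← cls_orthSum]
  symm
  refine cls_eq_of_equiv (p := p.orthSum c) (q := q) Φ ?_
  rintro ⟨x, y⟩
  change q.form (f.hom x + y) = p.form x + q.form y
  rw [form_add, y.2 x, f.map_form, add_zero]

end Emb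

end QuadTwoGroup

/-! ### Cyclic forms and even planes -/

theorem two_pow_dvd_val_sub {k : ℕ} (z : ℤ) (x : ZMod (2 ^ k)) (h : x = z) :
    (2 : ℤ) ^ k ∣ x.val - z := by
  have := (ZMod.intCast_zmod_eq_zero_iff_dvd ((x.val : ℤ) - z) (2 ^ k)).1
    (by push_cast; rw [ZMod.natCast_zmod_val, h, sub_self])
  exact_mod_cast this

theorem odd_isCoprime_two_pow {n : ℤ} (h : Odd n) (k : ℕ) : IsCoprime ((2 : ℤ) ^ k) n := by
  apply IsCoprime.pow_left
  obtain ⟨m, rfl⟩ := h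
  exact ⟨-m, 1, by ring⟩

/-- Odd integers are invertible modulo powers of two. -/
theorem exists_mul_sub_one_dvd {n : ℤ} (h : Odd n) (k : ℕ) : ∃ m : ℤ, (2 : ℤ) ^ k ∣ n * m - 1 := by
  obtain ⟨a, b, hab⟩ := odd_isCoprime_two_pow h k
  exact ⟨b, -a, by linear_combination hab⟩

theorem dvd_of_dvd_odd_mul {n x : ℤ} (h : Odd n) {k : ℕ} (hx : (2 : ℤ) ^ k ∣ n * x) :
    (2 : ℤ) ^ k ∣ x := (odd_isCoprime_two_pow h k).dvd_of_dvd_mul_left hx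

namespace QuadTwoGroup

/-- The value of the form `n x ^ 2 / 2 ^ (k + 2)` on `ℤ / 2 ^ (k + 1)`. -/
def cycVal (k : ℕ) (n : ℤ) (x : ULift.{u} (ZMod (2 ^ (k + 1)))) : QmodZ :=
  dyadic (k + 2) (n * (x.down.val : ℤ) ^ 2)

/-- Changing a representative by a multiple of `2^(k+1)` changes its square by a multiple of
`2^(k+2)`. This is why the denominator may exceed the order of the group by a factor of two. -/
theorem cycVal_intCast (k : ℕ) (n z : ℤ) :
    cycVal.{u} k n ⟨(z : ZMod (2 ^ (k + 1)))⟩ = dyadic (k + 2) (n * z ^ 2) := by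
  rw [cycVal, dyadic_eq_iff]
  obtain ⟨c, hc⟩ := two_pow_dvd_val_sub z (z : ZMod (2 ^ (k + 1))) rfl
  rw [sub_eq_iff_eq_add] at hc
  refine ⟨n * (2 ^ k * c ^ 2 + c * z), ?_⟩
  simp only [hc]
  ring

theorem exists_intCast_ulift {k : ℕ} (x : ULift.{u} (ZMod (2 ^ k))) : ∃ z : ℤ, x = ⟨z⟩ := by
  obtain ⟨z, hz⟩ := ZMod.intCast_surjective x.down
  exact ⟨z, ULift.ext _ _ hz.symm⟩

theorem ulift_add {k : ℕ} (a b : ℤ) : (⟨(a : ZMod (2 ^ k))⟩ + ⟨b⟩ : ULift.{u} (ZMod (2 ^ k)))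
    = ⟨((a + b : ℤ) : ZMod (2 ^ k))⟩ := by
  rw [Int.cast_add]; rfl

theorem ulift_smul {k : ℕ} (c a : ℤ) : (c • ⟨(a : ZMod (2 ^ k))⟩ : ULift.{u} (ZMod (2 ^ k)))
    = ⟨((c * a : ℤ) : ZMod (2 ^ k))⟩ := by
  apply ULift.ext
  change c • (a : ZMod (2 ^ k)) = _
  rw [zsmul_eq_mul, Int.cast_mul]

theorem cycVal_polar (k : ℕ) (n a b : ℤ) :
    QuadraticMap.polar (cycVal.{u} k n) ⟨(a : ZMod (2 ^ (k + 1)))⟩ ⟨b⟩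
      = dyadic (k + 1) (n * a * b) := by
  rw [QuadraticMap.polar, ulift_add, cycVal_intCast, cycVal_intCast, cycVal_intCast, ← map_sub,
    ← map_sub, ← dyadic_succ_two_mul (k + 1)]
  congr 1
  ring

/-- The quadratic map `x ↦ n x ^ 2 / 2 ^ (k + 2)` on `ℤ / 2 ^ (k + 1)`. -/
def cycForm (k : ℕ) (n : ℤ) : QuadraticMap ℤ (ULift.{u} (ZMod (2 ^ (k + 1)))) QmodZ :=
  QuadraticMap.ofPolar (cycVal k n)
    (by
      intro c x
      obtain ⟨a, rfl⟩ := exists_intCast_ulift x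
      rw [ulift_smul, cycVal_intCast, cycVal_intCast, zsmul_dyadic]
      congr 1
      ring)
    (by
      intro x y z
      obtain ⟨a, rfl⟩ := exists_intCast_ulift x
      obtain ⟨b, rfl⟩ := exists_intCast_ulift y
      obtain ⟨c, rfl⟩ := exists_intCast_ulift z
      rw [ulift_add, cycVal_polar, cycVal_polar, cycVal_polar, ← map_add]
      congr 1
      ring)
    (by
      intro c x y
      obtain ⟨a, rfl⟩ := exists_intCast_ulift x
      obtain ⟨b, rfl⟩ := exists_intCast_ulift y
      rw [ulift_smul, cycVal_polar, cycVal_polar, zsmul_dyadic]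
      congr 1
      ring)

theorem ulift_eq_zero_iff {k : ℕ} (a : ℤ) :
    (⟨(a : ZMod (2 ^ k))⟩ : ULift.{u} (ZMod (2 ^ k))) = 0 ↔ (2 : ℤ) ^ k ∣ a := by
  have := ZMod.intCast_zmod_eq_zero_iff_dvd a (2 ^ k)
  push_cast at this
  rw [← this]
  exact ⟨fun h => congrArg ULift.down h, fun h => ULift.ext _ _ h⟩

theorem two_pow_nsmul_ulift {k : ℕ} (x : ULift.{u} (ZMod (2 ^ k))) : 2 ^ k • x = 0 := by
  obtain ⟨a, rfl⟩ := exists_intCast_ulift x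
  rw [← natCast_zsmul, ulift_smul, ulift_eq_zero_iff]
  push_cast
  exact dvd_mul_right _ _

/-- The cyclic form `n x ^ 2 / 2 ^ (k + 2)` on `ℤ / 2 ^ (k + 1)`, for `n` odd. -/
def cyc (k : ℕ) (n : ℤ) (hn : Odd n) : QuadTwoGroup.{u} where
  G := ULift.{u} (ZMod (2 ^ (k + 1)))
  card_eq := ⟨k + 1, by simp⟩
  form := cycForm k n
  nondegenerate := by
    apply nondegenerate_of
    · intro x hx
      obtain ⟨a, rfl⟩ := exists_intCast_ulift x
      have := hx ⟨((1 : ℤ) : ZMod (2 ^ (k + 1)))⟩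
      rw [show QuadraticMap.polar (cycForm k n) _ _ = _ from cycVal_polar k n a 1,
        dyadic_eq_zero_iff, mul_one] at this
      rw [ulift_eq_zero_iff]
      exact dvd_of_dvd_odd_mul hn this
    · intro f
      obtain ⟨c, hc⟩ := exists_dyadic_of_nsmul_eq_zero
        (k := k + 1) (t := f ⟨((1 : ℤ) : ZMod (2 ^ (k + 1)))⟩)
        (by rw [← map_nsmul, two_pow_nsmul_ulift, map_zero])
      obtain ⟨m, hm⟩ := exists_mul_sub_one_dvd hn (k + 1)
      refine ⟨⟨((m * c : ℤ) : ZMod (2 ^ (k + 1)))⟩, fun y => ?_⟩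
      obtain ⟨b, rfl⟩ := exists_intCast_ulift y
      rw [show QuadraticMap.polar (cycForm k n) _ _ = _ from cycVal_polar k n (m * c) b]
      have : (⟨(b : ZMod (2 ^ (k + 1)))⟩ : ULift.{u} (ZMod (2 ^ (k + 1))))
          = b • ⟨((1 : ℤ) : ZMod (2 ^ (k + 1)))⟩ := by
        rw [ulift_smul, mul_one]
      rw [this, map_zsmul, hc, zsmul_dyadic, dyadic_eq_iff]
      obtain ⟨d, hd⟩ := hm
      exact ⟨d * c * b, by linear_combination c * b * hd⟩

/-- The class of an integer in the group of a cyclic form. -/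
def cycOf (k : ℕ) (n : ℤ) (hn : Odd n) (a : ℤ) : (cyc.{u} k n hn).G :=
  (⟨(a : ZMod (2 ^ (k + 1)))⟩ : ULift.{u} (ZMod (2 ^ (k + 1))))

theorem exists_cycOf {k : ℕ} {n : ℤ} {hn : Odd n} (x : (cyc.{u} k n hn).G) :
    ∃ a, x = cycOf k n hn a := exists_intCast_ulift.{u} x

theorem cyc_form (k : ℕ) (n : ℤ) (hn : Odd n) (a : ℤ) :
    (cyc.{u} k n hn).form (cycOf k n hn a) = dyadic (k + 2) (n * a ^ 2) :=
  cycVal_intCast.{u} k n a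

theorem cyc_linking (k : ℕ) (n : ℤ) (hn : Odd n) (a b : ℤ) :
    (cyc.{u} k n hn).linking (cycOf k n hn a) (cycOf k n hn b) = dyadic (k + 1) (n * a * b) :=
  cycVal_polar.{u} k n a b

theorem zsmul_cycOf (k : ℕ) (n : ℤ) (hn : Odd n) (a b : ℤ) :
    a • cycOf.{u} k n hn b = cycOf k n hn (a * b) := ulift_smul.{u} a b

theorem cycOf_eq_zero_iff (k : ℕ) (n : ℤ) (hn : Odd n) (a : ℤ) :
    cycOf.{u} k n hn a = 0 ↔ (2 : ℤ) ^ (k + 1) ∣ a := ulift_eq_zero_iff.{u} a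

theorem card_cyc (k : ℕ) (n : ℤ) (hn : Odd n) : Nat.card (cyc.{u} k n hn).G = 2 ^ (k + 1) := by
  change Nat.card (ULift.{u} (ZMod (2 ^ (k + 1)))) = _
  simp

/-- The value of `(α x ^ 2 + υ x y + β y ^ 2) / 2 ^ (k + 1)` on `(ℤ / 2 ^ (k + 1)) ^ 2`. -/
def planeVal (k : ℕ) (α υ β : ℤ)
    (x : ULift.{u} (ZMod (2 ^ (k + 1))) × ULift.{u} (ZMod (2 ^ (k + 1)))) : QmodZ :=
  dyadic (k + 1) (α * (x.1.down.val : ℤ) ^ 2 + υ * (x.1.down.val : ℤ) * (x.2.down.val : ℤ)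
    + β * (x.2.down.val : ℤ) ^ 2)

theorem planeVal_intCast (k : ℕ) (α υ β a b : ℤ) :
    planeVal.{u} k α υ β (⟨(a : ZMod (2 ^ (k + 1)))⟩, ⟨(b : ZMod (2 ^ (k + 1)))⟩)
      = dyadic (k + 1) (α * a ^ 2 + υ * a * b + β * b ^ 2) := by
  rw [planeVal, dyadic_eq_iff]
  obtain ⟨c, hc⟩ := two_pow_dvd_val_sub a (a : ZMod (2 ^ (k + 1))) rfl
  obtain ⟨d, hd⟩ := two_pow_dvd_val_sub b (b : ZMod (2 ^ (k + 1))) rfl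
  rw [sub_eq_iff_eq_add] at hc hd
  refine ⟨α * (2 ^ (k + 1) * c ^ 2 + 2 * c * a)
    + υ * (2 ^ (k + 1) * c * d + c * b + a * d) + β * (2 ^ (k + 1) * d ^ 2 + 2 * d * b), ?_⟩
  simp only [hc, hd]
  ring

theorem planeVal_polar (k : ℕ) (α υ β a b a' b' : ℤ) :
    QuadraticMap.polar (planeVal.{u} k α υ β)
      (⟨(a : ZMod (2 ^ (k + 1)))⟩, ⟨(b : ZMod (2 ^ (k + 1)))⟩)
      (⟨(a' : ZMod (2 ^ (k + 1)))⟩, ⟨(b' : ZMod (2 ^ (k + 1)))⟩)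
      = dyadic (k + 1) (2 * α * a * a' + υ * (a * b' + a' * b) + 2 * β * b * b') := by
  rw [QuadraticMap.polar, Prod.mk_add_mk, ulift_add, ulift_add, planeVal_intCast,
    planeVal_intCast, planeVal_intCast, ← map_sub, ← map_sub]
  congr 1
  ring

/-- The quadratic map `(α x ^ 2 + υ x y + β y ^ 2) / 2 ^ (k + 1)` on `(ℤ / 2 ^ (k + 1)) ^ 2`. -/
def planeForm (k : ℕ) (α υ β : ℤ) :
    QuadraticMap ℤ (ULift.{u} (ZMod (2 ^ (k + 1))) × ULift.{u} (ZMod (2 ^ (k + 1)))) QmodZ :=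
  QuadraticMap.ofPolar (planeVal k α υ β)
    (by
      rintro c ⟨x, y⟩
      obtain ⟨a, rfl⟩ := exists_intCast_ulift x
      obtain ⟨b, rfl⟩ := exists_intCast_ulift y
      rw [Prod.smul_mk, ulift_smul, ulift_smul, planeVal_intCast, planeVal_intCast, zsmul_dyadic]
      congr 1
      ring)
    (by
      rintro ⟨x, y⟩ ⟨x', y'⟩ ⟨x'', y''⟩
      obtain ⟨a, rfl⟩ := exists_intCast_ulift x
      obtain ⟨b, rfl⟩ := exists_intCast_ulift y
      obtain ⟨a', rfl⟩ := exists_intCast_ulift x'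
      obtain ⟨b', rfl⟩ := exists_intCast_ulift y'
      obtain ⟨a'', rfl⟩ := exists_intCast_ulift x''
      obtain ⟨b'', rfl⟩ := exists_intCast_ulift y''
      rw [Prod.mk_add_mk, ulift_add, ulift_add, planeVal_polar, planeVal_polar, planeVal_polar,
        ← map_add]
      congr 1
      ring)
    (by
      rintro c ⟨x, y⟩ ⟨x', y'⟩
      obtain ⟨a, rfl⟩ := exists_intCast_ulift x
      obtain ⟨b, rfl⟩ := exists_intCast_ulift y
      obtain ⟨a', rfl⟩ := exists_intCast_ulift x'
      obtain ⟨b', rfl⟩ := exists_intCast_ulift y'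
      rw [Prod.smul_mk, ulift_smul, ulift_smul, planeVal_polar, planeVal_polar, zsmul_dyadic]
      congr 1
      ring)

/-- The even plane `(α x ^ 2 + υ x y + β y ^ 2) / 2 ^ (k + 1)` on `(ℤ / 2 ^ (k + 1)) ^ 2`,
for `υ` odd. -/
def plane (k : ℕ) (α υ β : ℤ) (hυ : Odd υ) : QuadTwoGroup.{u} where
  G := ULift.{u} (ZMod (2 ^ (k + 1))) × ULift.{u} (ZMod (2 ^ (k + 1)))
  card_eq := ⟨(k + 1) + (k + 1), by simp [pow_add]⟩
  form := planeForm k α υ β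
  nondegenerate := by
    -- Up to sign this is the determinant of the Gram matrix. Being odd, it is invertible modulo
    -- powers of two, and Cramer's rule gives both the injectivity and the preimages.
    have hdisc : Odd (υ ^ 2 - 4 * α * β) := by
      obtain ⟨w, rfl⟩ := hυ
      exact ⟨2 * w ^ 2 + 2 * w - 2 * α * β, by ring⟩
    have hpolar : ∀ a b a' b' : ℤ, QuadraticMap.polar (planeForm.{u} k α υ β)
        (⟨(a : ZMod (2 ^ (k + 1)))⟩, ⟨(b : ZMod (2 ^ (k + 1)))⟩)
        (⟨(a' : ZMod (2 ^ (k + 1)))⟩, ⟨(b' : ZMod (2 ^ (k + 1)))⟩)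
        = dyadic (k + 1) (2 * α * a * a' + υ * (a * b' + a' * b) + 2 * β * b * b') :=
      planeVal_polar k α υ β
    apply nondegenerate_of
    · rintro ⟨x, y⟩ hx
      obtain ⟨a, rfl⟩ := exists_intCast_ulift x
      obtain ⟨b, rfl⟩ := exists_intCast_ulift y
      have h1 := hx (⟨((1 : ℤ) : ZMod (2 ^ (k + 1)))⟩, ⟨((0 : ℤ) : ZMod (2 ^ (k + 1)))⟩)
      have h2 := hx (⟨((0 : ℤ) : ZMod (2 ^ (k + 1)))⟩, ⟨((1 : ℤ) : ZMod (2 ^ (k + 1)))⟩)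
      rw [hpolar, dyadic_eq_zero_iff] at h1 h2
      obtain ⟨c, hc⟩ := h1
      obtain ⟨d, hd⟩ := h2
      refine Prod.ext ?_ ?_
      · exact (ulift_eq_zero_iff a).2 (dvd_of_dvd_odd_mul hdisc
          ⟨υ * d - 2 * β * c, by linear_combination υ * hd - 2 * β * hc⟩)
      · exact (ulift_eq_zero_iff b).2 (dvd_of_dvd_odd_mul hdisc
          ⟨υ * c - 2 * α * d, by linear_combination υ * hc - 2 * α * hd⟩)
    · intro f
      obtain ⟨c, hc⟩ := exists_dyadic_of_nsmul_eq_zero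
        (k := k + 1) (t := f (⟨((1 : ℤ) : ZMod (2 ^ (k + 1)))⟩, 0))
        (by rw [← map_nsmul, Prod.smul_mk, two_pow_nsmul_ulift, nsmul_zero, ← Prod.zero_eq_mk,
          map_zero])
      obtain ⟨d, hd⟩ := exists_dyadic_of_nsmul_eq_zero
        (k := k + 1) (t := f (0, ⟨((1 : ℤ) : ZMod (2 ^ (k + 1)))⟩))
        (by rw [← map_nsmul, Prod.smul_mk, nsmul_zero, two_pow_nsmul_ulift, ← Prod.zero_eq_mk,
          map_zero])
      obtain ⟨m, w, hm⟩ := exists_mul_sub_one_dvd hdisc (k + 1)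
      refine ⟨(⟨((m * (υ * d - 2 * β * c) : ℤ) : ZMod (2 ^ (k + 1)))⟩,
        ⟨((m * (υ * c - 2 * α * d) : ℤ) : ZMod (2 ^ (k + 1)))⟩), ?_⟩
      rintro ⟨x, y⟩
      obtain ⟨a, rfl⟩ := exists_intCast_ulift x
      obtain ⟨b, rfl⟩ := exists_intCast_ulift y
      rw [hpolar]
      have : ((⟨(a : ZMod (2 ^ (k + 1)))⟩, ⟨(b : ZMod (2 ^ (k + 1)))⟩) :
          ULift.{u} (ZMod (2 ^ (k + 1))) × ULift.{u} (ZMod (2 ^ (k + 1))))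
          = a • (⟨((1 : ℤ) : ZMod (2 ^ (k + 1)))⟩, 0)
            + b • (0, ⟨((1 : ℤ) : ZMod (2 ^ (k + 1)))⟩) := by
        rw [Prod.smul_mk, Prod.smul_mk, ulift_smul, ulift_smul, mul_one, mul_one, zsmul_zero,
          zsmul_zero, Prod.mk_add_mk, add_zero, zero_add]
      rw [this, f.map_add, map_zsmul, map_zsmul, hc, hd, zsmul_dyadic, zsmul_dyadic, ← map_add,
        dyadic_eq_iff]
      exact ⟨w * (a * c + b * d), by linear_combination (a * c + b * d) * hm⟩

/-- The class of a pair of integers in the group of an even plane. -/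
def planeOf (k : ℕ) (α υ β : ℤ) (hυ : Odd υ) (a b : ℤ) : (plane.{u} k α υ β hυ).G :=
  ((⟨(a : ZMod (2 ^ (k + 1)))⟩, ⟨(b : ZMod (2 ^ (k + 1)))⟩) :
    ULift.{u} (ZMod (2 ^ (k + 1))) × ULift.{u} (ZMod (2 ^ (k + 1))))

theorem exists_planeOf {k : ℕ} {α υ β : ℤ} {hυ : Odd υ} (x : (plane.{u} k α υ β hυ).G) :
    ∃ a b, x = planeOf k α υ β hυ a b := by
  obtain ⟨a, ha⟩ := exists_intCast_ulift.{u} x.1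
  obtain ⟨b, hb⟩ := exists_intCast_ulift.{u} x.2
  exact ⟨a, b, Prod.ext ha hb⟩

theorem plane_form (k : ℕ) (α υ β : ℤ) (hυ : Odd υ) (a b : ℤ) :
    (plane.{u} k α υ β hυ).form (planeOf k α υ β hυ a b)
      = dyadic (k + 1) (α * a ^ 2 + υ * a * b + β * b ^ 2) :=
  planeVal_intCast.{u} k α υ β a b

theorem plane_linking (k : ℕ) (α υ β : ℤ) (hυ : Odd υ) (a b a' b' : ℤ) :
    (plane.{u} k α υ β hυ).linking (planeOf k α υ β hυ a b) (planeOf k α υ β hυ a' b')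
      = dyadic (k + 1) (2 * α * a * a' + υ * (a * b' + a' * b) + 2 * β * b * b') :=
  planeVal_polar.{u} k α υ β a b a' b'

theorem zsmul_planeOf (k : ℕ) (α υ β : ℤ) (hυ : Odd υ) (c a b : ℤ) :
    c • planeOf.{u} k α υ β hυ a b = planeOf k α υ β hυ (c * a) (c * b) :=
  Prod.ext (ulift_smul.{u} c a) (ulift_smul.{u} c b)

theorem planeOf_eq_zero_iff (k : ℕ) (α υ β : ℤ) (hυ : Odd υ) (a b : ℤ) :
    planeOf.{u} k α υ β hυ a b = 0 ↔ (2 : ℤ) ^ (k + 1) ∣ a ∧ (2 : ℤ) ^ (k + 1) ∣ b := by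
  rw [← ulift_eq_zero_iff.{u}, ← ulift_eq_zero_iff.{u}]
  exact Prod.ext_iff

theorem card_plane (k : ℕ) (α υ β : ℤ) (hυ : Odd υ) :
    Nat.card (plane.{u} k α υ β hυ).G = 2 ^ (k + 1) * 2 ^ (k + 1) := by
  change Nat.card (ULift.{u} (ZMod (2 ^ (k + 1))) × ULift.{u} (ZMod (2 ^ (k + 1)))) = _
  simp

/-- The homomorphism from `ℤ / 2 ^ k` with prescribed image of `1`. -/
theorem exists_zmod_hom {A : Type*} [AddCommGroup A] {k : ℕ} {h : A} (hh : 2 ^ k • h = 0) :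
    ∃ f : ULift.{u} (ZMod (2 ^ k)) →+ A, ∀ a : ℤ, f ⟨(a : ZMod (2 ^ k))⟩ = a • h := by
  obtain ⟨f, hf⟩ : ∃ f : ZMod (2 ^ k) →+ A, ∀ a : ℤ, f a = a • h :=
    ⟨ZMod.lift (2 ^ k) ⟨zmultiplesHom A h, (natCast_zsmul h (2 ^ k)).trans hh⟩,
      fun a => by rw [ZMod.lift_coe]; rfl⟩
  exact ⟨f.comp (AddEquiv.ulift (α := ZMod (2 ^ k))).toAddMonoidHom, hf⟩

/-- It suffices that `2^(k+1)` annihilates `h`: injectivity follows from nondegeneracy, and equal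
cardinalities then give an isomorphism by `Emb.cls_eq`. The description of the image serves to check
orthogonality. -/
theorem exists_emb_cyc {q : QuadTwoGroup.{u}} (k : ℕ) (n : ℤ) (hn : Odd n) (h : q.G)
    (h₁ : 2 ^ (k + 1) • h = 0) (h₂ : q.form h = dyadic (k + 2) n) :
    ∃ f : Emb (cyc k n hn) q, ∀ x, ∃ a : ℤ, f.hom x = a • h := by
  have : ∃ f : (cyc k n hn).G →+ q.G, ∀ a, f (cycOf k n hn a) = a • h := exists_zmod_hom.{u} h₁
  obtain ⟨f, hf⟩ := this
  refine ⟨⟨f, fun x => ?_⟩, fun x => ?_⟩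
  · obtain ⟨a, rfl⟩ := exists_cycOf x
    rw [cyc_form, hf, form_zsmul, h₂, zsmul_dyadic]
    congr 1
    ring
  · obtain ⟨a, rfl⟩ := exists_cycOf x
    exact ⟨a, hf a⟩

theorem exists_emb_plane {q : QuadTwoGroup.{u}} (k : ℕ) (α υ β : ℤ) (hυ : Odd υ) (h h' : q.G)
    (h₁ : 2 ^ (k + 1) • h = 0) (h₁' : 2 ^ (k + 1) • h' = 0)
    (h₂ : q.form h = dyadic (k + 1) α) (h₂' : q.form h' = dyadic (k + 1) β)
    (h₃ : q.linking h h' = dyadic (k + 1) υ) :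
    ∃ f : Emb (plane k α υ β hυ) q, ∀ x, ∃ a b : ℤ, f.hom x = a • h + b • h' := by
  obtain ⟨f, hf⟩ := exists_zmod_hom.{u} h₁
  obtain ⟨f', hf'⟩ := exists_zmod_hom.{u} h₁'
  have : ∃ g : (plane k α υ β hυ).G →+ q.G, ∀ a b,
      g (planeOf k α υ β hυ a b) = a • h + b • h' :=
    ⟨f.coprod f', fun a b => by
      rw [← hf, ← hf']; rfl⟩
  obtain ⟨g, hg⟩ := this
  refine ⟨⟨g, fun x => ?_⟩, fun x => ?_⟩
  · obtain ⟨a, b, rfl⟩ := exists_planeOf x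
    rw [plane_form, hg, form_add, form_zsmul, form_zsmul, linking_zsmul_left,
      linking_zsmul_right, h₂, h₂', h₃, zsmul_dyadic, zsmul_dyadic, zsmul_dyadic, zsmul_dyadic,
      ← map_add, ← map_add]
    congr 1
    ring
  · obtain ⟨a, b, rfl⟩ := exists_planeOf x
    exact ⟨a, b, hg a b⟩

end QuadTwoGroup

/-! ### Isomorphisms between sums of elementary forms -/

/-- Quadratic polynomials with odd linear and even constant coefficient have roots modulo every
power of two. -/
theorem exists_two_pow_dvd_quadratic (B : ℤ) {U C : ℤ} (hU : Odd U) (hC : Even C) (N : ℕ) :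
    ∃ s : ℤ, (2 : ℤ) ^ N ∣ B * s ^ 2 + U * s + C := by
  suffices ∃ s : ℤ, (2 : ℤ) ^ (N + 1) ∣ B * s ^ 2 + U * s + C by
    obtain ⟨s, hs⟩ := this
    exact ⟨s, (pow_dvd_pow 2 (Nat.le_succ N)).trans hs⟩
  induction N with
  | zero => exact ⟨0, by simpa using hC.two_dvd⟩
  | succ N ih =>
    obtain ⟨s, c, hc⟩ := ih
    rcases Int.even_or_odd' c with ⟨d, rfl | rfl⟩
    · exact ⟨s, d, by rw [hc]; ring⟩
    -- The quotient is odd here. Replacing `s` by `s + 2^(N+1)` adds `U 2^(N+1)` modulo `2^(N+2)`,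
    -- which makes it even.
    · obtain ⟨v, rfl⟩ := hU
      exact ⟨s + 2 ^ (N + 1), d + 1 + v + B * s + B * 2 ^ N, by linear_combination hc⟩

theorem intCast_zmod_eight_mul_self {a : ℤ} (ha : Odd a) :
    (a : ZMod 8) * (a : ZMod 8) = 1 := by
  obtain ⟨b, rfl⟩ := ha
  push_cast
  generalize (b : ZMod 8) = x
  revert x
  decide

theorem eight_dvd_sub_iff (m n : ℤ) : (8 : ℤ) ∣ m - n ↔ (m : ZMod 8) = n := by
  rw [← sub_eq_zero, ← Int.cast_sub]
  exact (ZMod.intCast_zmod_eq_zero_iff_dvd (m - n) 8).symm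

namespace QuadTwoGroup

theorem two_pow_nsmul_cycOf {k j : ℕ} {n : ℤ} {hn : Odd n} {a : ℤ}
    (h : (2 : ℤ) ^ (k + 1) ∣ 2 ^ j * a) : 2 ^ j • cycOf.{u} k n hn a = 0 := by
  rw [← natCast_zsmul, zsmul_cycOf, cycOf_eq_zero_iff]
  exact_mod_cast h

theorem two_pow_nsmul_planeOf {k j : ℕ} {α υ β : ℤ} {hυ : Odd υ} {a b : ℤ}
    (h : (2 : ℤ) ^ (k + 1) ∣ 2 ^ j * a) (h' : (2 : ℤ) ^ (k + 1) ∣ 2 ^ j * b) :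
    2 ^ j • planeOf.{u} k α υ β hυ a b = 0 := by
  rw [← natCast_zsmul, zsmul_planeOf, planeOf_eq_zero_iff]
  push_cast
  exact ⟨h, h'⟩

/-- If `n - m = 8c`, then `n (1 + 2s)² - m = 4 (n s² + n s + 2c)`, and the bracket has a root modulo
`2^k`. So `1 ↦ 1 + 2s` is the isometry. -/
theorem cls_cyc_congr (k : ℕ) {m n : ℤ} (hm : Odd m) (hn : Odd n) (h : (m : ZMod 8) = n) :
    (cyc.{u} k m hm).cls = (cyc k n hn).cls := by
  obtain ⟨c, hc⟩ := (eight_dvd_sub_iff n m).2 h.symm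
  obtain ⟨s, e, hs⟩ := exists_two_pow_dvd_quadratic n hn (even_two_mul c) k
  obtain ⟨f, -⟩ := exists_emb_cyc (q := cyc.{u} k n hn) k m hm (cycOf k n hn (1 + 2 * s))
    (two_pow_nsmul_cycOf (dvd_mul_right _ _)) (by
      rw [cyc_form, dyadic_eq_iff]
      exact ⟨e, by linear_combination 4 * hs + hc⟩)
  exact f.cls_eq (by rw [card_cyc, card_cyc])

/-- On `ℤ/2` the only nonzero value is `n/4`, which sees `n` modulo 4 only. This is the sole source
of ambiguity of the total parity when index 1 is irregular. -/
theorem cls_cyc_zero_congr {n : ℤ} (hn : Odd n) (hn' : Odd (n + 4)) :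
    (cyc.{u} 0 n hn).cls = (cyc 0 (n + 4) hn').cls := by
  obtain ⟨f, -⟩ := exists_emb_cyc (q := cyc.{u} 0 (n + 4) hn') 0 n hn (cycOf 0 (n + 4) hn' 1)
    (two_pow_nsmul_cycOf (dvd_mul_right _ _)) (by
      rw [cyc_form, dyadic_eq_iff]
      exact ⟨1, by ring⟩)
  exact f.cls_eq (by rw [card_cyc, card_cyc])

theorem cls_plane_swap (k : ℕ) (α υ β : ℤ) (hυ : Odd υ) :
    (plane.{u} k α υ β hυ).cls = (plane k β υ α hυ).cls := by
  obtain ⟨f, -⟩ := exists_emb_plane (q := plane.{u} k β υ α hυ) k α υ β hυ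
    (planeOf k β υ α hυ 0 1) (planeOf k β υ α hυ 1 0)
    (two_pow_nsmul_planeOf (dvd_mul_right _ _) (dvd_mul_right _ _))
    (two_pow_nsmul_planeOf (dvd_mul_right _ _) (dvd_mul_right _ _))
    (by rw [plane_form]; congr 1; ring) (by rw [plane_form]; congr 1; ring)
    (by rw [plane_linking]; congr 1; ring)
  exact f.cls_eq (by rw [card_plane, card_plane])

/-- A root `t` of `β t² + υ t + α` makes `v = (1, t)` isotropic. With `w` inverse to the numerator
of `λ(v, (0, 1))`, the vector `w (0, 1) - β w² v` is isotropic too and has numerator 1 against `v`.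
-/
theorem cls_plane_eq_of_even_left (k : ℕ) {α υ β : ℤ} (hυ : Odd υ) (hα : Even α) :
    (plane.{u} k α υ β hυ).cls = (plane k 0 1 0 odd_one).cls := by
  obtain ⟨t, e₁, h₁⟩ := exists_two_pow_dvd_quadratic β hυ hα (k + 1)
  have hU : Odd (υ + 2 * β * t) := by rw [mul_assoc]; exact hυ.add_even (even_two_mul _)
  obtain ⟨w, e₂, h₂⟩ := exists_mul_sub_one_dvd hU (k + 1)
  symm
  obtain ⟨f, -⟩ := exists_emb_plane (q := plane.{u} k α υ β hυ) k 0 1 0 odd_one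
    (planeOf k α υ β hυ 1 t) (planeOf k α υ β hυ (-(β * w ^ 2)) (w - β * w ^ 2 * t))
    (two_pow_nsmul_planeOf (dvd_mul_right _ _) (dvd_mul_right _ _))
    (two_pow_nsmul_planeOf (dvd_mul_right _ _) (dvd_mul_right _ _))
    (by
      rw [plane_form, dyadic_eq_iff]
      exact ⟨e₁, by linear_combination h₁⟩)
    (by
      rw [plane_form, dyadic_eq_iff]
      exact ⟨(β * w ^ 2) ^ 2 * e₁ - β * w ^ 2 * e₂,
        by linear_combination (β * w ^ 2) ^ 2 * h₁ - β * w ^ 2 * h₂⟩)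
    (by
      rw [plane_linking, dyadic_eq_iff]
      exact ⟨e₂ - 2 * (β * w ^ 2) * e₁, by linear_combination h₂ - 2 * (β * w ^ 2) * h₁⟩)
  exact f.cls_eq (by rw [card_plane, card_plane])

theorem cls_plane_eq_of_even (k : ℕ) {α υ β : ℤ} (hυ : Odd υ) (h : Even (α * β)) :
    (plane.{u} k α υ β hυ).cls = (plane k 0 1 0 odd_one).cls := by
  rcases Int.even_mul.1 h with h | h
  · exact cls_plane_eq_of_even_left k hυ h
  · rw [cls_plane_swap]
    exact cls_plane_eq_of_even_left k hυ h

/-- Choose `t` so that `v = (1, t)` has numerator 1, and `u = w (0, 1)` with pairing numerator 1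
against `v`; then `u` has numerator `γ = β w²`. The vector `s v + (1 - 2s) u` still pairs to 1 with
`v`, and its numerator is 1 when `(4γ - 1) s² + (1 - 4γ) s + γ - 1` vanishes, which is solvable
because `γ` is odd. -/
theorem cls_plane_eq_of_odd (k : ℕ) {α υ β : ℤ} (hυ : Odd υ) (hα : Odd α) (hβ : Odd β) :
    (plane.{u} k α υ β hυ).cls = (plane k 1 1 1 odd_one).cls := by
  obtain ⟨t, e₁, h₁⟩ := exists_two_pow_dvd_quadratic β hυ (hα.sub_odd odd_one) (k + 1)
  have hU : Odd (υ + 2 * β * t) := by rw [mul_assoc]; exact hυ.add_even (even_two_mul _)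
  obtain ⟨w, e₂, h₂⟩ := exists_mul_sub_one_dvd hU (k + 1)
  have hw : Odd w := by
    by_contra hw
    rw [Int.not_odd_iff_even] at hw
    have h3 : Odd ((υ + 2 * β * t) * w - 1) := (hw.mul_left _).sub_odd odd_one
    rw [h₂] at h3
    exact (Int.not_odd_iff_even.2 (((even_two).pow_of_ne_zero k.succ_ne_zero).mul_right e₂)) h3
  have hγ : Odd (β * w ^ 2) := hβ.mul hw.pow
  obtain ⟨s, e₃, h₃⟩ := exists_two_pow_dvd_quadratic (4 * (β * w ^ 2) - 1)
    (U := 1 - 4 * (β * w ^ 2)) (C := β * w ^ 2 - 1)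
    (odd_one.sub_even (Even.mul_right (by decide) _)) (hγ.sub_odd odd_one) (k + 1)
  symm
  obtain ⟨f, -⟩ := exists_emb_plane (q := plane.{u} k α υ β hυ) k 1 1 1 odd_one
    (planeOf k α υ β hυ 1 t) (planeOf k α υ β hυ s (s * t + (1 - 2 * s) * w))
    (two_pow_nsmul_planeOf (dvd_mul_right _ _) (dvd_mul_right _ _))
    (two_pow_nsmul_planeOf (dvd_mul_right _ _) (dvd_mul_right _ _))
    (by
      rw [plane_form, dyadic_eq_iff]
      exact ⟨e₁, by linear_combination h₁⟩)
    (by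
      rw [plane_form, dyadic_eq_iff]
      exact ⟨s ^ 2 * e₁ + s * (1 - 2 * s) * e₂ + e₃,
        by linear_combination s ^ 2 * h₁ + s * (1 - 2 * s) * h₂ + h₃⟩)
    (by
      rw [plane_linking, dyadic_eq_iff]
      exact ⟨2 * s * e₁ + (1 - 2 * s) * e₂,
        by linear_combination 2 * s * h₁ + (1 - 2 * s) * h₂⟩)
  exact f.cls_eq (by rw [card_plane, card_plane])

theorem card_orthSum (p q : QuadTwoGroup.{u}) :
    Nat.card (p.orthSum q).G = Nat.card p.G * Nat.card q.G := Nat.card_prod _ _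

/-- The scheme for verifying relations: two orthogonal vectors with the right values suffice, since
injectivity is automatic and the order forces surjectivity. -/
theorem cls_eq_cyc_add_cyc {q : QuadTwoGroup.{u}} (k j : ℕ) (n m : ℤ) (hn : Odd n) (hm : Odd m)
    (h h' : q.G) (h₁ : 2 ^ (k + 1) • h = 0) (h₂ : 2 ^ (j + 1) • h' = 0)
    (h₃ : q.form h = dyadic (k + 2) n) (h₄ : q.form h' = dyadic (j + 2) m)
    (h₅ : q.linking h h' = 0) (hc : Nat.card q.G = 2 ^ (k + 1) * 2 ^ (j + 1)) :
    q.cls = (cyc k n hn).cls + (cyc j m hm).cls := by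
  obtain ⟨f, hf⟩ := exists_emb_cyc k n hn h h₁ h₃
  obtain ⟨g, hg⟩ := exists_emb_cyc j m hm h' h₂ h₄
  have := (f.sum g (by
    intro x y
    obtain ⟨a, ha⟩ := hf x
    obtain ⟨b, hb⟩ := hg y
    rw [ha, hb, linking_zsmul_left, linking_zsmul_right, h₅, zsmul_zero, zsmul_zero])).cls_eq
    (by rw [card_orthSum, card_cyc, card_cyc, hc])
  rw [← this, cls_orthSum]

theorem cls_eq_cyc_add_plane {q : QuadTwoGroup.{u}} (k j : ℕ) (n α υ β : ℤ) (hn : Odd n)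
    (hυ : Odd υ) (h x y : q.G) (h₁ : 2 ^ (k + 1) • h = 0) (hx : 2 ^ (j + 1) • x = 0)
    (hy : 2 ^ (j + 1) • y = 0) (h₃ : q.form h = dyadic (k + 2) n)
    (hx' : q.form x = dyadic (j + 1) α) (hy' : q.form y = dyadic (j + 1) β)
    (hxy : q.linking x y = dyadic (j + 1) υ) (h₄ : q.linking h x = 0) (h₅ : q.linking h y = 0)
    (hc : Nat.card q.G = 2 ^ (k + 1) * (2 ^ (j + 1) * 2 ^ (j + 1))) :
    q.cls = (cyc k n hn).cls + (plane j α υ β hυ).cls := by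
  obtain ⟨f, hf⟩ := exists_emb_cyc k n hn h h₁ h₃
  obtain ⟨g, hg⟩ := exists_emb_plane j α υ β hυ x y hx hy hx' hy' hxy
  have := (f.sum g (by
    intro z w
    obtain ⟨a, ha⟩ := hf z
    obtain ⟨b, c, hb⟩ := hg w
    rw [ha, hb, linking_zsmul_left, linking_add_right, linking_zsmul_right, linking_zsmul_right,
      h₄, h₅, zsmul_zero, zsmul_zero, add_zero, zsmul_zero])).cls_eq
    (by rw [card_orthSum, card_cyc, card_plane, hc])
  rw [← this, cls_orthSum]

/-- The vectors `(1, 2)` and `(-2b, a)` are orthogonal with numerators `a + 4b` and `ab(a + 4b)`.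
Since odd squares are 1 modulo 8, these are `a + 4` and `b + 4` there. -/
theorem cls_cyc_add_cyc_same (k : ℕ) {a b : ℤ} (ha : Odd a) (hb : Odd b) (ha' : Odd (a + 4))
    (hb' : Odd (b + 4)) :
    (cyc.{u} k a ha).cls + (cyc k b hb).cls = (cyc k (a + 4) ha').cls + (cyc k (b + 4) hb').cls := by
  have hn : Odd (a + 4 * b) := ha.add_even (Even.mul_right (by decide) _)
  have hm : Odd (a * b * (a + 4 * b)) := (ha.mul hb).mul hn
  have ha8 := intCast_zmod_eight_mul_self ha
  have hb8 := intCast_zmod_eight_mul_self hb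
  rw [← cls_orthSum, cls_eq_cyc_add_cyc k k (a + 4 * b) (a * b * (a + 4 * b)) hn hm
    (q := (cyc k a ha).orthSum (cyc k b hb)) (pair (cycOf k a ha 1) (cycOf k b hb 2))
    (pair (cycOf k a ha (-2 * b)) (cycOf k b hb a))
    (nsmul_pair_eq_zero (two_pow_nsmul_cycOf (dvd_mul_right _ _)) (two_pow_nsmul_cycOf (dvd_mul_right _ _)))
    (nsmul_pair_eq_zero (two_pow_nsmul_cycOf (dvd_mul_right _ _)) (two_pow_nsmul_cycOf (dvd_mul_right _ _)))
    (by
      rw [orthSum_form, cyc_form, cyc_form, ← map_add]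
      congr 1; ring)
    (by
      rw [orthSum_form, cyc_form, cyc_form, ← map_add]
      congr 1; ring)
    (by
      rw [orthSum_linking, cyc_linking, cyc_linking, ← map_add, dyadic_eq_zero_iff]
      exact ⟨0, by ring⟩)
    (by rw [card_orthSum, card_cyc, card_cyc])]
  congr 1
  · apply cls_cyc_congr
    push_cast
    generalize (a : ZMod 8) = x at *
    generalize (b : ZMod 8) = y at *
    revert x y
    decide
  · apply cls_cyc_congr
    push_cast
    generalize (a : ZMod 8) = x at *
    generalize (b : ZMod 8) = y at *
    revert x y
    decide

/-- The orthogonal vectors are `(b, -2a)` and `(1, 1)`. Over the denominators of the two levels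
their numerators are `ab(b + 2a) ≡ a + 2b` modulo 8 and `b + 2a`. -/
theorem cls_cyc_add_cyc_succ (k : ℕ) {a b : ℤ} (ha : Odd a) (hb : Odd b) (ha' : Odd (a + 2 * b))
    (hb' : Odd (b + 2 * a)) :
    (cyc.{u} k a ha).cls + (cyc (k + 1) b hb).cls
      = (cyc k (a + 2 * b) ha').cls + (cyc (k + 1) (b + 2 * a) hb').cls := by
  have hn : Odd (a * b * (b + 2 * a)) := (ha.mul hb).mul hb'
  have ha8 := intCast_zmod_eight_mul_self ha
  have hb8 := intCast_zmod_eight_mul_self hb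
  rw [← cls_orthSum, cls_eq_cyc_add_cyc k (k + 1) (a * b * (b + 2 * a)) (b + 2 * a) hn hb'
    (q := (cyc k a ha).orthSum (cyc (k + 1) b hb)) (pair (cycOf k a ha b) (cycOf (k + 1) b hb (-2 * a)))
    (pair (cycOf k a ha 1) (cycOf (k + 1) b hb 1))
    (nsmul_pair_eq_zero (two_pow_nsmul_cycOf (dvd_mul_right _ _))
      (two_pow_nsmul_cycOf ⟨-a, by ring⟩))
    (nsmul_pair_eq_zero (two_pow_nsmul_cycOf ⟨2, by ring⟩) (two_pow_nsmul_cycOf (dvd_mul_right _ _)))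
    (by
      rw [orthSum_form, cyc_form, cyc_form, ← dyadic_succ_two_mul (k + 2), ← map_add,
        ← dyadic_succ_two_mul (k + 2)]
      congr 1; ring)
    (by
      rw [orthSum_form, cyc_form, cyc_form, ← dyadic_succ_two_mul (k + 2), ← map_add]
      congr 1; ring)
    (by
      rw [orthSum_linking, cyc_linking, cyc_linking, ← dyadic_succ_two_mul (k + 1), ← map_add,
        dyadic_eq_zero_iff]
      exact ⟨0, by ring⟩)
    (by rw [card_orthSum, card_cyc, card_cyc])]
  congr 1
  apply cls_cyc_congr
  push_cast
  generalize (a : ZMod 8) = x at *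
  generalize (b : ZMod 8) = y at *
  revert x y
  decide

/-- As for neighbouring levels, with `(b, -4a)` and `(1, 1)`: the gap of two levels replaces the
factor 2 by 4, so that signs are kept and only the factors 5 change. -/
theorem cls_cyc_add_cyc_succ_succ (k : ℕ) {a b : ℤ} (ha : Odd a) (hb : Odd b) (ha' : Odd (a + 4))
    (hb' : Odd (b + 4)) :
    (cyc.{u} k a ha).cls + (cyc (k + 2) b hb).cls
      = (cyc k (a + 4) ha').cls + (cyc (k + 2) (b + 4) hb').cls := by
  have hm : Odd (b + 4 * a) := hb.add_even (Even.mul_right (by decide) _)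
  have hn : Odd (a * b * (b + 4 * a)) := (ha.mul hb).mul hm
  have ha8 := intCast_zmod_eight_mul_self ha
  have hb8 := intCast_zmod_eight_mul_self hb
  rw [← cls_orthSum, cls_eq_cyc_add_cyc k (k + 2) (a * b * (b + 4 * a)) (b + 4 * a) hn hm
    (q := (cyc k a ha).orthSum (cyc (k + 2) b hb)) (pair (cycOf k a ha b) (cycOf (k + 2) b hb (-4 * a)))
    (pair (cycOf k a ha 1) (cycOf (k + 2) b hb 1))
    (nsmul_pair_eq_zero (two_pow_nsmul_cycOf (dvd_mul_right _ _))
      (two_pow_nsmul_cycOf ⟨-a, by ring⟩))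
    (nsmul_pair_eq_zero (two_pow_nsmul_cycOf ⟨4, by ring⟩) (two_pow_nsmul_cycOf (dvd_mul_right _ _)))
    (by
      rw [orthSum_form, cyc_form, cyc_form, ← dyadic_add_pow_mul (k + 2) 2, ← map_add,
        ← dyadic_add_pow_mul (k + 2) 2]
      congr 1; ring)
    (by
      rw [orthSum_form, cyc_form, cyc_form, ← dyadic_add_pow_mul (k + 2) 2, ← map_add]
      congr 1; ring)
    (by
      rw [orthSum_linking, cyc_linking, cyc_linking, ← dyadic_add_pow_mul (k + 1) 2, ← map_add,
        dyadic_eq_zero_iff]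
      exact ⟨0, by ring⟩)
    (by rw [card_orthSum, card_cyc, card_cyc])]
  congr 1
  · apply cls_cyc_congr
    push_cast
    generalize (a : ZMod 8) = x at *
    generalize (b : ZMod 8) = y at *
    revert x y
    decide
  · apply cls_cyc_congr
    push_cast
    generalize (a : ZMod 8) = x at *
    generalize (b : ZMod 8) = y at *
    revert x y
    decide

/-- The diagonal vector `(1, 1, 1)` has numerator `a + b + c`. Its complement is spanned by `(b, -a,
0)` and `(0, c, -b)`, whose numerators `ab(a + b)` and `bc(b + c)` are even; it is therefore an even
plane. -/
theorem cls_cyc_add_cyc_add_cyc (k : ℕ) {a b c α β : ℤ} (ha : Odd a) (hb : Odd b) (hc : Odd c)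
    (hs : Odd (a + b + c)) (hυ : Odd (-(a * b * c))) (hα : a * b * (a + b) = 2 * α)
    (hβ : b * c * (b + c) = 2 * β) :
    (cyc.{u} k a ha).cls + (cyc k b hb).cls + (cyc k c hc).cls
      = (cyc k (a + b + c) hs).cls + (plane k α (-(a * b * c)) β hυ).cls := by
  rw [← cls_orthSum, ← cls_orthSum]
  refine cls_eq_cyc_add_plane k k (a + b + c) α (-(a * b * c)) β hs hυ
    (q := ((cyc k a ha).orthSum (cyc k b hb)).orthSum (cyc k c hc))
    (pair (pair (cycOf k a ha 1) (cycOf k b hb 1)) (cycOf k c hc 1))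
    (pair (pair (cycOf k a ha b) (cycOf k b hb (-a))) (cycOf k c hc 0))
    (pair (pair (cycOf k a ha 0) (cycOf k b hb c)) (cycOf k c hc (-b)))
    (nsmul_pair_eq_zero (nsmul_pair_eq_zero (two_pow_nsmul_cycOf (dvd_mul_right _ _))
      (two_pow_nsmul_cycOf (dvd_mul_right _ _))) (two_pow_nsmul_cycOf (dvd_mul_right _ _)))
    (nsmul_pair_eq_zero (nsmul_pair_eq_zero (two_pow_nsmul_cycOf (dvd_mul_right _ _))
      (two_pow_nsmul_cycOf (dvd_mul_right _ _))) (two_pow_nsmul_cycOf (dvd_mul_right _ _)))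
    (nsmul_pair_eq_zero (nsmul_pair_eq_zero (two_pow_nsmul_cycOf (dvd_mul_right _ _))
      (two_pow_nsmul_cycOf (dvd_mul_right _ _))) (two_pow_nsmul_cycOf (dvd_mul_right _ _)))
    ?_ ?_ ?_ ?_ ?_ ?_ ?_
  · rw [orthSum_form, orthSum_form, cyc_form, cyc_form, cyc_form, ← map_add, ← map_add]
    congr 1; ring
  · rw [orthSum_form, orthSum_form, cyc_form, cyc_form, cyc_form, ← map_add, ← map_add,
      ← dyadic_succ_two_mul (k + 1)]
    congr 1; linear_combination hα
  · rw [orthSum_form, orthSum_form, cyc_form, cyc_form, cyc_form, ← map_add, ← map_add,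
      ← dyadic_succ_two_mul (k + 1)]
    congr 1; linear_combination hβ
  · rw [orthSum_linking, orthSum_linking, cyc_linking, cyc_linking, cyc_linking, ← map_add,
      ← map_add]
    congr 1; ring
  · rw [orthSum_linking, orthSum_linking, cyc_linking, cyc_linking, cyc_linking, ← map_add,
      ← map_add, dyadic_eq_zero_iff]
    exact ⟨0, by ring⟩
  · rw [orthSum_linking, orthSum_linking, cyc_linking, cyc_linking, cyc_linking, ← map_add,
      ← map_add, dyadic_eq_zero_iff]
    exact ⟨0, by ring⟩
  · rw [card_orthSum, card_orthSum, card_cyc, card_cyc, card_cyc, mul_assoc]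

/-- Adding `(2, 0)`, whose value is `4 / 2^(k+2)`, to the cyclic generator shifts its numerator by
4. The complementary plane has the even outer coefficient `a² + a`, so it is hyperbolic. -/
theorem cls_cyc_add_plane_succ (k : ℕ) {a : ℤ} (ha : Odd a) (ha' : Odd (a + 4)) :
    (cyc.{u} k a ha).cls + (plane (k + 1) 1 1 1 odd_one).cls
      = (cyc k (a + 4) ha').cls + (plane (k + 1) 0 1 0 odd_one).cls := by
  have hυ : Odd (a ^ 2 + 4 * a) := ha.pow.add_even (Even.mul_right (by decide) _)
  rw [← cls_plane_eq_of_even (k + 1) (α := a ^ 2 + 4 * a) (β := a ^ 2 + a) hυ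
    (Even.mul_left (ha.pow.add_odd ha) _), ← cls_orthSum]
  refine cls_eq_cyc_add_plane k (k + 1) (a + 4) (a ^ 2 + 4 * a) _ (a ^ 2 + a) ha' hυ
    (q := (cyc k a ha).orthSum (plane (k + 1) 1 1 1 odd_one))
    (pair (cycOf k a ha 1) (planeOf (k + 1) 1 1 1 odd_one 2 0))
    (pair (cycOf k a ha (-2)) (planeOf (k + 1) 1 1 1 odd_one a 0))
    (pair (cycOf k a ha (-1)) (planeOf (k + 1) 1 1 1 odd_one 0 a))
    (nsmul_pair_eq_zero (two_pow_nsmul_cycOf (dvd_mul_right _ _))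
      (two_pow_nsmul_planeOf ⟨1, by ring⟩ ⟨0, by ring⟩))
    (nsmul_pair_eq_zero (two_pow_nsmul_cycOf ⟨-4, by ring⟩)
      (two_pow_nsmul_planeOf (dvd_mul_right _ _) (dvd_mul_right _ _)))
    (nsmul_pair_eq_zero (two_pow_nsmul_cycOf ⟨-2, by ring⟩)
      (two_pow_nsmul_planeOf (dvd_mul_right _ _) (dvd_mul_right _ _)))
    ?_ ?_ ?_ ?_ ?_ ?_ ?_
  · rw [orthSum_form, cyc_form, plane_form, ← map_add]
    congr 1; ring
  · rw [orthSum_form, cyc_form, plane_form, ← map_add]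
    congr 1; ring
  · rw [orthSum_form, cyc_form, plane_form, ← map_add]
    congr 1; ring
  · rw [orthSum_linking, cyc_linking, plane_linking, ← dyadic_succ_two_mul (k + 1), ← map_add]
    congr 1; ring
  · rw [orthSum_linking, cyc_linking, plane_linking, ← dyadic_succ_two_mul (k + 1), ← map_add,
      dyadic_eq_zero_iff]
    exact ⟨0, by ring⟩
  · rw [orthSum_linking, cyc_linking, plane_linking, ← dyadic_succ_two_mul (k + 1), ← map_add,
      dyadic_eq_zero_iff]
    exact ⟨0, by ring⟩
  · rw [card_orthSum, card_cyc, card_plane]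

/-- Here `(1, 0)` has value `1 / 2^(k+1) = 4 / 2^(k+3)`, so adding it shifts the cyclic numerator by
4. Again the complement has an even outer coefficient. -/
theorem cls_cyc_succ_add_plane (k : ℕ) {b : ℤ} (hb : Odd b) (hb' : Odd (b + 4)) :
    (cyc.{u} (k + 1) b hb).cls + (plane k 1 1 1 odd_one).cls
      = (cyc (k + 1) (b + 4) hb').cls + (plane k 0 1 0 odd_one).cls := by
  have hυ : Odd (b ^ 2 + 4 * b) := hb.pow.add_even (Even.mul_right (by decide) _)
  rw [← cls_plane_eq_of_even k (α := b ^ 2 + 4 * b) (β := b ^ 2 + b) hυ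
    (Even.mul_left (hb.pow.add_odd hb) _), ← cls_orthSum]
  refine cls_eq_cyc_add_plane (k + 1) k (b + 4) (b ^ 2 + 4 * b) _ (b ^ 2 + b) hb' hυ
    (q := (cyc (k + 1) b hb).orthSum (plane k 1 1 1 odd_one))
    (pair (cycOf (k + 1) b hb 1) (planeOf k 1 1 1 odd_one 1 0))
    (pair (cycOf (k + 1) b hb (-4)) (planeOf k 1 1 1 odd_one b 0))
    (pair (cycOf (k + 1) b hb (-2)) (planeOf k 1 1 1 odd_one 0 b))
    (nsmul_pair_eq_zero (two_pow_nsmul_cycOf (dvd_mul_right _ _))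
      (two_pow_nsmul_planeOf ⟨2, by ring⟩ ⟨0, by ring⟩))
    (nsmul_pair_eq_zero (two_pow_nsmul_cycOf ⟨-2, by ring⟩)
      (two_pow_nsmul_planeOf (dvd_mul_right _ _) (dvd_mul_right _ _)))
    (nsmul_pair_eq_zero (two_pow_nsmul_cycOf ⟨-1, by ring⟩)
      (two_pow_nsmul_planeOf (dvd_mul_right _ _) (dvd_mul_right _ _)))
    ?_ ?_ ?_ ?_ ?_ ?_ ?_
  · rw [orthSum_form, cyc_form, plane_form, ← dyadic_add_pow_mul (k + 1) 2, ← map_add]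
    congr 1; ring
  · rw [orthSum_form, cyc_form, plane_form, ← dyadic_add_pow_mul (k + 1) 2, ← map_add,
      ← dyadic_add_pow_mul (k + 1) 2]
    congr 1; ring
  · rw [orthSum_form, cyc_form, plane_form, ← dyadic_add_pow_mul (k + 1) 2, ← map_add,
      ← dyadic_add_pow_mul (k + 1) 2]
    congr 1; ring
  · rw [orthSum_linking, cyc_linking, plane_linking, ← dyadic_succ_two_mul (k + 1), ← map_add,
      ← dyadic_succ_two_mul (k + 1)]
    congr 1; ring
  · rw [orthSum_linking, cyc_linking, plane_linking, ← dyadic_succ_two_mul (k + 1), ← map_add,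
      dyadic_eq_zero_iff]
    exact ⟨0, by ring⟩
  · rw [orthSum_linking, cyc_linking, plane_linking, ← dyadic_succ_two_mul (k + 1), ← map_add,
      dyadic_eq_zero_iff]
    exact ⟨0, by ring⟩
  · rw [card_orthSum, card_cyc, card_plane]

/-- Two orthogonal planes with coefficients `(2, 1, 1)` and `(3, -3, 6)` sit inside the sum. Each
has an even outer coefficient and is hyperbolic, and together they exhaust the group. -/
theorem cls_plane_add_plane (k : ℕ) :
    (plane.{u} k 1 1 1 odd_one).cls + (plane k 1 1 1 odd_one).cls
      = (plane k 0 1 0 odd_one).cls + (plane k 0 1 0 odd_one).cls := by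
  have h3 : Odd (-3 : ℤ) := by decide
  obtain ⟨f, hf⟩ := exists_emb_plane
    (q := (plane.{u} k 1 1 1 odd_one).orthSum (plane k 1 1 1 odd_one)) k 2 1 1 odd_one
    (pair (planeOf k 1 1 1 odd_one 1 0) (planeOf k 1 1 1 odd_one 1 0))
    (pair (planeOf k 1 1 1 odd_one 0 1) (planeOf k 1 1 1 odd_one 0 0))
    (nsmul_pair_eq_zero (two_pow_nsmul_planeOf (dvd_mul_right _ _) (dvd_mul_right _ _))
      (two_pow_nsmul_planeOf (dvd_mul_right _ _) (dvd_mul_right _ _)))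
    (nsmul_pair_eq_zero (two_pow_nsmul_planeOf (dvd_mul_right _ _) (dvd_mul_right _ _))
      (two_pow_nsmul_planeOf (dvd_mul_right _ _) (dvd_mul_right _ _)))
    (by rw [orthSum_form, plane_form, ← map_add]; congr 1)
    (by rw [orthSum_form, plane_form, plane_form, ← map_add]; congr 1)
    (by rw [orthSum_linking, plane_linking, plane_linking, ← map_add]; congr 1)
  obtain ⟨g, hg⟩ := exists_emb_plane
    (q := (plane.{u} k 1 1 1 odd_one).orthSum (plane k 1 1 1 odd_one)) k 3 (-3) 6 h3
    (pair (planeOf k 1 1 1 odd_one 0 0) (planeOf k 1 1 1 odd_one 1 (-2)))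
    (pair (planeOf k 1 1 1 odd_one (-2) 1) (planeOf k 1 1 1 odd_one 1 1))
    (nsmul_pair_eq_zero (two_pow_nsmul_planeOf (dvd_mul_right _ _) (dvd_mul_right _ _))
      (two_pow_nsmul_planeOf (dvd_mul_right _ _) (dvd_mul_right _ _)))
    (nsmul_pair_eq_zero (two_pow_nsmul_planeOf (dvd_mul_right _ _) (dvd_mul_right _ _))
      (two_pow_nsmul_planeOf (dvd_mul_right _ _) (dvd_mul_right _ _)))
    (by rw [orthSum_form, plane_form, plane_form, ← map_add]; congr 1)
    (by rw [orthSum_form, plane_form, plane_form, ← map_add]; congr 1)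
    (by rw [orthSum_linking, plane_linking, plane_linking, ← map_add]; congr 1)
  have h : ∀ x y, ((plane.{u} k 1 1 1 odd_one).orthSum (plane k 1 1 1 odd_one)).linking
      (f.hom x) (g.hom y) = 0 := by
    intro x y
    obtain ⟨a, b, hab⟩ := hf x
    obtain ⟨c, d, hcd⟩ := hg y
    rw [hab, hcd]
    simp only [linking_add_left, linking_add_right, linking_zsmul_left, linking_zsmul_right,
      orthSum_linking, plane_linking, ← map_add]
    norm_num
  rw [← cls_orthSum, ← (f.sum g h).cls_eq
    (by simp only [card_orthSum, card_plane]), cls_orthSum,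
    cls_plane_eq_of_even k odd_one (by decide), cls_plane_eq_of_even k h3 (by decide)]

end QuadTwoGroup

/-! ### Symbols and the relations between their classes -/

/-- Symbols for the indecomposable forms: `odd k s f` is the form `n x ^ 2 / 2 ^ (k + 2)` on
`ℤ / 2 ^ (k + 1)` where `n = ± 5 ^ f` with sign `-` if `s` holds, and `even k f` is the form
`(f x ^ 2 + x y + f y ^ 2) / 2 ^ (k + 1)` on `(ℤ / 2 ^ (k + 1)) ^ 2`. -/
inductive Gen : Type
  | odd (k : ℕ) (s f : Bool) : Gen
  | even (k : ℕ) (f : Bool) : Gen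

namespace Gen

/-- The odd integer `± 5 ^ f`. -/
def val (s f : Bool) : ℤ := (if s then -1 else 1) * (if f then 5 else 1)

theorem odd_val (s f : Bool) : Odd (val s f) := by
  cases s <;> cases f <;> decide

theorem exists_val {n : ℤ} (hn : Odd n) : ∃ s f, (n : ZMod 8) = (val s f : ZMod 8) := by
  have h := intCast_zmod_eight_mul_self hn
  generalize (n : ZMod 8) = x at *
  revert x
  decide

/-- The isomorphism class denoted by a symbol. -/
def cls : Gen → QuadClass.{u}
  | odd k s f => (QuadTwoGroup.cyc k (val s f) (odd_val s f)).cls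
  | even k true => (QuadTwoGroup.plane k 1 1 1 odd_one).cls
  | even k false => (QuadTwoGroup.plane k 0 1 0 odd_one).cls

open QuadTwoGroup

theorem cls_cyc_eq (k : ℕ) {n : ℤ} (hn : Odd n) {s f : Bool}
    (h : (n : ZMod 8) = (val s f : ZMod 8)) : (cyc.{u} k n hn).cls = (odd k s f).cls :=
  cls_cyc_congr k hn _ h

theorem odd_val_add_four (s f : Bool) : Odd (val s f + 4) :=
  (odd_val s f).add_even (by decide)

theorem cls_cyc_add_four (k : ℕ) (s f : Bool) :
    (cyc.{u} k (val s f + 4) (odd_val_add_four s f)).cls = (odd k s !f).cls :=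
  cls_cyc_eq k _ (by revert s f; decide)

theorem cls_odd_add_odd (k : ℕ) (s f s' f' : Bool) :
    (odd k s f).cls + (odd k s' f').cls
      = ((odd k s !f).cls + (odd k s' !f').cls : QuadClass.{u}) := by
  rw [← cls_cyc_add_four, ← cls_cyc_add_four]
  exact cls_cyc_add_cyc_same k _ _ _ _

/-- Modulo 8, passing from `a` to `a + 2b` always reverses the sign and toggles the factor 5 exactly
when `a` and `b` have the same sign. -/
theorem cls_odd_add_odd_succ (k : ℕ) (s f s' f' : Bool) :
    (odd k s f).cls + (odd (k + 1) s' f').cls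
      = ((odd k (!s) (f ^^ (s == s'))).cls + (odd (k + 1) (!s') (f' ^^ (s == s'))).cls :
        QuadClass.{u}) := by
  have h : ∀ s f s' f', ((val s f + 2 * val s' f' : ℤ) : ZMod 8)
      = (val (!s) (f ^^ (s == s')) : ZMod 8) := by decide
  have h' : ∀ s f s' f', ((val s' f' + 2 * val s f : ℤ) : ZMod 8)
      = (val (!s') (f' ^^ (s == s')) : ZMod 8) := by decide
  rw [← cls_cyc_eq k ((odd_val s f).add_even (even_two_mul (val s' f'))) (h s f s' f'),
    ← cls_cyc_eq (k + 1) ((odd_val s' f').add_even (even_two_mul (val s f))) (h' s f s' f')]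
  exact cls_cyc_add_cyc_succ k _ _ _ _

theorem cls_odd_add_odd_succ_succ (k : ℕ) (s f s' f' : Bool) :
    (odd k s f).cls + (odd (k + 2) s' f').cls
      = ((odd k s !f).cls + (odd (k + 2) s' !f').cls : QuadClass.{u}) := by
  rw [← cls_cyc_add_four, ← cls_cyc_add_four]
  exact cls_cyc_add_cyc_succ_succ k _ _ _ _

/-- Split three cyclic forms with coefficients `a, a, -a`: their sum is `a`, and the complementary
plane has outer coefficient 0. -/
theorem cls_odd_add_even_false (k : ℕ) (s f : Bool) :
    (odd k s f).cls + (even k false).cls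
      = ((odd k s f).cls + (odd k s f).cls + (odd k (!s) f).cls : QuadClass.{u}) := by
  have hs : ∀ s f, Odd (val s f + val s f + val (!s) f) := by decide
  have h8 : ∀ s f, ((val s f + val s f + val (!s) f : ℤ) : ZMod 8) = (val s f : ZMod 8) := by
    decide
  have hα : val s f * val s f * (val s f + val s f) = 2 * (val s f * val s f * val s f) := by ring
  have hβ : ∀ s f, val s f * val (!s) f * (val s f + val (!s) f) = 2 * 0 := by decide
  have ho := ((odd_val s f).mul (odd_val s f)).mul (odd_val (!s) f)
  have := cls_cyc_add_cyc_add_cyc.{u} k (odd_val s f) (odd_val s f) (odd_val (!s) f) (hs s f)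
    ho.neg hα (hβ s f)
  rw [cls_plane_eq_of_even k _ (by simp), cls_cyc_eq k (hs s f) (h8 s f)] at this
  exact this.symm

/-- With `n = val s f`, reversing both the sign and the factor 5 gives `3n` modulo 8. Three such
forms have total `9n ≡ n`, and the complementary plane has odd outer coefficients. -/
theorem cls_odd_add_even_true (k : ℕ) (s f : Bool) :
    (odd k s f).cls + (even k true).cls
      = ((odd k (!s) !f).cls + (odd k (!s) !f).cls + (odd k (!s) !f).cls : QuadClass.{u}) := by
  have hs : ∀ s f, Odd (val (!s) (!f) + val (!s) (!f) + val (!s) (!f)) := by decide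
  have h8 : ∀ s f, ((val (!s) (!f) + val (!s) (!f) + val (!s) (!f) : ℤ) : ZMod 8)
      = (val s f : ZMod 8) := by decide
  have hα : val (!s) (!f) * val (!s) (!f) * (val (!s) (!f) + val (!s) (!f))
      = 2 * (val (!s) (!f) * val (!s) (!f) * val (!s) (!f)) := by ring
  have ho := ((odd_val (!s) (!f)).mul (odd_val (!s) (!f))).mul (odd_val (!s) (!f))
  have := cls_cyc_add_cyc_add_cyc.{u} k (odd_val (!s) (!f)) (odd_val (!s) (!f))
    (odd_val (!s) (!f)) (hs s f) ho.neg hα hα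
  rw [cls_plane_eq_of_odd k _ ho ho, cls_cyc_eq k (hs s f) (h8 s f)] at this
  exact this.symm

theorem cls_odd_add_even_succ (k : ℕ) (s f e : Bool) :
    (odd k s f).cls + (even (k + 1) e).cls
      = ((odd k s !f).cls + (even (k + 1) !e).cls : QuadClass.{u}) := by
  have key : ∀ f, (odd k s f).cls + (even (k + 1) true).cls
      = ((odd k s !f).cls + (even (k + 1) false).cls : QuadClass.{u}) := by
    intro f
    rw [← cls_cyc_add_four]
    exact cls_cyc_add_plane_succ k _ _
  cases e
  · have := key (!f)
    rw [Bool.not_not] at this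
    exact this.symm
  · exact key f

theorem cls_odd_succ_add_even (k : ℕ) (s f e : Bool) :
    (odd (k + 1) s f).cls + (even k e).cls
      = ((odd (k + 1) s !f).cls + (even k !e).cls : QuadClass.{u}) := by
  have key : ∀ f, (odd (k + 1) s f).cls + (even k true).cls
      = ((odd (k + 1) s !f).cls + (even k false).cls : QuadClass.{u}) := by
    intro f
    rw [← cls_cyc_add_four]
    exact cls_cyc_succ_add_plane k _ _
  cases e
  · have := key (!f)
    rw [Bool.not_not] at this
    exact this.symm
  · exact key f

theorem cls_even_add_even (k : ℕ) (e : Bool) :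
    (even k e).cls + (even k e).cls = ((even k !e).cls + (even k !e).cls : QuadClass.{u}) := by
  cases e
  · exact (cls_plane_add_plane k).symm
  · exact cls_plane_add_plane k

theorem cls_odd_zero (s f : Bool) : (odd 0 s f).cls = ((odd 0 s !f).cls : QuadClass.{u}) := by
  rw [← cls_cyc_add_four]
  exact cls_cyc_zero_congr _ _

end Gen

/-! ### Decomposition into symbols and pure representatives -/

/-- The class of the orthogonal sum of a multiset of symbols. -/
def symCls (x : Multiset Gen) : QuadClass.{u} := (x.map Gen.cls).sum

theorem symCls_zero : symCls.{u} 0 = 0 := rfl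

theorem symCls_cons (g : Gen) (x : Multiset Gen) : symCls.{u} (g ::ₘ x) = g.cls + symCls x := by
  rw [symCls, Multiset.map_cons, Multiset.sum_cons]; rfl

theorem symCls_add (x y : Multiset Gen) : symCls.{u} (x + y) = symCls x + symCls y := by
  rw [symCls, Multiset.map_add, Multiset.sum_add]; rfl

namespace QuadTwoGroup

theorem cls_eq_zero_of_subsingleton (q : QuadTwoGroup.{u}) (h : ∀ x : q.G, x = 0) : q.cls = 0 := by
  have hsub : Subsingleton q.G := ⟨fun a b => by rw [h a, h b]⟩
  rw [← cls_trivial]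
  let f : Emb (trivial.{u}) q := ⟨0, fun x => by
    rw [AddMonoidHom.zero_apply, map_zero]; rfl⟩
  refine (f.cls_eq ?_).symm
  exact (Nat.card_of_subsingleton (PUnit.unit : PUnit.{u + 1})).trans
    (Nat.card_of_subsingleton (0 : q.G)).symm

theorem odd_of_nsmul_dyadic_ne_zero {k : ℕ} {n : ℤ} (h : 2 ^ k • dyadic (k + 1) n ≠ 0) :
    Odd n := by
  by_contra hn
  obtain ⟨m, rfl⟩ := (Int.not_odd_iff_even.1 hn).two_dvd
  apply h
  rw [dyadic_succ_two_mul, nsmul_dyadic, dyadic_eq_zero_iff]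
  push_cast
  exact dvd_mul_right _ _

/-- A nontrivial form contains an indecomposable form of the same exponent. -/
theorem exists_gen_emb (q : QuadTwoGroup.{u}) (h : ∃ x : q.G, x ≠ 0) :
    (∃ k n, ∃ hn : Odd n, Nonempty (Emb (cyc.{u} k n hn) q)) ∨
      ∃ k α υ β, ∃ hυ : Odd υ, Nonempty (Emb (plane.{u} k α υ β hυ) q) := by
  classical
  have hex : ∃ N : ℕ, ∀ x : q.G, 2 ^ N • x = 0 := by
    obtain ⟨N, hN⟩ := q.card_eq
    exact ⟨N, fun x => by rw [← hN]; exact card_nsmul_eq_zero'⟩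
  obtain ⟨N, hN, hmin⟩ : ∃ N : ℕ, (∀ x : q.G, 2 ^ N • x = 0) ∧
      ∀ m < N, ¬ ∀ x : q.G, 2 ^ m • x = 0 :=
    ⟨Nat.find hex, Nat.find_spec hex, fun m hm => Nat.find_min hex hm⟩
  obtain ⟨k, rfl⟩ : ∃ k, N = k + 1 := by
    cases N with
    | zero =>
      obtain ⟨x, hx⟩ := h
      exact absurd (by simpa using hN x) hx
    | succ k => exact ⟨k, rfl⟩
  have hk := hmin k k.lt_succ_self
  push Not at hk
  obtain ⟨x, hx⟩ := hk
  have hlink : ∀ x y : q.G, 2 ^ (k + 1) • q.linking x y = 0 := by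
    intro x y
    rw [← natCast_zsmul, ← linking_zsmul_left, natCast_zsmul, hN, linking_zero_left]
  by_cases hodd : ∃ x : q.G, 2 ^ k • q.linking x x ≠ 0
  -- Since `λ(x, x) = 2 q(x)`, the value `q(x)` has denominator dividing `2^(k+2)`; `2^k λ(x, x) ≠
  -- 0` makes the numerator odd.
  · obtain ⟨x, hx⟩ := hodd
    obtain ⟨n, hn⟩ := exists_dyadic_of_nsmul_eq_zero (k := k + 2) (t := q.form x) (by
      rw [pow_succ, mul_smul, ← linking_self, hlink])
    have hl : q.linking x x = dyadic (k + 1) n := by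
      rw [linking_self, hn, nsmul_dyadic, ← dyadic_succ_two_mul (k + 1)]
      rfl
    rw [hl] at hx
    have ho := odd_of_nsmul_dyadic_ne_zero hx
    obtain ⟨f, -⟩ := exists_emb_cyc k n ho x (hN x) hn
    exact Or.inl ⟨k, n, ho, ⟨f⟩⟩
  -- Now `2^k λ(z, z) = 0` for all `z`, so every value of `q` lies in `2^(-k-1)ℤ/ℤ`. An element `x`
  -- of full order pairs with some `y` to an odd numerator, and the two span an even plane.
  · push Not at hodd
    have hy : ∃ y, 2 ^ k • q.linking x y ≠ 0 := by
      by_contra hcon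
      push Not at hcon
      apply hx
      apply q.eq_zero_of_linking
      intro y
      rw [← natCast_zsmul, linking_zsmul_left, natCast_zsmul, hcon]
    obtain ⟨y, hy⟩ := hy
    obtain ⟨υ, hυ⟩ := exists_dyadic_of_nsmul_eq_zero (hlink x y)
    have hform : ∀ z, ∃ α, q.form z = dyadic (k + 1) α := fun z =>
      exists_dyadic_of_nsmul_eq_zero (by rw [pow_succ, mul_smul, ← linking_self, hodd])
    obtain ⟨α, hα⟩ := hform x
    obtain ⟨β, hβ⟩ := hform y
    rw [hυ] at hy
    have ho := odd_of_nsmul_dyadic_ne_zero hy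
    obtain ⟨f, -⟩ := exists_emb_plane k α υ β ho x y (hN x) (hN y) hα hβ hυ
    exact Or.inr ⟨k, α, υ, β, ho, ⟨f⟩⟩

/-- Induction on the order: an embedded elementary form splits off, and its complement is smaller.
-/
theorem exists_symCls (q : QuadTwoGroup.{u}) : ∃ x : Multiset Gen, symCls.{u} x = q.cls := by
  induction hm : Nat.card q.G using Nat.strong_induction_on generalizing q with
  | _ m ih =>
    by_cases h : ∃ x : q.G, x ≠ 0
    · have key : ∀ p : QuadTwoGroup.{u}, Nonempty (Emb p q) → 1 < Nat.card p.G →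
          (∃ g : Gen, g.cls = p.cls) → ∃ x : Multiset Gen, symCls.{u} x = q.cls := by
        rintro p ⟨f⟩ hp ⟨g, hg⟩
        obtain ⟨c, hc, hcard⟩ := f.exists_cls_eq_add
        obtain ⟨x, hx⟩ := ih (Nat.card c.G) (by
          rw [← hm, hcard]
          exact lt_mul_of_one_lt_left Nat.card_pos hp) c rfl
        exact ⟨g ::ₘ x, by rw [symCls_cons, hg, hx, hc]⟩
      rcases exists_gen_emb q h with ⟨k, n, hn, hf⟩ | ⟨k, α, υ, β, hυ, hf⟩
      · refine key _ hf ?_ ?_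
        · rw [card_cyc]; exact Nat.one_lt_two_pow k.succ_ne_zero
        · obtain ⟨s, f, hsf⟩ := Gen.exists_val hn
          exact ⟨Gen.odd k s f, (Gen.cls_cyc_eq k hn hsf).symm⟩
      · refine key _ hf ?_ ?_
        · rw [card_plane, ← pow_add]; exact Nat.one_lt_two_pow (by omega)
        · rcases Int.even_or_odd (α * β) with he | ho
          · exact ⟨Gen.even k false, (cls_plane_eq_of_even k hυ he).symm⟩
          · exact ⟨Gen.even k true, (cls_plane_eq_of_odd k hυ (Int.odd_mul.1 ho).1
              (Int.odd_mul.1 ho).2).symm⟩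
    · push Not at h
      exact ⟨0, by rw [symCls_zero, cls_eq_zero_of_subsingleton q h]⟩

end QuadTwoGroup

theorem exists_symCls_eq (c : QuadClass.{u}) : ∃ x : Multiset Gen, symCls.{u} x = c := by
  obtain ⟨q, rfl⟩ := Quotient.exists_rep c
  exact q.exists_symCls

/-- A multiset of symbols is pure if no level carries both odd and even symbols. -/
def IsPure (x : Multiset Gen) : Prop :=
  ∀ k s f e, Gen.odd k s f ∈ x → Gen.even k e ∉ x

/-- The number of even planes (`0` or `1`) in a symbol. -/
def Gen.evenCount : Gen → ℕ
  | .odd _ _ _ => 0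
  | .even _ _ => 1

theorem Gen.evenCount_odd (k : ℕ) (s f : Bool) : (Gen.odd k s f).evenCount = 0 := rfl

theorem Gen.evenCount_even (k : ℕ) (e : Bool) : (Gen.even k e).evenCount = 1 := rfl

/-- Take a representative with the fewest even symbols: an odd and an even symbol on the same level
could be traded for three odd ones. -/
theorem exists_isPure_symCls_eq (c : QuadClass.{u}) :
    ∃ x : Multiset Gen, IsPure x ∧ symCls.{u} x = c := by
  classical
  have hex : ∃ n, ∃ x : Multiset Gen, symCls.{u} x = c ∧ (x.map Gen.evenCount).sum = n := by
    obtain ⟨x, hx⟩ := exists_symCls_eq c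
    exact ⟨_, x, hx, rfl⟩
  obtain ⟨x, hx, hn⟩ := Nat.find_spec hex
  refine ⟨x, fun k s f e ho he => ?_, hx⟩
  obtain ⟨y, rfl⟩ := Multiset.exists_cons_of_mem ho
  rw [Multiset.mem_cons] at he
  rcases he with he | he
  · cases he
  obtain ⟨z, rfl⟩ := Multiset.exists_cons_of_mem he
  have key : ∀ s₁ f₁ s₂ f₂ s₃ f₃, (Gen.odd k s f).cls + (Gen.even k e).cls
      = ((Gen.odd k s₁ f₁).cls + (Gen.odd k s₂ f₂).cls + (Gen.odd k s₃ f₃).cls : QuadClass.{u}) →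
      False := by
    intro s₁ f₁ s₂ f₂ s₃ f₃ h
    refine Nat.find_min hex (m := (z.map Gen.evenCount).sum) ?_
      ⟨.odd k s₁ f₁ ::ₘ .odd k s₂ f₂ ::ₘ .odd k s₃ f₃ ::ₘ z, ?_, ?_⟩
    · rw [← hn]
      simp only [Multiset.map_cons, Multiset.sum_cons, Gen.evenCount_odd, Gen.evenCount_even]
      omega
    · rw [← hx]
      simp only [symCls_cons]
      rw [← add_assoc, ← add_assoc, ← h, add_assoc]
    · simp only [Multiset.map_cons, Multiset.sum_cons, Gen.evenCount_odd, zero_add]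
  cases e
  · exact key _ _ _ _ _ _ (Gen.cls_odd_add_even_false k s f)
  · exact key _ _ _ _ _ _ (Gen.cls_odd_add_even_true k s f)

/-! ### The exponential character on dyadic elements -/

theorem expQmodZ_coe (t : ℚ) :
    expQmodZ (t : QmodZ) = Complex.exp (2 * Real.pi * Complex.I * (t : ℂ)) :=
  expQmodZ_periodic.lift_coe t

theorem expQmodZ_add (s t : QmodZ) : expQmodZ (s + t) = expQmodZ s * expQmodZ t := by
  obtain ⟨s, rfl⟩ := QuotientAddGroup.mk_surjective s
  obtain ⟨t, rfl⟩ := QuotientAddGroup.mk_surjective t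
  change expQmodZ ((s + t : ℚ) : QmodZ) = expQmodZ (s : QmodZ) * expQmodZ (t : QmodZ)
  rw [expQmodZ_coe, expQmodZ_coe, expQmodZ_coe, ← Complex.exp_add]
  congr 1
  push_cast
  ring

theorem expQmodZ_zero : expQmodZ 0 = 1 := by
  have := expQmodZ_coe 0
  rw [AddCircle.coe_zero] at this
  rw [this]
  simp

theorem expQmodZ_dyadic (k : ℕ) (n : ℤ) :
    expQmodZ (dyadic k n) = Complex.exp (2 * Real.pi * Complex.I * ((n : ℂ) / 2 ^ k)) := by
  rw [dyadic_apply, expQmodZ_coe]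
  push_cast
  rfl

/-! ### Eighth roots of unity -/

theorem stdAddChar_val (j : ZMod 8) :
    (ZMod.stdAddChar j : ℂ) = Complex.exp (2 * Real.pi * Complex.I * (j.val : ℂ) / 8) := by
  have := ZMod.stdAddChar_coe (N := 8) (j.val : ℤ)
  simpa using this

theorem norm_stdAddChar (j : ZMod 8) : ‖(ZMod.stdAddChar j : ℂ)‖ = 1 := by
  rw [ZMod.stdAddChar_apply]; exact Circle.norm_coe _

theorem isEighthArg_iff {z : ℂ} {a : Z8bar} :
    IsEighthArg z a ↔ (z = 0 ∧ a = ⊤) ∨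
      ∃ j : ZMod 8, a = (j : Z8bar) ∧ ∃ r : ℝ, 0 < r ∧ z = r * ZMod.stdAddChar j := by
  refine or_congr Iff.rfl ⟨?_, ?_⟩
  · rintro ⟨hz, j, hj, h⟩
    refine ⟨j, hj, ‖z‖, norm_pos_iff.2 hz, ?_⟩
    rw [stdAddChar_val, ← h, mul_div_cancel₀]
    exact_mod_cast (norm_ne_zero_iff.2 hz)
  · rintro ⟨j, hj, r, hr, rfl⟩
    have h1 : (ZMod.stdAddChar j : ℂ) ≠ 0 := by
      rw [← norm_ne_zero_iff, norm_stdAddChar]; exact one_ne_zero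
    have hr' : (r : ℂ) ≠ 0 := by exact_mod_cast hr.ne'
    refine ⟨mul_ne_zero hr' h1, j, hj, ?_⟩
    rw [norm_mul, norm_stdAddChar, Complex.norm_real, Real.norm_of_nonneg hr.le, mul_one,
      ← stdAddChar_val, mul_div_cancel_left₀ _ hr']

theorem isEighthArg_of_pos {r : ℝ} (hr : 0 < r) (j : ZMod 8) :
    IsEighthArg (r * ZMod.stdAddChar j) (j : Z8bar) :=
  isEighthArg_iff.2 (Or.inr ⟨j, rfl, r, hr, rfl⟩)

theorem isEighthArg_zero_of_pos {r : ℝ} (hr : 0 < r) : IsEighthArg r 0 := by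
  have := isEighthArg_of_pos hr 0
  rwa [AddChar.map_zero_eq_one, mul_one] at this

theorem IsEighthArg.mul {z w : ℂ} {a b : Z8bar} (hz : IsEighthArg z a) (hw : IsEighthArg w b) :
    IsEighthArg (z * w) (a + b) := by
  rw [isEighthArg_iff] at hz hw ⊢
  rcases hz with ⟨rfl, rfl⟩ | ⟨i, rfl, r, hr, rfl⟩
  · exact Or.inl ⟨zero_mul _, WithTop.top_add _⟩
  · rcases hw with ⟨rfl, rfl⟩ | ⟨j, rfl, t, ht, rfl⟩
    · exact Or.inl ⟨mul_zero _, WithTop.add_top _⟩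
    · refine Or.inr ⟨i + j, rfl, r * t, mul_pos hr ht, ?_⟩
      rw [AddChar.map_add_eq_mul]
      push_cast
      ring

theorem IsEighthArg.ne_zero {z : ℂ} {i : ZMod 8} (h : IsEighthArg z (i : Z8bar)) : z ≠ 0 := by
  rcases h with ⟨-, h⟩ | ⟨h, -⟩
  · exact absurd h (WithTop.coe_ne_top)
  · exact h

theorem IsEighthArg.unique {z : ℂ} {a b : Z8bar} (ha : IsEighthArg z a) (hb : IsEighthArg z b) :
    a = b := by
  rcases ha with ⟨h, rfl⟩ | ⟨h, i, rfl, hi⟩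
  · rcases hb with ⟨-, rfl⟩ | ⟨h', -⟩
    · rfl
    · exact absurd h h'
  · rcases hb with ⟨h', -⟩ | ⟨-, j, rfl, hj⟩
    · exact absurd h' h
    · rw [← stdAddChar_val] at hi hj
      rw [ZMod.injective_stdAddChar (hi.symm.trans hj)]

/-- Division by a nonzero factor; this is how the Gauss sums of planes are obtained from those of
cyclic forms. -/
theorem IsEighthArg.of_mul {z w : ℂ} {i j : ZMod 8} (hz : IsEighthArg z (i : Z8bar))
    (h : IsEighthArg (z * w) ((i + j : ZMod 8) : Z8bar)) : IsEighthArg w (j : Z8bar) := by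
  have hz0 := hz.ne_zero
  have hzw := h.ne_zero
  rw [isEighthArg_iff] at hz h
  rcases hz with ⟨h0, -⟩ | ⟨i', hi, r, hr, rfl⟩
  · exact absurd h0 hz0
  rcases h with ⟨h0, -⟩ | ⟨l, hl, t, ht, h⟩
  · exact absurd h0 hzw
  have hi' := WithTop.coe_injective hi
  have hl' := WithTop.coe_injective hl
  subst hi' hl'
  have : w = ((t / r : ℝ) : ℂ) * ZMod.stdAddChar j := by
    rw [AddChar.map_add_eq_mul] at h
    apply mul_left_cancel₀ hz0
    have hr' : (r : ℂ) ≠ 0 := by exact_mod_cast hr.ne'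
    rw [h]
    push_cast
    field_simp
  rw [this]
  exact isEighthArg_of_pos (div_pos ht hr) j

/-! ### Formal properties of the Gauss sums -/

namespace QuadTwoGroup

/-- Since `λ(x, x) = 2 q(x)`, the factor `2^(m-1)` becomes `2^m`, and index 0 ceases to be an
exception. -/
theorem gaussSum_eq (q : QuadTwoGroup.{u}) (m : ℕ) :
    q.gaussSum m = ∑ᶠ x : q.G, expQmodZ (2 ^ m • q.form x) := by
  cases m with
  | zero => simp only [gaussSum, pow_zero, one_smul]
  | succ m => simp only [gaussSum, linking_self, pow_succ, mul_smul]

theorem gaussSum_congr {p q : QuadTwoGroup.{u}} (h : p.cls = q.cls) (m : ℕ) :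
    p.gaussSum m = q.gaussSum m := by
  obtain ⟨e, he⟩ := exists_equiv_of_cls_eq h
  rw [gaussSum_eq, gaussSum_eq, ← finsum_comp_equiv e.toEquiv]
  apply finsum_congr
  intro x
  change _ = expQmodZ (2 ^ m • q.form (e x))
  rw [he]

theorem gaussSum_orthSum (p q : QuadTwoGroup.{u}) (m : ℕ) :
    (p.orthSum q).gaussSum m = p.gaussSum m * q.gaussSum m := by
  have := Fintype.ofFinite p.G
  have := Fintype.ofFinite q.G
  rw [gaussSum_eq, gaussSum_eq, gaussSum_eq]
  change ∑ᶠ x : p.G × q.G, expQmodZ (2 ^ m • (p.form x.1 + q.form x.2)) = _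
  rw [finsum_eq_sum_of_fintype, finsum_eq_sum_of_fintype, finsum_eq_sum_of_fintype,
    Fintype.sum_prod_type, Finset.sum_mul_sum]
  simp only [smul_add, expQmodZ_add]

theorem gaussSum_eq_card (q : QuadTwoGroup.{u}) (m : ℕ) (h : ∀ x, 2 ^ m • q.form x = 0) :
    q.gaussSum m = ((Nat.card q.G : ℝ) : ℂ) := by
  have := Fintype.ofFinite q.G
  rw [gaussSum_eq, finsum_eq_sum_of_fintype]
  simp only [h, expQmodZ_zero, Finset.sum_const, Finset.card_univ, Nat.card_eq_fintype_card]
  simp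

theorem isEighthArg_gaussSum_of_form (q : QuadTwoGroup.{u}) (m : ℕ)
    (h : ∀ x, 2 ^ m • q.form x = 0) : IsEighthArg (q.gaussSum m) 0 := by
  rw [gaussSum_eq_card q m h]
  exact isEighthArg_zero_of_pos (by exact_mod_cast Nat.card_pos)

end QuadTwoGroup

/-! ### Gauss sums of cyclic forms -/

theorem sum_range_two_pow_mul {f : ℕ → ℂ} {P : ℕ} (hf : ∀ x, f (x + P) = f x) (m : ℕ) :
    ∑ x ∈ Finset.range (2 ^ m * P), f x = 2 ^ m * ∑ x ∈ Finset.range P, f x := by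
  have hf' : ∀ c x, f (c * P + x) = f x := by
    intro c
    induction c with
    | zero => intro x; rw [zero_mul, zero_add]
    | succ c ih => intro x; rw [add_mul, one_mul, add_right_comm, hf, ih]
  induction m with
  | zero => simp
  | succ m ih =>
    rw [pow_succ, mul_comm _ 2, mul_assoc, two_mul, Finset.sum_range_add]
    simp only [hf', ih]
    ring

/-- The Gauss sum of `n x ^ 2 / 2 ^ (M + 2)` over the residues modulo `2 ^ (M + 1)`. -/
def quadSum (n : ℤ) (M : ℕ) : ℂ :=
  ∑ x ∈ Finset.range (2 ^ (M + 1)), expQmodZ (dyadic (M + 2) (n * (x : ℤ) ^ 2))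

theorem expQmodZ_dyadic_congr {k : ℕ} {m n : ℤ} (h : (2 : ℤ) ^ k ∣ m - n) :
    expQmodZ (dyadic k m) = expQmodZ (dyadic k n) := by
  rw [(dyadic_eq_iff k m n).2 h]

theorem expQmodZ_dyadic_one {n : ℤ} (hn : Odd n) : expQmodZ (dyadic 1 n) = -1 := by
  obtain ⟨m, rfl⟩ := hn
  rw [expQmodZ_dyadic_congr (n := 1) ⟨m, by ring⟩, expQmodZ_dyadic]
  rw [← Complex.exp_pi_mul_I]
  congr 1
  push_cast
  ring

theorem quadSum_zero (n : ℤ) : quadSum n 0 = 1 + expQmodZ (dyadic 2 n) := by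
  rw [quadSum, zero_add, zero_add, pow_one, Finset.sum_range_succ, Finset.sum_range_one]
  simp [expQmodZ_zero]

theorem quadSum_one {n : ℤ} (hn : Odd n) : quadSum n 1 = 2 * expQmodZ (dyadic 3 n) := by
  have h2 : expQmodZ (dyadic 3 (n * 2 ^ 2)) = -1 := by
    rw [← expQmodZ_dyadic_one hn, ← dyadic_add_pow_mul 1 2]
    congr 2
    ring
  have h3 : expQmodZ (dyadic 3 (n * 3 ^ 2)) = expQmodZ (dyadic 3 n) :=
    expQmodZ_dyadic_congr ⟨n, by ring⟩
  rw [quadSum]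
  norm_num [Finset.sum_range_succ]
  norm_num at h2 h3
  rw [h2, h3, expQmodZ_zero]
  ring

/-- Odd residues `y` and `y + 2^(M+2)` give opposite terms and cancel. Even residues `2x` and `2x +
2^(M+2)` both give the term of `x` in the shorter sum. -/
theorem quadSum_add_two {n : ℤ} (hn : Odd n) (M : ℕ) : quadSum n (M + 2) = 2 * quadSum n M := by
  rw [quadSum, quadSum, show 2 ^ (M + 2 + 1) = 2 ^ (M + 2) + 2 ^ (M + 2) by ring,
    Finset.sum_range_add, ← Finset.sum_add_distrib]
  have hodd : ∀ x : ℕ, expQmodZ (dyadic (M + 2 + 2) (n * ((2 * x + 1 : ℕ) : ℤ) ^ 2))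
      + expQmodZ (dyadic (M + 2 + 2) (n * ((2 ^ (M + 2) + (2 * x + 1) : ℕ) : ℤ) ^ 2)) = 0 := by
    intro x
    have : dyadic (M + 2 + 2) (n * ((2 ^ (M + 2) + (2 * x + 1) : ℕ) : ℤ) ^ 2)
        = dyadic (M + 2 + 2) (n * ((2 * x + 1 : ℕ) : ℤ) ^ 2) + dyadic 1 n := by
      rw [← dyadic_add_pow_mul 1 (M + 3), show 1 + (M + 3) = M + 2 + 2 by ring, ← map_add,
        dyadic_eq_iff]
      refine ⟨n * (2 ^ M + x), ?_⟩
      push_cast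
      ring
    rw [this, expQmodZ_add, expQmodZ_dyadic_one hn]
    ring
  have heven : ∀ x : ℕ, expQmodZ (dyadic (M + 2 + 2) (n * ((2 * x : ℕ) : ℤ) ^ 2))
      + expQmodZ (dyadic (M + 2 + 2) (n * ((2 ^ (M + 2) + 2 * x : ℕ) : ℤ) ^ 2))
      = 2 * expQmodZ (dyadic (M + 2) (n * (x : ℤ) ^ 2)) := by
    intro x
    have h1 : dyadic (M + 2 + 2) (n * ((2 ^ (M + 2) + 2 * x : ℕ) : ℤ) ^ 2)
        = dyadic (M + 2) (n * (x : ℤ) ^ 2) := by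
      rw [← dyadic_add_pow_mul (M + 2) 2, dyadic_eq_iff]
      refine ⟨n * (2 ^ M + x), ?_⟩
      push_cast
      ring
    have h2 : dyadic (M + 2 + 2) (n * ((2 * x : ℕ) : ℤ) ^ 2)
        = dyadic (M + 2) (n * (x : ℤ) ^ 2) := by
      rw [← dyadic_add_pow_mul (M + 2) 2]
      congr 1
      push_cast
      ring
    rw [h1, h2]
    ring
  have key : ∀ (f : ℕ → ℂ) (N : ℕ), ∑ x ∈ Finset.range (2 * N), f x
      = ∑ x ∈ Finset.range N, (f (2 * x) + f (2 * x + 1)) := by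
    intro f N
    induction N with
    | zero => simp
    | succ N ih =>
      rw [mul_add, mul_one, Finset.sum_range_succ, Finset.sum_range_succ, ih,
        Finset.sum_range_succ, add_assoc]
  rw [show 2 ^ (M + 2) = 2 * 2 ^ (M + 1) by ring, key, Finset.mul_sum]
  apply Finset.sum_congr rfl
  intro x _
  rw [show 2 * 2 ^ (M + 1) = 2 ^ (M + 2) by ring, heven, hodd, add_zero]

theorem expQmodZ_dyadic_three (n : ℤ) : expQmodZ (dyadic 3 n) = ZMod.stdAddChar (n : ZMod 8) := by
  rw [expQmodZ_dyadic, ZMod.stdAddChar_coe]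
  congr 1
  push_cast
  ring

/-- For `n = ±1` one has `1 + e(n/4) = 2 cos(π/4) e(n/8)` with `e(t) = exp(2πi t)`. The factor 5 is
invisible because `5 ≡ 1` modulo 4. -/
theorem isEighthArg_quadSum_zero (s f : Bool) :
    IsEighthArg (quadSum (Gen.val s f) 0) ((Gen.val s false : ZMod 8) : Z8bar) := by
  have hval : ∀ s f, (2 : ℤ) ^ 2 ∣ Gen.val s f - Gen.val s false := by decide
  rw [quadSum_zero, expQmodZ_dyadic_congr (hval s f)]
  have hcos : (0 : ℝ) < 2 * Real.cos (Real.pi / 4) := by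
    have := Real.cos_pos_of_mem_Ioo (x := Real.pi / 4)
      ⟨by linarith [Real.pi_pos], by linarith [Real.pi_pos]⟩
    linarith
  have h1 : (1 : ℂ) + expQmodZ (dyadic 2 (Gen.val s false))
      = ((2 * Real.cos (Real.pi / 4) : ℝ) : ℂ) * expQmodZ (dyadic 3 (Gen.val s false)) := by
    have hcos2 : ((2 * Real.cos (Real.pi / 4) : ℝ) : ℂ)
        = expQmodZ (dyadic 3 (Gen.val s false)) + expQmodZ (dyadic 3 (-Gen.val s false)) := by
      push_cast
      rw [Complex.cos, expQmodZ_dyadic, expQmodZ_dyadic]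
      cases s
      · rw [show Gen.val false false = 1 from rfl, mul_div_cancel₀ _ two_ne_zero]
        congr 2 <;> push_cast <;> ring
      · rw [show Gen.val true false = -1 from rfl, mul_div_cancel₀ _ two_ne_zero, add_comm]
        congr 2 <;> push_cast <;> ring
    rw [hcos2, add_mul, ← expQmodZ_add, ← expQmodZ_add, ← map_add, ← map_add, neg_add_cancel,
      map_zero, expQmodZ_zero, ← two_mul, dyadic_succ_two_mul, add_comm]
  rw [h1, expQmodZ_dyadic_three]
  exact isEighthArg_of_pos hcos _

theorem isEighthArg_quadSum_one (s f : Bool) :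
    IsEighthArg (quadSum (Gen.val s f) 1) ((Gen.val s f : ZMod 8) : Z8bar) := by
  rw [quadSum_one (Gen.odd_val s f), expQmodZ_dyadic_three]
  exact_mod_cast isEighthArg_of_pos (r := 2) two_pos _

theorem IsEighthArg.pos_mul {z : ℂ} {a : Z8bar} (h : IsEighthArg z a) {r : ℝ} (hr : 0 < r) :
    IsEighthArg (r * z) a := by
  have := (isEighthArg_zero_of_pos hr).mul h
  rwa [zero_add] at this

/-- Shifting `M` by 2 keeps the argument; `M = 0` sees only the sign, while `M = 1` sees `n` modulo
8, that is, the extra `4f`. -/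
theorem isEighthArg_quadSum (s f : Bool) (M : ℕ) :
    IsEighthArg (quadSum (Gen.val s f) M)
      (((Gen.val s false : ZMod 8) + 4 * (if f then 1 else 0) * (M : ZMod 8) : ZMod 8) :
        Z8bar) := by
  induction M using Nat.twoStepInduction with
  | zero => simpa using isEighthArg_quadSum_zero s f
  | one =>
    have h : ∀ s f, ((Gen.val s false : ZMod 8) + 4 * (if f then 1 else 0) * ((1 : ℕ) : ZMod 8))
        = (Gen.val s f : ZMod 8) := by decide
    rw [h]
    exact isEighthArg_quadSum_one s f
  | more M ih _ =>
    rw [quadSum_add_two (Gen.odd_val s f)]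
    have h : (4 * (if f then 1 else 0) * ((M + 2 : ℕ) : ZMod 8) : ZMod 8)
        = 4 * (if f then 1 else 0) * (M : ZMod 8) := by
      push_cast
      generalize (M : ZMod 8) = x
      clear * - f x
      revert f x
      decide
    rw [h]
    exact_mod_cast ih.pos_mul (r := 2) two_pos

namespace QuadTwoGroup

theorem gaussSum_cyc (k : ℕ) (n : ℤ) (hn : Odd n) (m : ℕ) :
    (cyc.{u} k n hn).gaussSum m
      = ∑ x ∈ Finset.range (2 ^ (k + 1)), expQmodZ (dyadic (k + 2) (2 ^ m * (n * (x : ℤ) ^ 2))) := by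
  rw [gaussSum_eq]
  change ∑ᶠ x : ULift.{u} (ZMod (2 ^ (k + 1))), expQmodZ (2 ^ m • cycVal k n x) = _
  rw [finsum_eq_sum_of_fintype]
  refine Finset.sum_bij (fun x _ => x.down.val) ?_ ?_ ?_ ?_
  · intro x _
    exact Finset.mem_range.2 (ZMod.val_lt _)
  · intro x _ y _ h
    exact ULift.ext _ _ (ZMod.val_injective _ h)
  · intro b hb
    refine ⟨⟨(b : ZMod (2 ^ (k + 1)))⟩, Finset.mem_univ _, ?_⟩
    exact ZMod.val_natCast_of_lt (Finset.mem_range.1 hb)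
  · intro x _
    rw [cycVal, nsmul_dyadic]
    push_cast
    rfl

/-- At index `m` the summand has period `2^(M+1)`, so the sum runs over `2^m` periods. -/
theorem gaussSum_cyc_of_le (m M : ℕ) (n : ℤ) (hn : Odd n) :
    (cyc.{u} (m + M) n hn).gaussSum m = ((2 ^ m : ℝ) : ℂ) * quadSum n M := by
  rw [gaussSum_cyc, quadSum, show 2 ^ (m + M + 1) = 2 ^ m * 2 ^ (M + 1) by ring]
  have h : ∀ x : ℕ, expQmodZ (dyadic (m + M + 2) (2 ^ m * (n * (x : ℤ) ^ 2)))
      = expQmodZ (dyadic (M + 2) (n * (x : ℤ) ^ 2)) := by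
    intro x
    rw [← dyadic_add_pow_mul (M + 2) m, show M + 2 + m = m + M + 2 by ring]
  simp only [h]
  rw [sum_range_two_pow_mul]
  · push_cast; rfl
  · intro x
    apply expQmodZ_dyadic_congr
    refine ⟨n * (2 ^ M + x), ?_⟩
    push_cast
    ring

/-- The summand is `(-1)^x`. This vanishing makes index `k + 1` irregular. -/
theorem gaussSum_cyc_self (k : ℕ) (n : ℤ) (hn : Odd n) :
    (cyc.{u} k n hn).gaussSum (k + 1) = 0 := by
  rw [gaussSum_cyc]
  have h : ∀ x : ℕ, expQmodZ (dyadic (k + 2) (2 ^ (k + 1) * (n * (x : ℤ) ^ 2)))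
      = expQmodZ (dyadic 1 (n * (x : ℤ) ^ 2)) := by
    intro x
    rw [← dyadic_add_pow_mul 1 (k + 1), show 1 + (k + 1) = k + 2 by ring]
  simp only [h]
  rw [pow_succ, sum_range_two_pow_mul]
  · rw [Finset.sum_range_succ, Finset.sum_range_one]
    simp [expQmodZ_zero, expQmodZ_dyadic_one hn]
  · intro x
    apply expQmodZ_dyadic_congr
    refine ⟨2 * n * (1 + x), ?_⟩
    push_cast
    ring

theorem isEighthArg_gaussSum_cyc_of_lt (k m : ℕ) (n : ℤ) (hn : Odd n) (h : k + 1 < m) :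
    IsEighthArg ((cyc.{u} k n hn).gaussSum m) 0 := by
  apply isEighthArg_gaussSum_of_form
  intro x
  obtain ⟨a, rfl⟩ := exists_cycOf x
  rw [cyc_form, nsmul_dyadic, dyadic_eq_zero_iff]
  push_cast
  exact Dvd.dvd.mul_right (pow_dvd_pow 2 (by omega)) _

theorem isEighthArg_gaussSum_plane_of_lt (k m : ℕ) (α υ β : ℤ) (hυ : Odd υ) (h : k < m) :
    IsEighthArg ((plane.{u} k α υ β hυ).gaussSum m) 0 := by
  apply isEighthArg_gaussSum_of_form
  intro x
  obtain ⟨a, b, rfl⟩ := exists_planeOf x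
  rw [plane_form, nsmul_dyadic, dyadic_eq_zero_iff]
  push_cast
  exact Dvd.dvd.mul_right (pow_dvd_pow 2 (by omega)) _

end QuadTwoGroup

/-! ### Gauss sums of isomorphism classes -/

/-- The Gauss sums of an isomorphism class. -/
def QuadClass.gaussSum (m : ℕ) : QuadClass.{u} → ℂ :=
  Quotient.lift (fun q => q.gaussSum m)
    (fun _ _ h => QuadTwoGroup.gaussSum_congr (Quotient.sound h) m)

theorem QuadClass.gaussSum_add (m : ℕ) (c d : QuadClass.{u}) :
    QuadClass.gaussSum m (c + d) = QuadClass.gaussSum m c * QuadClass.gaussSum m d := by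
  obtain ⟨p, rfl⟩ := Quotient.exists_rep c
  obtain ⟨q, rfl⟩ := Quotient.exists_rep d
  exact QuadTwoGroup.gaussSum_orthSum p q m

namespace Gen

/-- The sign `± 1` in `ℤ / 8`. -/
def sgn (s : Bool) : ZMod 8 := if s then -1 else 1

/-- A Boolean as an element `0`, `1` of `ℤ / 8`. -/
def bit (f : Bool) : ZMod 8 := if f then 1 else 0

/-- The contribution of a symbol to the finite part of the signature at index `m`. -/
def sig (m : ℕ) : Gen → ZMod 8
  | odd k s f => if m ≤ k then sgn s + 4 * bit f * (k + m) else 0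
  | even k f => if m ≤ k then 4 * bit f * (k + m + 1) else 0

/-- The signature of a symbol. -/
def bar (m : ℕ) : Gen → Z8bar
  | odd k s f => if m = k + 1 then ⊤ else (sig m (odd k s f) : Z8bar)
  | even k f => (sig m (even k f) : Z8bar)

theorem isEighthArg_odd_of_le {m k : ℕ} (h : m ≤ k) (s f : Bool) :
    IsEighthArg (QuadClass.gaussSum m (odd k s f).cls.{u})
      ((sgn s + 4 * bit f * (k + m) : ZMod 8) : Z8bar) := by
  obtain ⟨M, rfl⟩ := Nat.exists_eq_add_of_le h
  change IsEighthArg ((QuadTwoGroup.cyc.{u} (m + M) (val s f) (odd_val s f)).gaussSum m) _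
  rw [QuadTwoGroup.gaussSum_cyc_of_le]
  have h1 := (isEighthArg_quadSum s f M).pos_mul (r := 2 ^ m) (by positivity)
  have h2 : (sgn s + 4 * bit f * ((m + M : ℕ) + m) : ZMod 8)
      = (val s false : ZMod 8) + 4 * (if f then 1 else 0) * (M : ZMod 8) := by
    push_cast
    generalize (M : ZMod 8) = x
    generalize (m : ZMod 8) = y
    clear * - s f x y
    revert s f x y
    decide
  rw [h2]
  exact h1

/-- A cyclic form plus a plane equals three cyclic forms of the same level. For `m ≤ k` their Gauss
sums are nonzero with known arguments, so the plane's argument follows by division. -/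
theorem isEighthArg_even_of_le {m k : ℕ} (h : m ≤ k) (f : Bool) :
    IsEighthArg (QuadClass.gaussSum m (even k f).cls.{u})
      ((4 * bit f * (k + m + 1) : ZMod 8) : Z8bar) := by
  have h1 := isEighthArg_odd_of_le.{u} h false false
  cases f
  · have h2 := cls_odd_add_even_false.{u} k false false
    have h3 := (h1.mul h1).mul (isEighthArg_odd_of_le.{u} h true false)
    rw [← QuadClass.gaussSum_add, ← QuadClass.gaussSum_add,
      show (odd k true false).cls = (odd k (!false) false).cls from rfl, ← h2,
      QuadClass.gaussSum_add, ← WithTop.coe_add, ← WithTop.coe_add] at h3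
    refine h1.of_mul ?_
    convert h3 using 2
    simp only [sgn, bit]
    generalize (k : ZMod 8) = x
    generalize (m : ZMod 8) = y
    revert x y
    decide
  · have h2 := cls_odd_add_even_true.{u} k false false
    have h4 := isEighthArg_odd_of_le.{u} h true true
    have h3 := (h4.mul h4).mul h4
    rw [← QuadClass.gaussSum_add, ← QuadClass.gaussSum_add,
      show (odd k true true).cls = (odd k (!false) (!false)).cls from rfl, ← h2,
      QuadClass.gaussSum_add, ← WithTop.coe_add, ← WithTop.coe_add] at h3
    refine h1.of_mul ?_
    convert h3 using 2
    simp only [sgn, bit]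
    generalize (k : ZMod 8) = x
    generalize (m : ZMod 8) = y
    revert x y
    decide

theorem isEighthArg_bar (g : Gen) (m : ℕ) :
    IsEighthArg (QuadClass.gaussSum m g.cls.{u}) (g.bar m) := by
  cases g with
  | odd k s f =>
    by_cases h1 : m ≤ k
    · rw [bar, if_neg (by omega), sig, if_pos h1]
      exact isEighthArg_odd_of_le h1 s f
    · by_cases h2 : m = k + 1
      · subst h2
        rw [bar, if_pos rfl]
        exact Or.inl ⟨QuadTwoGroup.gaussSum_cyc_self _ _ _, rfl⟩
      · rw [bar, if_neg h2, sig, if_neg h1]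
        exact QuadTwoGroup.isEighthArg_gaussSum_cyc_of_lt _ _ _ _ (by omega)
  | even k f =>
    by_cases h1 : m ≤ k
    · rw [bar, sig, if_pos h1]
      exact isEighthArg_even_of_le h1 f
    · rw [bar, sig, if_neg h1]
      cases f
      · exact QuadTwoGroup.isEighthArg_gaussSum_plane_of_lt _ _ _ _ _ _ (by omega)
      · exact QuadTwoGroup.isEighthArg_gaussSum_plane_of_lt _ _ _ _ _ _ (by omega)

end Gen

/-! ### Ranks of direct sums of free `ℤ/2^k`-modules -/

/-- The group `⨁ (ℤ / 2 ^ k) ^ r k`. -/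
abbrev FreeSum (r : ℕ → ℕ) : Type := DirectSum ℕ (fun k => Fin (r k) → ZMod (2 ^ k))

theorem freeSum_prod_equiv (r r' : ℕ → ℕ) :
    Nonempty (FreeSum r × FreeSum r' ≃+ FreeSum (r + r')) := by
  let app : ∀ k, (Fin (r k) → ZMod (2 ^ k)) × (Fin (r' k) → ZMod (2 ^ k))
      ≃+ (Fin ((r + r') k) → ZMod (2 ^ k)) := fun k =>
    AddEquiv.mk' ((Equiv.sumArrowEquivProdArrow _ _ _).symm.trans
      (Equiv.arrowCongr finSumFinEquiv (Equiv.refl _))) (by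
        intro a b
        funext i
        obtain ⟨j, rfl⟩ := finSumFinEquiv.surjective i
        rcases j with j | j <;> simp [Equiv.sumArrowEquivProdArrow])
  let fwd : FreeSum r × FreeSum r' →+ FreeSum (r + r') :=
    AddMonoidHom.coprod
      (DirectSum.map fun k => (app k).toAddMonoidHom.comp (AddMonoidHom.inl _ _))
      (DirectSum.map fun k => (app k).toAddMonoidHom.comp (AddMonoidHom.inr _ _))
  let bwd : FreeSum (r + r') →+ FreeSum r × FreeSum r' :=
    AddMonoidHom.prod
      (DirectSum.map fun k => (AddMonoidHom.fst _ _).comp (app k).symm.toAddMonoidHom)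
      (DirectSum.map fun k => (AddMonoidHom.snd _ _).comp (app k).symm.toAddMonoidHom)
  have hfwd : ∀ x k, fwd x k = app k (x.1 k, x.2 k) := by
    intro x k
    simp only [fwd, AddMonoidHom.coprod_apply, DirectSum.add_apply, DirectSum.map_apply]
    simp only [AddMonoidHom.comp_apply, AddMonoidHom.inl_apply, AddMonoidHom.inr_apply,
      AddEquiv.toAddMonoidHom_eq_coe, AddMonoidHom.coe_coe]
    rw [← map_add, Prod.mk_add_mk, add_zero, zero_add]
  refine ⟨⟨⟨fwd, bwd, ?_, ?_⟩, map_add fwd⟩⟩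
  · intro x
    refine Prod.ext (DirectSum.ext fun k => ?_) (DirectSum.ext fun k => ?_)
    · simp only [bwd, AddMonoidHom.prod_apply, DirectSum.map_apply]
      change ((app k).symm (fwd x k)).1 = _
      rw [hfwd, AddEquiv.symm_apply_apply]
    · simp only [bwd, AddMonoidHom.prod_apply, DirectSum.map_apply]
      change ((app k).symm (fwd x k)).2 = _
      rw [hfwd, AddEquiv.symm_apply_apply]
  · intro y
    refine DirectSum.ext fun k => ?_
    rw [hfwd]
    have : ((bwd y).1 k, (bwd y).2 k) = (app k).symm (y k) := by
      simp only [bwd, AddMonoidHom.prod_apply, DirectSum.map_apply]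
      rfl
    rw [this, AddEquiv.apply_symm_apply]

theorem freeSum_single_equiv (j n : ℕ) :
    Nonempty ((Fin n → ZMod (2 ^ j)) ≃+ FreeSum (fun k => if k = j then n else 0)) := by
  have hj : (if j = j then n else 0) = n := if_pos rfl
  let c : (Fin n → ZMod (2 ^ j)) ≃+ (Fin (if j = j then n else 0) → ZMod (2 ^ j)) :=
    AddEquiv.mk' (Equiv.arrowCongr (finCongr hj.symm) (Equiv.refl _)) (fun a b => rfl)
  let f : (Fin n → ZMod (2 ^ j)) →+ FreeSum (fun k => if k = j then n else 0) :=
    (DirectSum.of (fun k => Fin (if k = j then n else 0) → ZMod (2 ^ k)) j).comp c.toAddMonoidHom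
  refine ⟨AddEquiv.ofBijective f ⟨?_, ?_⟩⟩
  · intro a b hab
    exact c.injective (DirectSum.of_injective (β := fun k =>
      Fin (if k = j then n else 0) → ZMod (2 ^ k)) j hab)
  · intro y
    refine ⟨c.symm (y j), DirectSum.ext fun k => ?_⟩
    change DirectSum.of (fun k => Fin (if k = j then n else 0) → ZMod (2 ^ k)) j
      (c (c.symm (y j))) k = _
    rw [AddEquiv.apply_symm_apply]
    by_cases h : k = j
    · subst h
      rw [DirectSum.of_eq_same]
    · funext i
      rw [if_neg h] at i
      exact i.elim0

theorem freeSum_zero_equiv (A : Type*) [AddCommGroup A] [Subsingleton A] :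
    Nonempty (A ≃+ FreeSum 0) := by
  have : Subsingleton (FreeSum 0) :=
    ⟨fun a b => DirectSum.ext fun k => funext fun i => Fin.elim0 i⟩
  exact ⟨⟨⟨fun _ => 0, fun _ => 0, fun _ => Subsingleton.elim _ _,
    fun _ => Subsingleton.elim _ _⟩, fun _ _ => Subsingleton.elim _ _⟩⟩

theorem card_zmod_torsion (j k : ℕ) :
    Nat.card {z : ZMod (2 ^ j) // 2 ^ k • z = 0} = 2 ^ min j k := by
  have h := IsAddCyclic.card_nsmulAddMonoidHom_ker (ZMod (2 ^ j)) (2 ^ k)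
  have h2 : Nat.gcd (2 ^ j) (2 ^ k) = 2 ^ min j k := by
    rcases le_total j k with hjk | hjk
    · rw [min_eq_left hjk, Nat.gcd_eq_left (pow_dvd_pow 2 hjk)]
    · rw [min_eq_right hjk, Nat.gcd_eq_right (pow_dvd_pow 2 hjk)]
  rw [Nat.card_zmod, h2] at h
  exact h

/-- A direct sum of `(ℤ / 2 ^ k) ^ r k` that is finite has finitely many nonzero ranks. -/
theorem exists_bound_of_finite_freeSum (r : ℕ → ℕ) (hr : r 0 = 0) [Finite (FreeSum r)] :
    ∃ N, ∀ k, N ≤ k → r k = 0 := by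
  classical
  -- The all-ones vectors in the nonzero components are pairwise distinct; `r 0 = 0` is needed
  -- because `ℤ/2^0` is trivial and would not bound the rank.
  let x : ℕ → FreeSum r := fun k => DirectSum.of _ k (fun _ => 1)
  have hinj : Set.InjOn x {k | r k ≠ 0} := by
    intro k hk l hl h
    by_contra hkl
    have h1 : x k k = x l k := by rw [h]
    simp only [x] at h1
    rw [DirectSum.of_eq_same, DirectSum.of_eq_of_ne _ _ _ hkl] at h1
    have hk0 : k ≠ 0 := by rintro rfl; exact hk hr
    have h2 := congrFun h1 ⟨0, Nat.pos_of_ne_zero hk⟩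
    have : Fact (1 < 2 ^ k) := ⟨Nat.one_lt_two_pow hk0⟩
    exact one_ne_zero h2
  have hfin : {k | r k ≠ 0}.Finite := Set.Finite.of_finite_image (Set.toFinite _) hinj
  obtain ⟨N, hN⟩ := hfin.bddAbove
  refine ⟨N + 1, fun k hk => ?_⟩
  by_contra h
  have := hN h
  omega

/-- The condition can be tested in each cyclic factor, and `ℤ/2^j` has `2^min(j,k)` elements killed
by `2^k`. -/
theorem card_freeSum_torsion (r : ℕ → ℕ) (N k : ℕ) (hN : ∀ j, N ≤ j → r j = 0) :
    Nat.card {x : FreeSum r // 2 ^ k • x = 0} = 2 ^ ∑ j ∈ Finset.range N, r j * min j k := by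
  classical
  let e : FreeSum r ≃ ∀ j : Fin N, Fin (r j) → ZMod (2 ^ (j : ℕ)) :=
    { toFun := fun x j => x j
      invFun := fun f => DirectSum.mk _ (Finset.range N)
        (fun j => f ⟨j, Finset.mem_range.1 j.2⟩)
      left_inv := by
        intro x
        refine DirectSum.ext fun j => ?_
        by_cases hj : j < N
        · rw [DirectSum.mk_apply_of_mem (Finset.mem_range.2 hj)]
        · funext i
          exact absurd i.2 (by have := hN j (not_lt.1 hj); omega)
      right_inv := by
        intro f
        funext j
        exact DirectSum.mk_apply_of_mem (Finset.mem_range.2 j.2) }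
  have h1 : {x : FreeSum r // 2 ^ k • x = 0} ≃
      ∀ (j : Fin N) (_ : Fin (r j)), {z : ZMod (2 ^ (j : ℕ)) // 2 ^ k • z = 0} := by
    refine (e.subtypeEquiv (q := fun f => ∀ j i, 2 ^ k • f j i = 0) ?_).trans
      ((Equiv.subtypePiEquivPi (p := fun (j : Fin N) (g : Fin (r j) → ZMod (2 ^ (j : ℕ))) =>
          ∀ i, 2 ^ k • g i = 0)).trans
        (Equiv.piCongrRight fun j => Equiv.subtypePiEquivPi
          (p := fun _ (z : ZMod (2 ^ (j : ℕ))) => 2 ^ k • z = 0)))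
    intro x
    constructor
    · intro h j i
      have := congrArg (fun y : FreeSum r => y j i) h
      exact this
    · intro h
      refine DirectSum.ext fun j => ?_
      by_cases hj : j < N
      · funext i
        exact h ⟨j, hj⟩ i
      · funext i
        exact absurd i.2 (by have := hN j (not_lt.1 hj); omega)
  rw [Nat.card_congr h1, Nat.card_pi]
  simp only [Nat.card_pi, card_zmod_torsion, Finset.prod_const, Finset.card_univ, Fintype.card_fin]
  rw [← Finset.prod_pow_eq_pow_sum, Finset.prod_range]
  apply Finset.prod_congr rfl
  intro j _
  rw [← pow_mul, mul_comm]

/-- The ranks of a finite direct sum of free `ℤ / 2 ^ k`-modules are invariants. -/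
theorem freeSum_rank_unique {r r' : ℕ → ℕ} (hr : r 0 = 0) (hr' : r' 0 = 0) [Finite (FreeSum r)]
    (e : FreeSum r ≃+ FreeSum r') : r = r' := by
  have : Finite (FreeSum r') := Finite.of_equiv _ e.toEquiv
  obtain ⟨N₁, h₁⟩ := exists_bound_of_finite_freeSum r hr
  obtain ⟨N₂, h₂⟩ := exists_bound_of_finite_freeSum r' hr'
  have hN₁ : ∀ j, N₁ + N₂ ≤ j → r j = 0 := fun j hj => h₁ j (by omega)
  have hN₂ : ∀ j, N₁ + N₂ ≤ j → r' j = 0 := fun j hj => h₂ j (by omega)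
  have hsum : ∀ k, ∑ j ∈ Finset.range (N₁ + N₂), r j * min j k
      = ∑ j ∈ Finset.range (N₁ + N₂), r' j * min j k := by
    intro k
    apply Nat.pow_right_injective (le_refl 2)
    change 2 ^ _ = 2 ^ _
    rw [← card_freeSum_torsion r _ k hN₁, ← card_freeSum_torsion r' _ k hN₂]
    refine Nat.card_congr (e.toEquiv.subtypeEquiv fun x => ?_)
    change _ ↔ 2 ^ k • e x = 0
    rw [← map_nsmul, EmbeddingLike.map_eq_zero_iff]
  -- The second difference of `k ↦ min j k` is minus the indicator of `j = k + 1`, so the torsion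
  -- counts recover each rank.
  have key : ∀ (f : ℕ → ℕ) (k : ℕ), k + 1 < N₁ + N₂ →
      2 * ∑ j ∈ Finset.range (N₁ + N₂), f j * min j (k + 1)
        = ∑ j ∈ Finset.range (N₁ + N₂), f j * min j k
          + ∑ j ∈ Finset.range (N₁ + N₂), f j * min j (k + 2) + f (k + 1) := by
    intro f k hk
    have hs : f (k + 1) = ∑ j ∈ Finset.range (N₁ + N₂), if j = k + 1 then f j else 0 := by
      rw [Finset.sum_ite_eq' (Finset.range (N₁ + N₂)) (k + 1) f,
        if_pos (Finset.mem_range.2 hk)]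
    rw [hs, Finset.mul_sum, ← Finset.sum_add_distrib, ← Finset.sum_add_distrib]
    apply Finset.sum_congr rfl
    intro j _
    rcases lt_trichotomy j (k + 1) with h | h | h
    · rw [if_neg (by omega), min_eq_left (by omega), min_eq_left (by omega),
        min_eq_left (by omega)]
      ring
    · rw [if_pos h, h, min_eq_left (by omega), min_eq_right (by omega), min_eq_left (by omega)]
      ring
    · rw [if_neg (by omega), min_eq_right (by omega), min_eq_right (by omega),
        min_eq_right (by omega)]
      ring
  funext k
  cases k with
  | zero => rw [hr, hr']
  | succ k =>
    by_cases hk : k + 1 < N₁ + N₂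
    · have e1 := key r k hk
      have e2 := key r' k hk
      rw [hsum, hsum k, hsum (k + 2)] at e1
      omega
    · rw [hN₁ _ (not_lt.1 hk), hN₂ _ (not_lt.1 hk)]

/-! ### Tableaux of symbols and of their sums -/

/-- The contribution of a symbol to the rank at index `m`. -/
def Gen.rank (m : ℕ) : Gen → ℕ
  | .odd k _ _ => if m = k + 1 then 1 else 0
  | .even k _ => if m = k + 1 then 2 else 0

/-- The tableau of a symbol. -/
def Gen.tab (g : Gen) : Tableau := fun m => (g.rank m, g.bar m)

/-- The tableau of a multiset of symbols. -/
def symTab (x : Multiset Gen) : Tableau := (x.map Gen.tab).sum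

theorem symTab_cons (g : Gen) (x : Multiset Gen) : symTab (g ::ₘ x) = g.tab + symTab x := by
  rw [symTab, Multiset.map_cons, Multiset.sum_cons]; rfl

namespace QuadTwoGroup

theorem HasTableau.congr {p q : QuadTwoGroup.{u}} (h : p.cls = q.cls) {T : Tableau}
    (hT : p.HasTableau T) : q.HasTableau T := by
  obtain ⟨e, he⟩ := exists_equiv_of_cls_eq h
  obtain ⟨f⟩ := hT.rank
  refine ⟨hT.rank_zero, ⟨e.symm.trans f⟩, fun k => ?_⟩
  rw [← gaussSum_congr h]
  exact hT.signature k

theorem HasTableau.orthSum {p q : QuadTwoGroup.{u}} {T U : Tableau} (hT : p.HasTableau T)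
    (hU : q.HasTableau U) : (p.orthSum q).HasTableau (T + U) := by
  obtain ⟨f⟩ := hT.rank
  obtain ⟨g⟩ := hU.rank
  obtain ⟨h⟩ := freeSum_prod_equiv (fun k => (T k).1) (fun k => (U k).1)
  refine ⟨?_, ⟨?_⟩, fun k => ?_⟩
  · change (T 0).1 + (U 0).1 = 0
    rw [hT.rank_zero, hU.rank_zero]
  · exact (AddEquiv.prodCongr f g).trans h
  · rw [gaussSum_orthSum]
    exact (hT.signature k).mul (hU.signature k)

theorem hasTableau_trivial : (trivial.{u}).HasTableau 0 := by
  refine ⟨rfl, freeSum_zero_equiv PUnit.{u + 1}, fun k => ?_⟩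
  exact isEighthArg_gaussSum_of_form _ _ fun x => smul_zero _

theorem HasTableau.unique {q : QuadTwoGroup.{u}} {T U : Tableau} (hT : q.HasTableau T)
    (hU : q.HasTableau U) : T = U := by
  obtain ⟨f⟩ := hT.rank
  obtain ⟨g⟩ := hU.rank
  have : Finite (FreeSum fun k => (T k).1) := Finite.of_equiv _ f.toEquiv
  have h := freeSum_rank_unique hT.rank_zero hU.rank_zero (f.symm.trans g)
  funext k
  exact Prod.ext (congrFun h k) ((hT.signature k).unique (hU.signature k))

theorem hasTableau_gen (g : Gen) : ∃ q : QuadTwoGroup.{u}, q.cls = g.cls ∧ q.HasTableau g.tab := by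
  have hodd : ∀ k n hn, Nonempty ((cyc.{u} k n hn).G
      ≃+ FreeSum (fun m => if m = k + 1 then 1 else 0)) := by
    intro k n hn
    obtain ⟨e⟩ := freeSum_single_equiv (k + 1) 1
    let c : ULift.{u} (ZMod (2 ^ (k + 1))) ≃+ (Fin 1 → ZMod (2 ^ (k + 1))) :=
      AddEquiv.mk' (Equiv.ulift.trans (Equiv.funUnique (Fin 1) _).symm) (fun a b => rfl)
    exact ⟨c.trans e⟩
  have heven : ∀ k α υ β hυ, Nonempty ((plane.{u} k α υ β hυ).G
      ≃+ FreeSum (fun m => if m = k + 1 then 2 else 0)) := by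
    intro k α υ β hυ
    obtain ⟨e⟩ := freeSum_single_equiv (k + 1) 2
    let c : ULift.{u} (ZMod (2 ^ (k + 1))) × ULift.{u} (ZMod (2 ^ (k + 1)))
        ≃+ (Fin 2 → ZMod (2 ^ (k + 1))) :=
      AddEquiv.mk' ((Equiv.prodCongr Equiv.ulift Equiv.ulift).trans (finTwoArrowEquiv _).symm)
        (fun a b => by funext i; fin_cases i <;> rfl)
    exact ⟨c.trans e⟩
  have hsig := Gen.isEighthArg_bar.{u} g
  cases g with
  | odd k s f =>
    refine ⟨_, rfl, ?_, hodd _ _ _, hsig⟩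
    simp [Gen.tab, Gen.rank]
  | even k f =>
    cases f
    · refine ⟨plane k 0 1 0 odd_one, rfl, ?_, heven _ _ _ _ _, hsig⟩
      simp [Gen.tab, Gen.rank]
    · refine ⟨plane k 1 1 1 odd_one, rfl, ?_, heven _ _ _ _ _, hsig⟩
      simp [Gen.tab, Gen.rank]

/-- Ranks and signatures add over orthogonal sums, so the tableaux of single symbols suffice.
Combined with uniqueness, this makes `symTab` an invariant of the class. -/
theorem hasTableau_symTab (x : Multiset Gen) {q : QuadTwoGroup.{u}} (h : symCls x = q.cls) :
    q.HasTableau (symTab x) := by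
  induction x using Multiset.induction_on generalizing q with
  | empty =>
    refine HasTableau.congr ?_ hasTableau_trivial
    rw [← h, cls_trivial, symCls_zero]
  | cons g x ih =>
    obtain ⟨p, hp, hpT⟩ := hasTableau_gen.{u} g
    obtain ⟨p', hp'⟩ := Quotient.exists_rep (symCls.{u} x)
    rw [symTab_cons]
    refine HasTableau.congr ?_ (hpT.orthSum (ih (q := p') hp'.symm))
    rw [← h, symCls_cons, ← hp, cls_orthSum]
    exact congrArg _ hp'

end QuadTwoGroup

theorem symTab_eq_of_symCls_eq {x y : Multiset Gen} (h : symCls.{u} x = symCls y) :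
    symTab x = symTab y := by
  obtain ⟨q, hq⟩ := Quotient.exists_rep (symCls.{u} x)
  exact (QuadTwoGroup.hasTableau_symTab x (q := q) hq.symm).unique
    (QuadTwoGroup.hasTableau_symTab y (q := q) (h.symm.trans hq.symm))

/-! ### Finite signatures and the total parity -/

namespace Gen

/-- The index of a symbol, one less than the exponent of its group. -/
def lvl : Gen → ℕ
  | odd k _ _ => k
  | even k _ => k

/-- The contribution of a symbol to the total parity of factors `5`, times `4`. -/
def e4 : Gen → ZMod 8
  | odd _ _ f => 4 * bit f
  | even _ f => 4 * bit f

/-- The symbol with sign and parity forgotten. -/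
def shape : Gen → Gen
  | odd k _ _ => odd k false false
  | even k _ => even k false

/-- A symbol that has regular index `m` and lives at or above it. -/
def Above (m : ℕ) : Gen → Prop
  | odd k _ _ => m + 1 ≤ k
  | even k _ => m ≤ k

/-- The index enters the signature with coefficient `4f`. The boundary case of a plane with `k = m`
fits as well: `4f(2k + 1) + 4f = 0` modulo 8. -/
theorem sig_succ_of_above {m : ℕ} {g : Gen} (h : g.Above m) : g.sig (m + 1) = g.sig m + g.e4 := by
  cases g with
  | odd k s f =>
    have h : m + 1 ≤ k := h
    rw [sig, sig, e4, if_pos h, if_pos (by omega)]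
    push_cast
    ring
  | even k f =>
    have h : m ≤ k := h
    rw [sig, sig, e4, if_pos h]
    by_cases h' : m + 1 ≤ k
    · rw [if_pos h']
      push_cast
      ring
    · obtain rfl : k = m := by omega
      rw [if_neg h']
      generalize (k : ZMod 8) = x
      clear * - f x
      revert f x
      decide

theorem sig_odd_self (k : ℕ) (s f : Bool) : (odd k s f).sig k = sgn s := by
  rw [sig, if_pos le_rfl]
  generalize (k : ZMod 8) = x
  revert s f x
  decide

theorem sig_of_lvl_lt {m : ℕ} {g : Gen} (h : g.lvl < m) : g.sig m = 0 := by
  cases g <;> exact if_neg (not_le.2 h)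

theorem e4_add_self (g : Gen) : g.e4 + g.e4 = 0 := by
  cases g with
  | odd k s f => change 4 * bit f + 4 * bit f = 0; revert f; decide
  | even k f => change 4 * bit f + 4 * bit f = 0; revert f; decide

end Gen

/-- The rank at index `m` of a multiset of symbols. -/
def symRank (m : ℕ) (x : Multiset Gen) : ℕ := (x.map (Gen.rank m)).sum

/-- The finite part of the signature at index `m`. -/
def symSig (m : ℕ) (x : Multiset Gen) : ZMod 8 := (x.map (Gen.sig m)).sum

/-- The total parity of factors `5`, times `4`. -/
def symE4 (x : Multiset Gen) : ZMod 8 := (x.map Gen.e4).sum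

/-- The index `k + 1` is irregular. -/
def Irr (k : ℕ) (x : Multiset Gen) : Prop := ∃ s f, Gen.odd k s f ∈ x

theorem symRank_cons (m : ℕ) (g : Gen) (x : Multiset Gen) :
    symRank m (g ::ₘ x) = g.rank m + symRank m x := by
  rw [symRank, Multiset.map_cons, Multiset.sum_cons]; rfl

theorem symSig_cons (m : ℕ) (g : Gen) (x : Multiset Gen) :
    symSig m (g ::ₘ x) = g.sig m + symSig m x := by
  rw [symSig, Multiset.map_cons, Multiset.sum_cons]; rfl

theorem symE4_cons (g : Gen) (x : Multiset Gen) : symE4 (g ::ₘ x) = g.e4 + symE4 x := by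
  rw [symE4, Multiset.map_cons, Multiset.sum_cons]; rfl

theorem symE4_add_self (x : Multiset Gen) : symE4 x + symE4 x = 0 := by
  induction x using Multiset.induction_on with
  | empty => rfl
  | cons g x ih =>
    rw [symE4_cons]
    linear_combination ih + g.e4_add_self

theorem symSig_succ_of_above {m : ℕ} {x : Multiset Gen} (h : ∀ g ∈ x, g.Above m) :
    symSig (m + 1) x = symSig m x + symE4 x := by
  rw [symSig, symSig, symE4, ← Multiset.sum_map_add]
  exact congrArg _ (Multiset.map_congr rfl fun g hg => Gen.sig_succ_of_above (h g hg))

/-- Two steps add the total parity twice, which is zero modulo 8. -/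
theorem symSig_succ_succ_of_above {m : ℕ} {x : Multiset Gen} (h : ∀ g ∈ x, g.Above (m + 1)) :
    symSig (m + 2) x = symSig m x := by
  have h' : ∀ g ∈ x, g.Above m := by
    intro g hg
    have := h g hg
    cases g with
    | odd k s f => have : m + 1 + 1 ≤ k := this; exact (by omega : m + 1 ≤ k)
    | even k f => have : m + 1 ≤ k := this; exact (by omega : m ≤ k)
  rw [symSig_succ_of_above h, symSig_succ_of_above h', add_assoc, symE4_add_self, add_zero]

theorem irr_cons_odd (k : ℕ) (s f : Bool) (x : Multiset Gen) : Irr k (Gen.odd k s f ::ₘ x) :=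
  ⟨s, f, Multiset.mem_cons_self _ _⟩

theorem irr_cons_iff_of_ne {k : ℕ} {g : Gen} (h : ∀ s f, Gen.odd k s f ≠ g) (x : Multiset Gen) :
    Irr k (g ::ₘ x) ↔ Irr k x := by
  constructor
  · rintro ⟨s, f, hm⟩
    rcases Multiset.mem_cons.1 hm with hm | hm
    · exact absurd hm (h s f)
    · exact ⟨s, f, hm⟩
  · rintro ⟨s, f, hm⟩
    exact ⟨s, f, Multiset.mem_cons_of_mem hm⟩

theorem symTab_fst (x : Multiset Gen) (m : ℕ) : (symTab x m).1 = symRank m x := by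
  induction x using Multiset.induction_on with
  | empty => rfl
  | cons g x ih =>
    rw [symTab_cons, symRank_cons, ← ih]
    rfl

open Classical in
theorem symTab_snd (x : Multiset Gen) (m : ℕ) :
    (symTab x m).2 = if ∃ k, m = k + 1 ∧ Irr k x then ⊤ else (symSig m x : Z8bar) := by
  induction x using Multiset.induction_on with
  | empty =>
    rw [if_neg]
    · rfl
    · rintro ⟨k, -, s, f, h⟩
      exact Multiset.notMem_zero _ h
  | cons g x ih =>
    rw [symTab_cons, symSig_cons]
    change g.bar m + (symTab x m).2 = _
    rw [ih]
    by_cases hx : ∃ k, m = k + 1 ∧ Irr k x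
    · have hgx : ∃ k, m = k + 1 ∧ Irr k (g ::ₘ x) := by
        obtain ⟨k, hk, s, f, hm⟩ := hx
        exact ⟨k, hk, s, f, Multiset.mem_cons_of_mem hm⟩
      rw [if_pos hx, if_pos hgx, WithTop.add_top]
    · rw [if_neg hx]
      by_cases hg : ∃ k s f, m = k + 1 ∧ g = Gen.odd k s f
      · obtain ⟨k, s, f, hk, rfl⟩ := hg
        rw [if_pos ⟨k, hk, irr_cons_odd k s f x⟩, Gen.bar, if_pos hk, WithTop.top_add]
      · have hgx : ¬ ∃ k, m = k + 1 ∧ Irr k (g ::ₘ x) := by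
          rintro ⟨k, hk, s, f, hm⟩
          rcases Multiset.mem_cons.1 hm with hm | hm
          · exact hg ⟨k, s, f, hk, hm.symm⟩
          · exact hx ⟨k, hk, s, f, hm⟩
        rw [if_neg hgx]
        have hbar : g.bar m = (g.sig m : Z8bar) := by
          cases g with
          | odd k s f => rw [Gen.bar, if_neg fun hk => hg ⟨k, s, f, hk, rfl⟩]
          | even k f => rfl
        rw [hbar, ← WithTop.coe_add]

/-- The numerical invariants of two multisets of symbols agree. -/
structure Sim (x y : Multiset Gen) : Prop where
  rank : ∀ m, symRank m x = symRank m y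
  irr : ∀ k, Irr k x ↔ Irr k y
  sig_zero : symSig 0 x = symSig 0 y
  sig_succ : ∀ k, ¬ Irr k x → symSig (k + 1) x = symSig (k + 1) y
  e4 : symE4 x = symE4 y

theorem Sim.symm {x y : Multiset Gen} (h : Sim x y) : Sim y x :=
  ⟨fun m => (h.rank m).symm, fun k => (h.irr k).symm, h.sig_zero.symm,
    fun k hk => (h.sig_succ k (fun h' => hk ((h.irr k).1 h'))).symm, h.e4.symm⟩

theorem Sim.trans {x y z : Multiset Gen} (h : Sim x y) (h' : Sim y z) : Sim x z :=
  ⟨fun m => (h.rank m).trans (h'.rank m), fun k => (h.irr k).trans (h'.irr k),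
    h.sig_zero.trans h'.sig_zero,
    fun k hk => (h.sig_succ k hk).trans (h'.sig_succ k fun h'' => hk ((h.irr k).2 h'')),
    h.e4.trans h'.e4⟩

theorem sim_of_symTab_eq {x y : Multiset Gen} (h : symTab x = symTab y) (he : symE4 x = symE4 y) :
    Sim x y := by
  classical
  have hirr : ∀ z k, Irr k z ↔ (symTab z (k + 1)).2 = ⊤ := by
    intro z k
    rw [symTab_snd]
    by_cases hz : ∃ j, k + 1 = j + 1 ∧ Irr j z
    · rw [if_pos hz]
      obtain ⟨j, hj, hz⟩ := hz
      obtain rfl : k = j := by omega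
      exact iff_of_true hz rfl
    · rw [if_neg hz]
      exact iff_of_false (fun hk => hz ⟨k, rfl, hk⟩) WithTop.coe_ne_top
  have hsig : ∀ z k, ¬ Irr k z → (symTab z (k + 1)).2 = (symSig (k + 1) z : Z8bar) := by
    intro z k hk
    rw [symTab_snd, if_neg]
    rintro ⟨j, hj, hz⟩
    obtain rfl : k = j := by omega
    exact hk hz
  have hzero : ∀ z, (symTab z 0).2 = (symSig 0 z : Z8bar) := by
    intro z
    rw [symTab_snd, if_neg]
    rintro ⟨j, hj, -⟩
    omega
  have hirr' : ∀ k, Irr k x ↔ Irr k y := fun k => by rw [hirr, hirr, h]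
  refine ⟨fun m => by rw [← symTab_fst, ← symTab_fst, h], hirr', ?_, ?_, he⟩
  · apply WithTop.coe_injective
    rw [← hzero, ← hzero, h]
  · intro k hk
    apply WithTop.coe_injective
    rw [← hsig x k hk, ← hsig y k (fun h' => hk ((hirr' k).2 h')), h]

/-! ### Moves between multisets of symbols -/

/-- `y` arises from `x` by an isomorphism that preserves shape and total parity. -/
structure Mv (x y : Multiset Gen) : Prop where
  cls : symCls.{u} x = symCls y
  e4 : symE4 x = symE4 y
  shape : x.map Gen.shape = y.map Gen.shape

theorem Mv.refl (x : Multiset Gen) : Mv.{u} x x := ⟨rfl, rfl, rfl⟩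

theorem Mv.trans {x y z : Multiset Gen} (h : Mv.{u} x y) (h' : Mv.{u} y z) : Mv.{u} x z :=
  ⟨h.cls.trans h'.cls, h.e4.trans h'.e4, h.shape.trans h'.shape⟩

theorem Mv.sim {x y : Multiset Gen} (h : Mv.{u} x y) : Sim x y :=
  sim_of_symTab_eq (symTab_eq_of_symCls_eq h.cls) h.e4

theorem Mv.exists_shape_eq {x y : Multiset Gen} (h : Mv.{u} x y) {g : Gen} (hg : g ∈ y) :
    ∃ g' ∈ x, g'.shape = g.shape := by
  have : g.shape ∈ x.map Gen.shape := by
    rw [h.shape]; exact Multiset.mem_map_of_mem _ hg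
  exact Multiset.mem_map.1 this

theorem Gen.lvl_eq_of_shape_eq {g g' : Gen} (h : g.shape = g'.shape) : g.lvl = g'.lvl := by
  cases g <;> cases g' <;> simp_all [Gen.shape, Gen.lvl]

theorem Mv.isPure {x y : Multiset Gen} (h : Mv.{u} x y) (hx : IsPure x) : IsPure y := by
  intro k s f e ho he
  obtain ⟨g, hg, hgs⟩ := h.exists_shape_eq ho
  obtain ⟨g', hg', hgs'⟩ := h.exists_shape_eq he
  cases g with
  | even j f' => simp [Gen.shape] at hgs
  | odd j s' f' =>
    cases g' with
    | odd j' s'' f'' => simp [Gen.shape] at hgs'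
    | even j' f'' =>
      simp only [Gen.shape, Gen.odd.injEq, and_true, Gen.even.injEq] at hgs hgs'
      subst hgs hgs'
      exact hx _ _ _ _ hg hg'

theorem Mv.le_lvl {x y : Multiset Gen} (h : Mv.{u} x y) {k : ℕ} (hx : ∀ g ∈ x, k ≤ g.lvl) :
    ∀ g ∈ y, k ≤ g.lvl := by
  intro g hg
  obtain ⟨g', hg', hs⟩ := h.exists_shape_eq hg
  rw [← Gen.lvl_eq_of_shape_eq hs]
  exact hx g' hg'

theorem Mv.card {x y : Multiset Gen} (h : Mv.{u} x y) : x.card = y.card := by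
  rw [← Multiset.card_map Gen.shape, h.shape, Multiset.card_map]

theorem Mv.cons {x y : Multiset Gen} (h : Mv.{u} x y) (g : Gen) : Mv.{u} (g ::ₘ x) (g ::ₘ y) := by
  refine ⟨?_, ?_, ?_⟩
  · rw [symCls_cons, symCls_cons, h.cls]
  · rw [symE4_cons, symE4_cons, h.e4]
  · rw [Multiset.map_cons, Multiset.map_cons, h.shape]

theorem mv_pair {a b a' b' : Gen} (h : a.cls + b.cls = (a'.cls + b'.cls : QuadClass.{u}))
    (he : a.e4 + b.e4 = a'.e4 + b'.e4) (ha : a.shape = a'.shape) (hb : b.shape = b'.shape)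
    (z : Multiset Gen) : Mv.{u} (a ::ₘ b ::ₘ z) (a' ::ₘ b' ::ₘ z) := by
  refine ⟨?_, ?_, ?_⟩
  · rw [symCls_cons, symCls_cons, symCls_cons, symCls_cons, ← add_assoc, h, add_assoc]
  · rw [symE4_cons, symE4_cons, symE4_cons, symE4_cons, ← add_assoc, he, add_assoc]
  · simp only [Multiset.map_cons, ha, hb]

theorem mv_swap (a b : Gen) (z : Multiset Gen) : Mv.{u} (a ::ₘ b ::ₘ z) (b ::ₘ a ::ₘ z) := by
  rw [Multiset.cons_swap]; exact Mv.refl _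

theorem mv_odd_odd (k : ℕ) (s f s' f' : Bool) (z : Multiset Gen) :
    Mv.{u} (.odd k s f ::ₘ .odd k s' f' ::ₘ z) (.odd k s (!f) ::ₘ .odd k s' (!f') ::ₘ z) :=
  mv_pair (Gen.cls_odd_add_odd k s f s' f') (by simp only [Gen.e4]; revert f f'; decide) rfl rfl z

theorem mv_odd_odd_succ (k : ℕ) (s f s' f' : Bool) (z : Multiset Gen) :
    Mv.{u} (.odd k s f ::ₘ .odd (k + 1) s' f' ::ₘ z)
      (.odd k (!s) (f ^^ (s == s')) ::ₘ .odd (k + 1) (!s') (f' ^^ (s == s')) ::ₘ z) :=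
  mv_pair (Gen.cls_odd_add_odd_succ k s f s' f')
    (by simp only [Gen.e4]; revert s f s' f'; decide) rfl rfl z

theorem mv_odd_odd_succ_succ (k : ℕ) (s f s' f' : Bool) (z : Multiset Gen) :
    Mv.{u} (.odd k s f ::ₘ .odd (k + 2) s' f' ::ₘ z)
      (.odd k s (!f) ::ₘ .odd (k + 2) s' (!f') ::ₘ z) :=
  mv_pair (Gen.cls_odd_add_odd_succ_succ k s f s' f')
    (by simp only [Gen.e4]; revert f f'; decide) rfl rfl z

theorem mv_odd_even_succ (k : ℕ) (s f e : Bool) (z : Multiset Gen) :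
    Mv.{u} (.odd k s f ::ₘ .even (k + 1) e ::ₘ z) (.odd k s (!f) ::ₘ .even (k + 1) (!e) ::ₘ z) :=
  mv_pair (Gen.cls_odd_add_even_succ k s f e)
    (by simp only [Gen.e4]; revert f e; decide) rfl rfl z

theorem mv_even_odd_succ (k : ℕ) (s f e : Bool) (z : Multiset Gen) :
    Mv.{u} (.even k e ::ₘ .odd (k + 1) s f ::ₘ z) (.even k (!e) ::ₘ .odd (k + 1) s (!f) ::ₘ z) :=
  mv_pair (a := .even k e) (b := .odd (k + 1) s f) (a' := .even k (!e)) (b' := .odd (k + 1) s (!f))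
    (by rw [add_comm, Gen.cls_odd_succ_add_even k s f e, add_comm])
    (by simp only [Gen.e4]; revert f e; decide) rfl rfl z

theorem mv_even_even (k : ℕ) (e : Bool) (z : Multiset Gen) :
    Mv.{u} (.even k e ::ₘ .even k e ::ₘ z) (.even k (!e) ::ₘ .even k (!e) ::ₘ z) :=
  mv_pair (Gen.cls_even_add_even k e) (by simp only [Gen.e4]; revert e; decide) rfl rfl z

/-- Four cyclic forms of the same sign can be replaced by four of the opposite sign. -/
theorem exists_mv_four (k : ℕ) (s f₁ f₂ f₃ f₄ : Bool) (z : Multiset Gen) :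
    ∃ f c, Mv.{u} (.odd k s f₁ ::ₘ .odd k s f₂ ::ₘ .odd k s f₃ ::ₘ .odd k s f₄ ::ₘ z)
      (.odd k (!s) f ::ₘ .odd k (!s) c ::ₘ .odd k (!s) c ::ₘ .odd k (!s) c ::ₘ z) := by
  have h1 : ∀ f₄, ∃ d, Mv.{u} (.odd k s f₂ ::ₘ .odd k s f₄ ::ₘ z)
      (.odd k s f₁ ::ₘ .odd k s d ::ₘ z) := by
    intro f₄
    by_cases h : f₂ = f₁
    · subst h; exact ⟨f₄, Mv.refl _⟩
    · obtain rfl : f₁ = !f₂ := Bool.eq_not.2 (Ne.symm h)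
      exact ⟨!f₄, mv_odd_odd _ _ _ _ _ _⟩
  have h2 : ∀ d z, ∃ d', Mv.{u} (.odd k s f₃ ::ₘ .odd k s d ::ₘ z)
      (.odd k s f₁ ::ₘ .odd k s d' ::ₘ z) := by
    intro d z
    by_cases h : f₃ = f₁
    · subst h; exact ⟨d, Mv.refl _⟩
    · obtain rfl : f₁ = !f₃ := Bool.eq_not.2 (Ne.symm h)
      exact ⟨!d, mv_odd_odd _ _ _ _ _ _⟩
  obtain ⟨d, hd⟩ := h1 f₄
  obtain ⟨d', hd'⟩ := h2 d z
  -- Toggling the bits in pairs makes those of the first three symbols equal.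
  have m1 : Mv.{u} (.odd k s f₁ ::ₘ .odd k s f₂ ::ₘ .odd k s f₃ ::ₘ .odd k s f₄ ::ₘ z)
      (.odd k s f₁ ::ₘ .odd k s f₁ ::ₘ .odd k s f₁ ::ₘ .odd k s d' ::ₘ z) := by
    have a1 := (hd.cons (.odd k s f₃)).cons (.odd k s f₁)
    rw [Multiset.cons_swap (Gen.odd k s f₃) (Gen.odd k s f₂),
      Multiset.cons_swap (Gen.odd k s f₃) (Gen.odd k s f₁)] at a1
    exact a1.trans ((hd'.cons _).cons _)
  refine ⟨!f₁, !d', m1.trans ⟨?_, ?_, ?_⟩⟩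
  -- Three equal symbols of sign `s` become one of the opposite sign plus the plane `x² + xy + y²`;
  -- this plane and the fourth symbol then become three symbols of the opposite sign.
  · have r1 := Gen.cls_odd_add_even_true.{u} k (!s) (!f₁)
    have r2 := Gen.cls_odd_add_even_true.{u} k s d'
    rw [Bool.not_not, Bool.not_not] at r1
    simp only [symCls_cons]
    generalize symCls.{u} z = Z at *
    calc _ = ((Gen.odd k s f₁).cls + (Gen.odd k s f₁).cls + (Gen.odd k s f₁).cls)
          + (Gen.odd k s d').cls + Z := by abel
      _ = (Gen.odd k (!s) !f₁).cls + ((Gen.odd k s d').cls + (Gen.even k true).cls) + Z := by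
        rw [← r1]; abel
      _ = _ := by rw [r2]; abel
  · simp only [symE4_cons, Gen.e4]
    generalize symE4 z = Z
    clear * - Z f₁ d'
    revert Z f₁ d'
    decide
  · simp only [Multiset.map_cons, Gen.shape]

theorem Gen.rank_pos_iff {k : ℕ} {g : Gen} : g.rank (k + 1) ≠ 0 ↔ g.lvl = k := by
  cases g with
  | odd j s f =>
    simp only [Gen.rank, Gen.lvl]
    split_ifs with h
    · exact iff_of_true one_ne_zero (by omega)
    · exact iff_of_false (fun h' => h' rfl) (by omega)
  | even j f =>
    simp only [Gen.rank, Gen.lvl]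
    split_ifs with h
    · exact iff_of_true two_ne_zero (by omega)
    · exact iff_of_false (fun h' => h' rfl) (by omega)

theorem symRank_ne_zero_iff {k : ℕ} {x : Multiset Gen} :
    symRank (k + 1) x ≠ 0 ↔ ∃ g ∈ x, g.lvl = k := by
  rw [symRank, Ne, Multiset.sum_eq_zero_iff]
  simp only [Multiset.mem_map, forall_exists_index, and_imp, forall_apply_eq_imp_iff₂]
  push Not
  exact exists_congr fun g => and_congr_right fun _ => Gen.rank_pos_iff

theorem symRank_eq_zero {k : ℕ} {x : Multiset Gen} (h : ∀ g ∈ x, g.lvl ≠ k) :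
    symRank (k + 1) x = 0 := by
  by_contra h0
  obtain ⟨g, hg, hk⟩ := symRank_ne_zero_iff.1 h0
  exact h g hg hk

theorem above_of_not_irr {m : ℕ} {x : Multiset Gen} (h : ∀ g ∈ x, m ≤ g.lvl) (hirr : ¬ Irr m x) :
    ∀ g ∈ x, g.Above m := by
  intro g hg
  have := h g hg
  cases g with
  | odd k s f =>
    have hk : m ≤ k := this
    have : m ≠ k := by rintro rfl; exact hirr ⟨s, f, hg⟩
    exact (by omega : m + 1 ≤ k)
  | even k f => exact this

theorem above_of_lt {m : ℕ} {x : Multiset Gen} (h : ∀ g ∈ x, m + 1 ≤ g.lvl) :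
    ∀ g ∈ x, g.Above m := by
  intro g hg
  have := h g hg
  cases g with
  | odd k s f => exact this
  | even k f => exact le_trans (Nat.le_succ m) this

theorem Irr.mono {k : ℕ} {g : Gen} {x : Multiset Gen} (h : Irr k x) : Irr k (g ::ₘ x) := by
  obtain ⟨s, f, hm⟩ := h
  exact ⟨s, f, Multiset.mem_cons_of_mem hm⟩

/-- No odd symbol sits on level `m - 1`, so index `m` is regular (or `m = 0`), and there the
signatures are compared. -/
theorem Sim.sig_of_le {x y : Multiset Gen} (h : Sim x y) {m : ℕ} (hm : ∀ g ∈ x, m ≤ g.lvl) :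
    symSig m x = symSig m y := by
  cases m with
  | zero => exact h.sig_zero
  | succ j =>
    refine h.sig_succ j ?_
    rintro ⟨s, f, hj⟩
    exact absurd (hm _ hj) (by simp [Gen.lvl])

/-- A common symbol of lowest level can be removed. -/
theorem Sim.of_cons {g : Gen} {c c' : Multiset Gen} (h : Sim (g ::ₘ c) (g ::ₘ c'))
    (hp : IsPure (g ::ₘ c)) (hp' : IsPure (g ::ₘ c')) (hl : ∀ a ∈ g ::ₘ c, g.lvl ≤ a.lvl)
    (hl' : ∀ a ∈ g ::ₘ c', g.lvl ≤ a.lvl) : Sim c c' := by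
  have hrank : ∀ m, symRank m c = symRank m c' := by
    intro m
    have := h.rank m
    rw [symRank_cons, symRank_cons] at this
    omega
  have he4 : symE4 c = symE4 c' := by
    have := h.e4
    rw [symE4_cons, symE4_cons] at this
    exact add_left_cancel this
  have hcancel : ∀ m, symSig m (g ::ₘ c) = symSig m (g ::ₘ c') → symSig m c = symSig m c' := by
    intro m hm
    rw [symSig_cons, symSig_cons] at hm
    exact add_left_cancel hm
  cases g with
  | even k e =>
    have hi : ∀ j z, Irr j (Gen.even k e ::ₘ z) ↔ Irr j z := fun j z =>
      irr_cons_iff_of_ne (fun _ _ => by simp) z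
    refine ⟨hrank, fun j => ?_, hcancel 0 h.sig_zero, fun j hj => ?_, he4⟩
    · rw [← hi j c, ← hi j c', h.irr]
    · exact hcancel _ (h.sig_succ j (fun h' => hj ((hi j c).1 h')))
  | odd k s f =>
    have hi : ∀ j z, j ≠ k → (Irr j (Gen.odd k s f ::ₘ z) ↔ Irr j z) := fun j z hjk =>
      irr_cons_iff_of_ne (fun _ _ h' => hjk (by injection h')) z
    -- By purity the rest has only odd symbols on level `k`, so their presence is visible from the
    -- rank.
    have hk : ∀ z, IsPure (Gen.odd k s f ::ₘ z) → (Irr k z ↔ symRank (k + 1) z ≠ 0) := by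
      intro z hz
      rw [symRank_ne_zero_iff]
      constructor
      · rintro ⟨s', f', hm⟩
        exact ⟨_, hm, rfl⟩
      · rintro ⟨g, hg, hgk⟩
        cases g with
        | odd j s' f' =>
          obtain rfl : j = k := hgk
          exact ⟨s', f', hg⟩
        | even j e =>
          obtain rfl : j = k := hgk
          exact absurd (Multiset.mem_cons_of_mem hg) (hz j s f e (Multiset.mem_cons_self _ _))
    have hirr : ∀ j, Irr j c ↔ Irr j c' := by
      intro j
      by_cases hjk : j = k
      · subst hjk
        rw [hk c hp, hk c' hp', hrank]
      · rw [← hi j c hjk, ← hi j c' hjk, h.irr]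
    refine ⟨hrank, hirr, hcancel 0 h.sig_zero, fun j hj => ?_, he4⟩
    by_cases hjk : j = k
    · subst hjk
      -- Removing the symbol may turn index `k + 1` regular, where `Sim` gave no comparison. The
      -- signature there is that at `k` plus the total parity.
      have habove : ∀ z, IsPure (Gen.odd j s f ::ₘ z) → ¬ Irr j z →
          (∀ a ∈ Gen.odd j s f ::ₘ z, (Gen.odd j s f).lvl ≤ a.lvl) →
          symSig (j + 1) z = symSig j z + symE4 z := by
        intro z hz hjz hlz
        exact symSig_succ_of_above
          (above_of_not_irr (fun a ha => hlz a (Multiset.mem_cons_of_mem ha)) hjz)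
      rw [habove c hp hj hl, habove c' hp' (fun h' => hj ((hirr j).2 h')) hl', he4,
        hcancel j (h.sig_of_le hl)]
    · exact hcancel _ (h.sig_succ j (fun h' => hj ((hi j c hjk).1 h')))

/-! ### Producing a common symbol of lowest level -/

/-- Up to moves, `x` and `y` share a symbol of index `k`. -/
def Common (k : ℕ) (x y : Multiset Gen) : Prop :=
  ∃ g c c', g.lvl = k ∧ Mv.{u} x (g ::ₘ c) ∧ Mv.{u} y (g ::ₘ c')

theorem Common.of_mv {k : ℕ} {x x' y y' : Multiset Gen} (h : Common.{u} k x' y')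
    (hx : Mv.{u} x x') (hy : Mv.{u} y y') : Common.{u} k x y := by
  obtain ⟨g, c, c', hg, h1, h2⟩ := h
  exact ⟨g, c, c', hg, hx.trans h1, hy.trans h2⟩

theorem common_self (g : Gen) (c c' : Multiset Gen) : Common.{u} g.lvl (g ::ₘ c) (g ::ₘ c') :=
  ⟨g, c, c', rfl, Mv.refl _, Mv.refl _⟩

theorem exists_cons_even {k : ℕ} {y : Multiset Gen} (hr : symRank (k + 1) y ≠ 0)
    (hi : ¬ Irr k y) : ∃ e c, y = Gen.even k e ::ₘ c := by
  obtain ⟨g, hg, hk⟩ := symRank_ne_zero_iff.1 hr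
  cases g with
  | odd j s f =>
    obtain rfl : j = k := hk
    exact absurd ⟨s, f, hg⟩ hi
  | even j e =>
    obtain rfl : j = k := hk
    exact ⟨e, Multiset.exists_cons_of_mem hg⟩

theorem lt_lvl_of_symRank_eq_zero {k : ℕ} {c : Multiset Gen} (hl : ∀ g ∈ c, k ≤ g.lvl)
    (hr : symRank (k + 1) c = 0) : ∀ g ∈ c, k + 1 ≤ g.lvl := by
  intro g hg
  have h1 := hl g hg
  have h2 : g.lvl ≠ k := fun h => symRank_ne_zero_iff.2 ⟨g, hg, h⟩ hr
  omega

/-- The lowest symbols are planes. If their bits differ, a second plane on level `k` or an odd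
symbol on level `k + 1` can absorb the difference. Otherwise indices `k + 1` and `k + 2` are
regular, and the difference of their signatures is the parity of the remainder, which contradicts
equal total parities. -/
theorem common_of_regular {k : ℕ} {x y : Multiset Gen} (h : Sim x y)
    (hl : ∀ g ∈ x, k ≤ g.lvl) (hl' : ∀ g ∈ y, k ≤ g.lvl) (hr : symRank (k + 1) x ≠ 0)
    (hi : ¬ Irr k x) : Common.{u} k x y := by
  have hi' : ¬ Irr k y := fun h' => hi ((h.irr k).2 h')
  obtain ⟨e, c, rfl⟩ := exists_cons_even hr hi
  obtain ⟨e', c', rfl⟩ := exists_cons_even (h.rank (k + 1) ▸ hr) hi'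
  by_cases hee : e = e'
  · subst hee; exact common_self (Gen.even _ _) _ _
  obtain rfl : e' = !e := Bool.eq_not.2 (Ne.symm hee)
  have hcc : symRank (k + 1) c = symRank (k + 1) c' := by
    have := h.rank (k + 1)
    rw [symRank_cons, symRank_cons] at this
    simp only [Gen.rank] at this
    omega
  have hev : ∀ e j z, Irr j (Gen.even k e ::ₘ z) ↔ Irr j z := fun e j z =>
    irr_cons_iff_of_ne (fun _ _ => by simp) z
  by_cases hc : symRank (k + 1) c = 0
  · have hlc := lt_lvl_of_symRank_eq_zero
      (fun g hg => hl g (Multiset.mem_cons_of_mem hg)) hc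
    have hlc' := lt_lvl_of_symRank_eq_zero
      (fun g hg => hl' g (Multiset.mem_cons_of_mem hg)) (hcc ▸ hc)
    by_cases hi1 : Irr (k + 1) c'
    · obtain ⟨s, f, hsf⟩ := hi1
      obtain ⟨z, rfl⟩ := Multiset.exists_cons_of_mem hsf
      have := mv_even_odd_succ.{u} k s f (!e) z
      rw [Bool.not_not] at this
      exact (common_self _ _ _).of_mv (Mv.refl _) this
    · exfalso
      have hi1x : ¬ Irr (k + 1) (Gen.even k e ::ₘ c) := fun h' =>
        hi1 ((hev _ _ _).1 ((h.irr _).1 h'))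
      have hi1c : ¬ Irr (k + 1) c := fun h' => hi1x ((hev _ _ _).2 h')
      have e1 := h.sig_succ k hi
      have e2 := h.sig_succ (k + 1) hi1x
      have e3 := h.e4
      rw [symSig_cons, symSig_cons, Gen.sig_of_lvl_lt (Nat.lt_succ_self k),
        Gen.sig_of_lvl_lt (Nat.lt_succ_self k), zero_add, zero_add] at e1
      rw [symSig_cons, symSig_cons, Gen.sig_of_lvl_lt (show k < k + 1 + 1 by omega),
        Gen.sig_of_lvl_lt (show k < k + 1 + 1 by omega), zero_add, zero_add,
        symSig_succ_of_above (above_of_not_irr hlc hi1c),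
        symSig_succ_of_above (above_of_not_irr hlc' hi1), e1] at e2
      rw [symE4_cons, symE4_cons, add_left_cancel e2] at e3
      have e4 := add_right_cancel e3
      simp only [Gen.e4] at e4
      clear * - e4
      revert e
      decide
  · have hic : ¬ Irr k c := fun h' => hi h'.mono
    have hic' : ¬ Irr k c' := fun h' => hi' h'.mono
    obtain ⟨e₂, c₂, rfl⟩ := exists_cons_even hc hic
    obtain ⟨e₂', c₂', rfl⟩ := exists_cons_even (hcc ▸ hc) hic'
    by_cases h1 : e₂ = e
    · subst h1
      exact (common_self _ _ _).of_mv (mv_even_even _ _ _) (Mv.refl _)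
    · obtain rfl : e₂ = !e := Bool.eq_not.2 h1
      exact (common_self (Gen.even k _) _ _).of_mv (mv_swap _ _ _) (Mv.refl _)

/-- If the odd symbols of lowest level of `c` have distinct signs and the next level is regular,
then there are at most two of them, and their contribution to the signature is known. -/
theorem sig_of_distinct_signs {n : ℕ} {c : Multiset Gen} (hl : ∀ g ∈ c, n ≤ g.lvl)
    (he : ∀ e, Gen.even n e ∉ c) (hi : Irr n c) (hi' : ¬ Irr (n + 1) c)
    (hd : ∀ s f f' z, c ≠ Gen.odd n s f ::ₘ Gen.odd n s f' ::ₘ z) :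
    (symRank (n + 1) c = 1 ∧ ∃ s, symSig n c = Gen.sgn s + symSig (n + 2) c) ∨
      (symRank (n + 1) c = 2 ∧ symSig n c = symSig (n + 2) c) := by
  have hodd : ∀ d : Multiset Gen, d ≤ c → symRank (n + 1) d ≠ 0 →
      ∃ s f z, d = Gen.odd n s f ::ₘ z := by
    intro d hdc hr
    obtain ⟨g, hg, hk⟩ := symRank_ne_zero_iff.1 hr
    cases g with
    | odd j s f =>
      obtain rfl : j = n := hk
      obtain ⟨z, hz⟩ := Multiset.exists_cons_of_mem hg
      exact ⟨s, f, z, hz⟩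
    | even j e =>
      obtain rfl : j = n := hk
      exact absurd (Multiset.mem_of_le hdc hg) (he e)
  have hrest : ∀ d : Multiset Gen, d ≤ c → symRank (n + 1) d = 0 →
      symSig (n + 2) d = symSig n d := by
    intro d hdc hr
    refine symSig_succ_succ_of_above (above_of_not_irr (lt_lvl_of_symRank_eq_zero
      (fun g hg => hl g (Multiset.mem_of_le hdc hg)) hr) ?_)
    rintro ⟨s, f, hm⟩
    exact hi' ⟨s, f, Multiset.mem_of_le hdc hm⟩
  have hrk : ∀ s f, (Gen.odd n s f).rank (n + 1) = 1 := fun s f => if_pos rfl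
  have hlow : ∀ s f, (Gen.odd n s f).sig (n + 2) = 0 := fun s f =>
    Gen.sig_of_lvl_lt (show n < n + 2 by omega)
  obtain ⟨s₁, f₁, hm⟩ := hi
  obtain ⟨d, rfl⟩ := Multiset.exists_cons_of_mem hm
  have hdc : d ≤ Gen.odd n s₁ f₁ ::ₘ d := Multiset.le_cons_self _ _
  by_cases hrd : symRank (n + 1) d = 0
  · left
    rw [symRank_cons, hrk, hrd]
    refine ⟨rfl, s₁, ?_⟩
    rw [symSig_cons, symSig_cons, Gen.sig_odd_self, hlow, hrest d hdc hrd, zero_add]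
  · right
    obtain ⟨s₂, f₂, z, rfl⟩ := hodd d hdc hrd
    have hs : s₂ = !s₁ := by
      refine Bool.eq_not.2 fun hs => ?_
      subst hs
      exact hd _ _ _ _ rfl
    subst hs
    have hzc : z ≤ Gen.odd n s₁ f₁ ::ₘ Gen.odd n (!s₁) f₂ ::ₘ z :=
      (Multiset.le_cons_self _ _).trans hdc
    -- A third odd symbol would repeat one of the two opposite signs.
    have hrz : symRank (n + 1) z = 0 := by
      by_contra hrz
      obtain ⟨s₃, f₃, w, rfl⟩ := hodd z hzc hrz
      by_cases h3 : s₃ = s₁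
      · subst h3
        exact hd s₃ f₁ f₃ (Gen.odd n (!s₃) f₂ ::ₘ w) (by
          rw [Multiset.cons_swap (Gen.odd n s₃ f₃)])
      · obtain rfl : s₃ = !s₁ := Bool.eq_not.2 h3
        exact hd (!s₁) f₂ f₃ (Gen.odd n s₁ f₁ ::ₘ w) (by
          rw [Multiset.cons_swap (Gen.odd n s₁ f₁),
            Multiset.cons_swap (Gen.odd n s₁ f₁)])
    rw [symRank_cons, symRank_cons, hrk, hrk, hrz]
    refine ⟨rfl, ?_⟩
    rw [symSig_cons, symSig_cons, symSig_cons, symSig_cons, Gen.sig_odd_self, Gen.sig_odd_self,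
      hlow, hlow, hrest z hzc hrz, zero_add, zero_add, ← add_assoc]
    have : ∀ s, Gen.sgn s + Gen.sgn (!s) = 0 := by decide
    rw [this, zero_add]

/-- The neighbouring-level move is applied with each of the two upper symbols in turn. The sign `s`
is reversed twice, and the bit toggles once, as `s₁` agrees with exactly one of `s` and `!s`. -/
theorem mv_double_sign (k : ℕ) (s f s₁ f₁ f₂ : Bool) (z : Multiset Gen) :
    ∃ w, Mv.{u} (.odd k s f ::ₘ .odd (k + 1) s₁ f₁ ::ₘ .odd (k + 1) s₁ f₂ ::ₘ z)
      (.odd k s (!f) ::ₘ w) := by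
  have m1 := mv_odd_odd_succ.{u} k s f s₁ f₁ (.odd (k + 1) s₁ f₂ ::ₘ z)
  have m2 := mv_odd_odd_succ.{u} k (!s) (f ^^ (s == s₁)) s₁ f₂
    (.odd (k + 1) (!s₁) (f₁ ^^ (s == s₁)) ::ₘ z)
  rw [Multiset.cons_swap (Gen.odd (k + 1) (!s₁) (f₁ ^^ (s == s₁)))] at m1
  have m3 := m1.trans m2
  have : ((f ^^ (s == s₁)) ^^ ((!s) == s₁)) = !f := by
    clear * - f s s₁
    revert f s s₁
    decide
  rw [Bool.not_not, this] at m3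
  exact ⟨_, m3⟩

/-- Suppose the bits differ. An odd symbol on level `k + 2`, a plane on level `k + 1`, or two odd
symbols of equal sign on level `k + 1` allow one to toggle the bit. If none of these is present,
index `k + 3` is regular and too little remains on level `k + 1` to account for the discrepancy 4 in
parity. -/
theorem common_of_single_same_sign {k : ℕ} {s f f' : Bool} {c c' : Multiset Gen}
    (h : Sim (.odd k s f ::ₘ c) (.odd k s f' ::ₘ c')) (hp : IsPure (.odd k s f ::ₘ c))
    (hp' : IsPure (.odd k s f' ::ₘ c')) (hl : ∀ g ∈ c, k + 1 ≤ g.lvl)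
    (hl' : ∀ g ∈ c', k + 1 ≤ g.lvl) :
    Common.{u} k (.odd k s f ::ₘ c) (.odd k s f' ::ₘ c') := by
  by_cases hff : f' = f
  · subst hff; exact common_self (Gen.odd _ _ _) _ _
  obtain rfl : f' = !f := Bool.eq_not.2 hff
  have hirr : ∀ j f z, j ≠ k → (Irr j (Gen.odd k s f ::ₘ z) ↔ Irr j z) := fun j f z hjk =>
    irr_cons_iff_of_ne (fun _ _ h' => hjk (by injection h')) z
  by_cases hi2 : Irr (k + 2) c'
  · obtain ⟨s₁, f₁, hm⟩ := hi2
    obtain ⟨z, rfl⟩ := Multiset.exists_cons_of_mem hm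
    have := mv_odd_odd_succ_succ.{u} k s (!f) s₁ f₁ z
    rw [Bool.not_not] at this
    exact (common_self _ _ _).of_mv (Mv.refl _) this
  have hi2' : ¬ Irr (k + 2) c := fun h' => hi2 ((hirr _ _ _ (by omega)).1
    ((h.irr _).1 ((hirr _ _ _ (by omega)).2 h')))
  have hcons : ∀ m f z, k < m → symSig m (Gen.odd k s f ::ₘ z) = symSig m z := by
    intro m f z hm
    rw [symSig_cons, Gen.sig_of_lvl_lt hm, zero_add]
  have hrank : symRank (k + 2) c = symRank (k + 2) c' := by
    have := h.rank (k + 2)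
    rw [symRank_cons, symRank_cons] at this
    exact Nat.add_left_cancel this
  have h3 : symSig (k + 3) c = symSig (k + 3) c' := by
    have := h.sig_succ (k + 2) (fun h' => hi2' ((hirr _ _ _ (by omega)).1 h'))
    rwa [hcons _ _ _ (by omega), hcons _ _ _ (by omega)] at this
  have he4 : symE4 c = symE4 c' + 4 := by
    have := h.e4
    rw [symE4_cons, symE4_cons] at this
    simp only [Gen.e4] at this
    have hb : ∀ f, 4 * Gen.bit (!f) = 4 * Gen.bit f + 4 := by decide
    rw [hb] at this
    linear_combination this
  by_cases hR : symRank (k + 2) c' = 0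
  -- With level `k + 1` empty, indices `k + 2` and `k + 3` are both regular, and their signatures
  -- give equal parities for the remainders, whereas these differ by 4.
  · exfalso
    have hlc := lt_lvl_of_symRank_eq_zero hl (hrank.trans hR)
    have hlc' := lt_lvl_of_symRank_eq_zero hl' hR
    have h2 : symSig (k + 2) c = symSig (k + 2) c' := by
      have hi1 : ¬ Irr (k + 1) (Gen.odd k s f ::ₘ c) := by
        rw [hirr _ _ _ (by omega)]
        rintro ⟨s₁, f₁, hm⟩
        have : k + 1 + 1 ≤ k + 1 := hlc _ hm
        omega
      have := h.sig_succ (k + 1) hi1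
      rwa [hcons _ _ _ (by omega), hcons _ _ _ (by omega)] at this
    have h3a := symSig_succ_of_above (above_of_not_irr hlc hi2')
    have h3b := symSig_succ_of_above (above_of_not_irr hlc' hi2)
    have h3' : symSig (k + 1 + 1 + 1) c = symSig (k + 1 + 1 + 1) c' := h3
    have h2' : symSig (k + 1 + 1) c = symSig (k + 1 + 1) c' := h2
    rw [h3a, h3b, h2', he4] at h3'
    have : (4 : ZMod 8) = 0 := by linear_combination h3'
    exact absurd this (by decide)
  · obtain ⟨g, hg, hgk⟩ := symRank_ne_zero_iff.1 hR
    cases g with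
    | even j e =>
      obtain rfl : j = k + 1 := hgk
      obtain ⟨z, rfl⟩ := Multiset.exists_cons_of_mem hg
      have := mv_odd_even_succ.{u} k s (!f) e z
      rw [Bool.not_not] at this
      exact (common_self _ _ _).of_mv (Mv.refl _) this
    | odd j s₁ f₁ =>
      obtain rfl : j = k + 1 := hgk
      have hic' : Irr (k + 1) c' := ⟨s₁, f₁, hg⟩
      have hic : Irr (k + 1) c := (hirr _ _ _ (by omega)).1
        ((h.irr _).2 ((hirr _ _ _ (by omega)).2 hic'))
      by_cases hd' : ∀ s f f' z, c' ≠ Gen.odd (k + 1) s f ::ₘ Gen.odd (k + 1) s f' ::ₘ z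
      · by_cases hd : ∀ s f f' z, c ≠ Gen.odd (k + 1) s f ::ₘ Gen.odd (k + 1) s f' ::ₘ z
        -- The signatures at `k + 1` differ by 4 and those at `k + 3` agree. But level `k + 1`
        -- contributes a single sign or two opposite ones on each side, so the discrepancy could
        -- only be 0 or ±2.
        · exfalso
          have hev : ∀ e, Gen.even (k + 1) e ∉ c := by
            intro e he
            obtain ⟨s₂, f₂, h2⟩ := hic
            exact hp _ _ _ _ (Multiset.mem_cons_of_mem h2) (Multiset.mem_cons_of_mem he)
          have hev' : ∀ e, Gen.even (k + 1) e ∉ c' := by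
            intro e he
            exact hp' _ _ _ _ (Multiset.mem_cons_of_mem hg) (Multiset.mem_cons_of_mem he)
          have d1 := sig_of_distinct_signs hl hev hic hi2' hd
          have d2 := sig_of_distinct_signs hl' hev' hic' hi2 hd'
          have h0 : symSig k c = symSig k c' := by
            have := h.sig_of_le (m := k) (by
              intro a ha
              rcases Multiset.mem_cons.1 ha with rfl | ha
              · exact le_rfl
              · exact le_trans (Nat.le_succ k) (hl a ha))
            rw [symSig_cons, symSig_cons, Gen.sig_odd_self, Gen.sig_odd_self] at this
            exact add_left_cancel this
          have h1 : symSig (k + 1) c = symSig (k + 1) c' + 4 := by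
            rw [symSig_succ_of_above (above_of_lt hl), symSig_succ_of_above (above_of_lt hl'), h0,
              he4, add_assoc]
          have h3' : symSig (k + 1 + 2) c = symSig (k + 1 + 2) c' := h3
          have hrank' : symRank (k + 1 + 1) c = symRank (k + 1 + 1) c' := hrank
          rcases d1 with ⟨r1, s₂, d1⟩ | ⟨r1, d1⟩ <;> rcases d2 with ⟨r2, s₃, d2⟩ | ⟨r2, d2⟩
          · rw [d1, d2, h3'] at h1
            have : Gen.sgn s₂ = Gen.sgn s₃ + 4 := by linear_combination h1
            clear * - this
            revert s₂ s₃
            decide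
          · omega
          · omega
          · rw [d1, d2, h3'] at h1
            have : (4 : ZMod 8) = 0 := by linear_combination -h1
            exact absurd this (by decide)
        · push Not at hd
          obtain ⟨s₂, f₂, f₃, z, rfl⟩ := hd
          obtain ⟨w, hw⟩ := mv_double_sign.{u} k s f s₂ f₂ f₃ z
          exact (common_self _ _ _).of_mv hw (Mv.refl _)
      · push Not at hd'
        obtain ⟨s₂, f₂, f₃, z, rfl⟩ := hd'
        obtain ⟨w, hw⟩ := mv_double_sign.{u} k s (!f) s₂ f₂ f₃ z
        rw [Bool.not_not] at hw
        exact (common_self _ _ _).of_mv (Mv.refl _) hw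

/-- For opposite signs, an odd symbol on level `k + 1` reverses one of them. Without it index `k +
2` is regular, and the difference of the signatures at `k` and `k + 2` is the sign itself. -/
theorem common_of_single {k : ℕ} {s f s' f' : Bool} {c c' : Multiset Gen}
    (h : Sim (.odd k s f ::ₘ c) (.odd k s' f' ::ₘ c')) (hp : IsPure (.odd k s f ::ₘ c))
    (hp' : IsPure (.odd k s' f' ::ₘ c')) (hl : ∀ g ∈ c, k + 1 ≤ g.lvl)
    (hl' : ∀ g ∈ c', k + 1 ≤ g.lvl) :
    Common.{u} k (.odd k s f ::ₘ c) (.odd k s' f' ::ₘ c') := by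
  by_cases hss : s' = s
  · subst hss
    exact common_of_single_same_sign h hp hp' hl hl'
  obtain rfl : s' = !s := Bool.eq_not.2 hss
  by_cases hi : Irr (k + 1) c'
  · obtain ⟨s₁, f₁, hm⟩ := hi
    obtain ⟨z, rfl⟩ := Multiset.exists_cons_of_mem hm
    have hmv := mv_odd_odd_succ.{u} k (!s) f' s₁ f₁ z
    rw [Bool.not_not] at hmv
    refine Common.of_mv ?_ (Mv.refl _) hmv
    refine common_of_single_same_sign (h.trans hmv.sim) hp (hmv.isPure hp') hl ?_
    intro a ha
    rcases Multiset.mem_cons.1 ha with rfl | ha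
    · exact le_rfl
    · exact hl' a (Multiset.mem_cons_of_mem ha)
  · exfalso
    have hirr : ∀ j s f z, j ≠ k → (Irr j (Gen.odd k s f ::ₘ z) ↔ Irr j z) := fun j s f z hjk =>
      irr_cons_iff_of_ne (fun _ _ h' => hjk (by injection h')) z
    have hix : ¬ Irr (k + 1) (.odd k s f ::ₘ c) := fun h' => hi ((hirr _ _ _ _ (by omega)).1
      ((h.irr _).1 h'))
    have hic : ¬ Irr (k + 1) c := fun h' => hix h'.mono
    have h0 := h.sig_of_le (m := k) (by
      intro a ha
      rcases Multiset.mem_cons.1 ha with rfl | ha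
      · exact le_rfl
      · exact le_trans (Nat.le_succ k) (hl a ha))
    have h2 : symSig (k + 2) _ = symSig (k + 2) _ := h.sig_succ (k + 1) hix
    rw [symSig_cons, symSig_cons, Gen.sig_odd_self, Gen.sig_odd_self] at h0
    rw [symSig_cons, symSig_cons, Gen.sig_of_lvl_lt (show k < k + 2 by omega),
      Gen.sig_of_lvl_lt (show k < k + 2 by omega), zero_add, zero_add,
      symSig_succ_succ_of_above (above_of_not_irr hl hic),
      symSig_succ_succ_of_above (above_of_not_irr hl' hi)] at h2
    rw [h2] at h0
    have := add_right_cancel h0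
    clear * - this
    revert s
    decide

theorem exists_odd_of_pure {k : ℕ} {s f : Bool} {c : Multiset Gen}
    (hp : IsPure (.odd k s f ::ₘ c)) (hr : symRank (k + 1) c ≠ 0) :
    ∃ s' f' z, c = Gen.odd k s' f' ::ₘ z := by
  obtain ⟨g, hg, hk⟩ := symRank_ne_zero_iff.1 hr
  cases g with
  | odd j s' f' =>
    obtain rfl : j = k := hk
    obtain ⟨z, hz⟩ := Multiset.exists_cons_of_mem hg
    exact ⟨s', f', z, hz⟩
  | even j e =>
    obtain rfl : j = k := hk
    exact absurd (Multiset.mem_cons_of_mem hg) (hp _ _ _ _ (Multiset.mem_cons_self _ _))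

/-- A differing bit is toggled together with that of a second symbol of level `k`, which exists by
the rank and is odd by purity. -/
theorem common_of_common_sign {k : ℕ} {s f f' : Bool} {x y : Multiset Gen} (hp' : IsPure y)
    (hr : 2 ≤ symRank (k + 1) y) (hx : Gen.odd k s f ∈ x) (hy : Gen.odd k s f' ∈ y) :
    Common.{u} k x y := by
  obtain ⟨c, rfl⟩ := Multiset.exists_cons_of_mem hx
  obtain ⟨c', rfl⟩ := Multiset.exists_cons_of_mem hy
  by_cases hff : f' = f
  · subst hff; exact common_self (Gen.odd _ _ _) _ _
  obtain rfl : f' = !f := Bool.eq_not.2 hff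
  have hr' : symRank (k + 1) c' ≠ 0 := by
    rw [symRank_cons, show (Gen.odd k s !f).rank (k + 1) = 1 from if_pos rfl] at hr
    omega
  obtain ⟨s₁, f₁, z, rfl⟩ := exists_odd_of_pure hp' hr'
  have := mv_odd_odd.{u} k s (!f) s₁ f₁ z
  rw [Bool.not_not] at this
  exact (common_self _ _ _).of_mv (Mv.refl _) this

/-- If all symbols of lowest level `k` are odd with the same sign and the next level is regular,
then their contribution to the signature is known. -/
theorem sig_of_constant_sign {k : ℕ} {s : Bool} {x : Multiset Gen} (hl : ∀ g ∈ x, k ≤ g.lvl)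
    (hs : ∀ g ∈ x, g.lvl = k → ∃ f, g = Gen.odd k s f) (hi : ¬ Irr (k + 1) x) :
    symSig k x = Gen.sgn s * (symRank (k + 1) x : ZMod 8) + symSig (k + 2) x := by
  induction x using Multiset.induction_on with
  | empty => rw [symRank, symSig, symSig]; simp
  | cons g x ih =>
    have ih := ih (fun a ha => hl a (Multiset.mem_cons_of_mem ha))
      (fun a ha => hs a (Multiset.mem_cons_of_mem ha)) (fun h' => hi h'.mono)
    rw [symSig_cons, symSig_cons, symRank_cons, ih]
    have key : g.sig k = Gen.sgn s * (g.rank (k + 1) : ZMod 8) + g.sig (k + 2) := by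
      by_cases hk : g.lvl = k
      · obtain ⟨f, rfl⟩ := hs g (Multiset.mem_cons_self _ _) hk
        rw [Gen.sig_odd_self, Gen.sig_of_lvl_lt (show k < k + 2 by omega),
          show (Gen.odd k s f).rank (k + 1) = 1 from if_pos rfl]
        push_cast
        ring
      · have h1 : g.rank (k + 1) = 0 := by
          by_contra h0
          exact hk (Gen.rank_pos_iff.1 h0)
        have h2 : symSig (k + 2) {g} = symSig k {g} := by
          apply symSig_succ_succ_of_above
          apply above_of_not_irr
          · intro a ha
            rw [Multiset.mem_singleton] at ha
            subst ha
            have := hl a (Multiset.mem_cons_self _ _)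
            omega
          · rintro ⟨s', f', hm⟩
            rw [Multiset.mem_singleton] at hm
            exact hi ⟨s', f', hm ▸ Multiset.mem_cons_self _ _⟩
        rw [symSig, symSig, Multiset.map_singleton, Multiset.map_singleton,
          Multiset.sum_singleton, Multiset.sum_singleton] at h2
        rw [h1, h2]
        push_cast
        ring
    rw [key]
    push_cast
    ring

theorem exists_cons_of_constant_sign {k n : ℕ} {s : Bool} {x : Multiset Gen}
    (hs : ∀ g ∈ x, g.lvl = k → ∃ f, g = Gen.odd k s f) (hr : n + 1 ≤ symRank (k + 1) x) :
    ∃ f z, x = Gen.odd k s f ::ₘ z ∧ n ≤ symRank (k + 1) z ∧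
      ∀ g ∈ z, g.lvl = k → ∃ f, g = Gen.odd k s f := by
  obtain ⟨g, hg, hk⟩ := symRank_ne_zero_iff.1 (show symRank (k + 1) x ≠ 0 by omega)
  obtain ⟨f, rfl⟩ := hs g hg hk
  obtain ⟨z, rfl⟩ := Multiset.exists_cons_of_mem hg
  refine ⟨f, z, rfl, ?_, fun a ha => hs a (Multiset.mem_cons_of_mem ha)⟩
  rw [symRank_cons, show (Gen.odd k s f).rank (k + 1) = 1 from if_pos rfl] at hr
  omega

/-- The critical case is that all signs on level `k` are `s` in `x` and `!s` in `y`. One sign in `y`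
is reversed by an odd symbol on level `k + 1`, if there is one. Otherwise comparing signatures at
`k` and `k + 2` shows that twice the rank vanishes modulo 8, so there are at least four symbols, and
four signs can be reversed at once. -/
theorem common_of_two_le_rank {k : ℕ} {x y : Multiset Gen} (h : Sim x y) (hp : IsPure x)
    (hp' : IsPure y) (hl : ∀ g ∈ x, k ≤ g.lvl) (hl' : ∀ g ∈ y, k ≤ g.lvl)
    (hr : 2 ≤ symRank (k + 1) x) (hi : Irr k x) : Common.{u} k x y := by
  have hr' : 2 ≤ symRank (k + 1) y := h.rank (k + 1) ▸ hr
  have hi' := (h.irr k).1 hi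
  by_cases hcom : ∃ s f f', Gen.odd k s f ∈ x ∧ Gen.odd k s f' ∈ y
  · obtain ⟨s, f, f', hx, hy⟩ := hcom
    exact common_of_common_sign hp' hr' hx hy
  obtain ⟨s, f, hx⟩ := hi
  have hsy : ∀ g ∈ y, g.lvl = k → ∃ f, g = Gen.odd k (!s) f := by
    intro g hg hk
    obtain ⟨s₁, f₁, h1⟩ := hi'
    cases g with
    | odd j s₂ f₂ =>
      obtain rfl : j = k := hk
      refine ⟨f₂, ?_⟩
      have : s₂ = !s := Bool.eq_not.2 fun hs => hcom ⟨s, f, f₂, hx, hs ▸ hg⟩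
      rw [this]
    | even j e =>
      obtain rfl : j = k := hk
      exact absurd hg (hp' _ _ _ _ h1)
  have hsx : ∀ g ∈ x, g.lvl = k → ∃ f, g = Gen.odd k s f := by
    intro g hg hk
    cases g with
    | odd j s₂ f₂ =>
      obtain rfl : j = k := hk
      refine ⟨f₂, ?_⟩
      by_contra hne
      have hs2 : s₂ = !s := Bool.eq_not.2 fun hs => hne (by rw [hs])
      obtain ⟨g', hg', hk'⟩ := symRank_ne_zero_iff.1 (show symRank (j + 1) y ≠ 0 by omega)
      obtain ⟨f', rfl⟩ := hsy g' hg' hk'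
      exact hcom ⟨!s, f₂, f', hs2 ▸ hg, hg'⟩
    | even j e =>
      obtain rfl : j = k := hk
      exact absurd hg (hp _ _ _ _ hx)
  by_cases hi1 : Irr (k + 1) y
  · obtain ⟨g, hg, hk⟩ := symRank_ne_zero_iff.1 (show symRank (k + 1) y ≠ 0 by omega)
    obtain ⟨f', rfl⟩ := hsy g hg hk
    obtain ⟨c, rfl⟩ := Multiset.exists_cons_of_mem hg
    obtain ⟨s₁, f₁, hm⟩ := hi1
    rcases Multiset.mem_cons.1 hm with hm | hm
    · injection hm with h1
      omega
    obtain ⟨z, rfl⟩ := Multiset.exists_cons_of_mem hm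
    have hmv := mv_odd_odd_succ.{u} k (!s) f' s₁ f₁ z
    rw [Bool.not_not] at hmv
    refine Common.of_mv ?_ (Mv.refl _) hmv
    exact common_of_common_sign (hmv.isPure hp') (hmv.sim.rank (k + 1) ▸ hr') hx
      (Multiset.mem_cons_self _ _)
  · have hi1x : ¬ Irr (k + 1) x := fun h' => hi1 ((h.irr _).1 h')
    have h0 := h.sig_of_le hl
    have h2 : symSig (k + 2) x = symSig (k + 2) y := h.sig_succ (k + 1) hi1x
    rw [sig_of_constant_sign hl hsx hi1x, sig_of_constant_sign hl' hsy hi1, h2,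
      h.rank (k + 1)] at h0
    -- Equality of `R` and `-R` modulo 8 excludes the ranks 2 and 3.
    have h4 : 4 ≤ symRank (k + 1) y := by
      by_contra hlt
      have h0' := add_right_cancel h0
      generalize symRank (k + 1) y = R at *
      have : R = 2 ∨ R = 3 := by omega
      rcases this with rfl | rfl
      · clear * - h0'
        revert s
        decide
      · clear * - h0'
        revert s
        decide
    obtain ⟨f₁, y₁, rfl, h4, hs1⟩ := exists_cons_of_constant_sign hsy h4
    obtain ⟨f₂, y₂, rfl, h4, hs2⟩ := exists_cons_of_constant_sign hs1 h4
    obtain ⟨f₃, y₃, rfl, h4, hs3⟩ := exists_cons_of_constant_sign hs2 h4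
    obtain ⟨f₄, y₄, rfl, h4, hs4⟩ := exists_cons_of_constant_sign hs3 h4
    obtain ⟨f', c, hmv⟩ := exists_mv_four.{u} k (!s) f₁ f₂ f₃ f₄ y₄
    rw [Bool.not_not] at hmv
    refine Common.of_mv ?_ (Mv.refl _) hmv
    exact common_of_common_sign (hmv.isPure hp') (hmv.sim.rank (k + 1) ▸ hr') hx
      (Multiset.mem_cons_self _ _)

theorem exists_common {k : ℕ} {x y : Multiset Gen} (h : Sim x y) (hp : IsPure x)
    (hp' : IsPure y) (hl : ∀ g ∈ x, k ≤ g.lvl) (hl' : ∀ g ∈ y, k ≤ g.lvl)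
    (hr : symRank (k + 1) x ≠ 0) : Common.{u} k x y := by
  by_cases hi : Irr k x
  · by_cases h2 : 2 ≤ symRank (k + 1) x
    · exact common_of_two_le_rank h hp hp' hl hl' h2 hi
    · have hi' := (h.irr k).1 hi
      have hry := h.rank (k + 1)
      obtain ⟨s, f, hm⟩ := hi
      obtain ⟨c, rfl⟩ := Multiset.exists_cons_of_mem hm
      obtain ⟨s', f', hm'⟩ := hi'
      obtain ⟨c', rfl⟩ := Multiset.exists_cons_of_mem hm'
      have hrk : ∀ s f, (Gen.odd k s f).rank (k + 1) = 1 := fun s f => if_pos rfl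
      rw [symRank_cons, hrk] at h2
      rw [symRank_cons, symRank_cons, hrk, hrk] at hry
      exact common_of_single h hp hp'
        (lt_lvl_of_symRank_eq_zero (fun g hg => hl g (Multiset.mem_cons_of_mem hg)) (by omega))
        (lt_lvl_of_symRank_eq_zero (fun g hg => hl' g (Multiset.mem_cons_of_mem hg)) (by omega))
  · exact common_of_regular h hl hl' hr hi

/-! ### Injectivity -/

/-- Induction on the number of symbols: moves produce a common symbol of lowest level, and its
removal preserves similarity and purity. -/
theorem symCls_eq_of_sim {x y : Multiset Gen} (h : Sim x y) (hp : IsPure x) (hp' : IsPure y) :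
    symCls.{u} x = symCls y := by
  classical
  induction hn : x.card generalizing x y with
  | zero =>
    rw [Multiset.card_eq_zero] at hn
    subst hn
    have : y = 0 := by
      refine Multiset.eq_zero_of_forall_notMem fun g hg => ?_
      have h1 : symRank (g.lvl + 1) y ≠ 0 := symRank_ne_zero_iff.2 ⟨g, hg, rfl⟩
      rw [← h.rank] at h1
      exact h1 rfl
    rw [this]
  | succ n ih =>
    have hex : ∃ k, ∃ g ∈ x, g.lvl = k := by
      obtain ⟨g, hg⟩ := Multiset.card_pos_iff_exists_mem.1 (by omega : 0 < x.card)
      exact ⟨_, g, hg, rfl⟩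
    obtain ⟨k, hk, hmin⟩ : ∃ k, (∃ g ∈ x, g.lvl = k) ∧ ∀ j < k, ¬ ∃ g ∈ x, g.lvl = j :=
      ⟨Nat.find hex, Nat.find_spec hex, fun j hj => Nat.find_min hex hj⟩
    have hl : ∀ g ∈ x, k ≤ g.lvl := fun g hg => by
      by_contra hlt
      exact hmin _ (not_le.1 hlt) ⟨g, hg, rfl⟩
    have hl' : ∀ g ∈ y, k ≤ g.lvl := fun g hg => by
      by_contra hlt
      refine hmin _ (not_le.1 hlt) (symRank_ne_zero_iff.1 ?_)
      rw [h.rank]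
      exact symRank_ne_zero_iff.2 ⟨g, hg, rfl⟩
    obtain ⟨g, c, c', hgk, hx, hy⟩ :=
      exists_common.{u} h hp hp' hl hl' (symRank_ne_zero_iff.2 hk)
    have hsim := (hx.sim.symm.trans h).trans hy.sim
    have hpc := hx.isPure hp
    have hpc' := hy.isPure hp'
    have hlc := hx.le_lvl hl
    have hlc' := hy.le_lvl hl'
    rw [← hgk] at hlc hlc'
    have hpure : ∀ z, IsPure (g ::ₘ z) → IsPure z := fun z hz j s f e ho he =>
      hz j s f e (Multiset.mem_cons_of_mem ho) (Multiset.mem_cons_of_mem he)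
    have hcard := hx.card
    rw [Multiset.card_cons, hn] at hcard
    have := ih (hsim.of_cons hpc hpc' hlc hlc') (hpure c hpc) (hpure c' hpc') (by omega)
    rw [hx.cls, hy.cls, symCls_cons, symCls_cons, this]

/-- A quadratic form is determined by its tableau. -/
theorem symCls_eq_of_symTab_eq {x y : Multiset Gen} (hp : IsPure x) (hp' : IsPure y)
    (h : symTab x = symTab y) : symCls.{u} x = symCls y := by
  by_cases he : symE4 x = symE4 y
  · exact symCls_eq_of_sim (sim_of_symTab_eq h he) hp hp'
  have hne : symE4 x = symE4 y + 4 := by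
    have h4 : ∀ z : Multiset Gen, symE4 z = 0 ∨ symE4 z = 4 := by
      intro z
      have : ∀ a : ZMod 8, a + a = 0 → a = 0 ∨ a = 4 := by decide
      exact this _ (symE4_add_self z)
    rcases h4 x with hx | hx <;> rcases h4 y with hy | hy
    · exact absurd (hx.trans hy.symm) he
    · rw [hx, hy]; decide
    · rw [hx, hy]; decide
    · exact absurd (hx.trans hy.symm) he
  -- If index 1 is irregular, the bit of an odd symbol on level 0 can be flipped without changing
  -- the class, which corrects the total parity.
  by_cases hi : Irr 0 y
  · obtain ⟨s, f, hm⟩ := hi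
    obtain ⟨z, rfl⟩ := Multiset.exists_cons_of_mem hm
    have hcls : symCls.{u} (.odd 0 s f ::ₘ z) = symCls (.odd 0 s (!f) ::ₘ z) := by
      rw [symCls_cons, symCls_cons, Gen.cls_odd_zero]
    rw [hcls]
    refine symCls_eq_of_sim (sim_of_symTab_eq (h.trans (symTab_eq_of_symCls_eq.{u} hcls)) ?_) hp ?_
    · rw [hne, symE4_cons, symE4_cons]
      simp only [Gen.e4]
      have hb : ∀ f, 4 * Gen.bit (!f) = 4 * Gen.bit f + 4 := by decide
      rw [hb]
      ring
    · intro k s' f' e ho hee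
      rcases Multiset.mem_cons.1 hee with hee | hee
      · cases hee
      · rcases Multiset.mem_cons.1 ho with ho | ho
        · injection ho with h1
          subst h1
          exact hp' _ _ _ _ hm (Multiset.mem_cons_of_mem hee)
        · exact hp' _ _ _ _ (Multiset.mem_cons_of_mem ho) (Multiset.mem_cons_of_mem hee)
  -- If index 1 is regular, the signatures at 0 and 1 determine the total parity, so it could not
  -- differ.
  · exfalso
    have h0 : (symTab x 0).2 = (symTab y 0).2 := by rw [h]
    have h1 : (symTab x 1).2 = (symTab y 1).2 := by rw [h]
    rw [symTab_snd, symTab_snd] at h0 h1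
    have hi0 : ∀ z : Multiset Gen, ¬ ∃ k, 0 = k + 1 ∧ Irr k z := by
      rintro z ⟨k, hk, -⟩
      omega
    have hi1 : ∀ z : Multiset Gen, (∃ k, 1 = k + 1 ∧ Irr k z) ↔ Irr 0 z := by
      intro z
      constructor
      · rintro ⟨k, hk, hz⟩
        obtain rfl : k = 0 := by omega
        exact hz
      · exact fun hz => ⟨0, rfl, hz⟩
    rw [if_neg (hi0 x), if_neg (hi0 y)] at h0
    rw [if_neg (fun hy => hi ((hi1 y).1 hy))] at h1
    by_cases hix : Irr 0 x
    · rw [if_pos ((hi1 x).2 hix)] at h1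
      exact WithTop.coe_ne_top h1.symm
    · rw [if_neg (fun hx => hix ((hi1 x).1 hx))] at h1
      have h0' := WithTop.coe_injective h0
      have h1' : symSig (0 + 1) x = symSig (0 + 1) y := WithTop.coe_injective h1
      rw [symSig_succ_of_above (above_of_not_irr (fun _ _ => Nat.zero_le _) hix),
        symSig_succ_of_above (above_of_not_irr (fun _ _ => Nat.zero_le _) hi), h0'] at h1'
      exact he (add_left_cancel h1')

/-! ### Admissibility and its additivity -/

namespace Tableau

/-- The finite part of the formal signature. -/
def sig (T : Tableau) (m : ℕ) : ZMod 8 := (T.s m).untopD 0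

/-- Reduction of `ℤ / 8` modulo `2`. -/
def par : ZMod 8 →+* ZMod 2 := ZMod.castHom (show 2 ∣ 8 by norm_num) (ZMod 2)

/-- Reduction of `ℤ / 8` modulo `4`. -/
def mod4 : ZMod 8 →+* ZMod 4 := ZMod.castHom (show 4 ∣ 8 by norm_num) (ZMod 4)

theorem coe_sig {T : Tableau} {m : ℕ} (h : T.s m ≠ ⊤) : T.s m = (T.sig m : Z8bar) := by
  rw [sig]
  lift T.s m to ZMod 8 using h with a
  rfl

theorem sig_eq {T : Tableau} {m : ℕ} {a : ZMod 8} (h : T.s m = (a : Z8bar)) : T.sig m = a := by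
  rw [sig, h]; rfl

/-- The conditions `(1)`-`(4)` expressed with finite signatures. -/
structure Adm (T : Tableau) : Prop where
  finite : (Function.support T).Finite
  rank_zero : T.r 0 = 0
  signature_zero : T.s 0 ≠ ⊤
  ne_top : ∀ m, T.Regular m → T.s m ≠ ⊤
  even : ∀ m, T.Regular m → Even (T.r m)
  par_sig : ∀ m, T.Regular m → par (T.sig m) = T.tailRank (m + 1)
  mod4_sig : ∀ m, T.Regular m → T.Regular (m + 1) →
    mod4 (T.sig m + T.sig (m + 1)) = 2 * T.tailRank (m + 2)
  zero : ∀ m l, 1 ≤ l → T.Regular m → T.Regular (m + l + 1) → T.TypeT0 m l →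
    T.sig m - T.sig (m + l + 1) = 0
  one : ∀ m l, 1 ≤ l → T.Regular m → T.Regular (m + l + 1) → T.TypeT1 m l →
    T.sig m - T.sig (m + l + 1) = 1 ∨ T.sig m - T.sig (m + l + 1) = -1
  two : ∀ m l, 1 ≤ l → T.Regular m → T.Regular (m + l + 1) → T.TypeT2 m l →
    T.sig m - T.sig (m + l + 1) = 0 ∨ T.sig m - T.sig (m + l + 1) = 2 ∨
      T.sig m - T.sig (m + l + 1) = -2
  regular : ∀ m l, 1 ≤ l → T.Regular m → T.Regular (m + l + 1) → T.TypeT3 m l →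
    T.sig m - T.sig (m + l + 1) = 0 ∨ T.sig m - T.sig (m + l + 1) = 4

/-- Condition (2) makes signatures finite at regular indices, so all existential witnesses are the
finite parts. -/
theorem admissible_iff_adm {T : Tableau} : T.Admissible ↔ T.Adm := by
  constructor
  · intro h
    have hs : ∀ m, T.Regular m → T.s m = (T.sig m : Z8bar) := by
      intro m hm
      obtain ⟨a, ha, -⟩ := h.cond2 m hm
      rw [sig_eq ha, ha]
    have h4 : ∀ m l, 1 ≤ l → T.Regular m → T.Regular (m + l + 1) →
        (T.TypeT0 m l → T.sig m - T.sig (m + l + 1) = 0) ∧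
        (T.TypeT1 m l → T.sig m - T.sig (m + l + 1) = 1 ∨ T.sig m - T.sig (m + l + 1) = -1) ∧
        (T.TypeT2 m l → T.sig m - T.sig (m + l + 1) = 0 ∨ T.sig m - T.sig (m + l + 1) = 2 ∨
          T.sig m - T.sig (m + l + 1) = -2) ∧
        (T.TypeT3 m l → T.sig m - T.sig (m + l + 1) = 0 ∨ T.sig m - T.sig (m + l + 1) = 4) := by
      intro m l hl hm hn
      obtain ⟨a, b, ha, hb, h4⟩ := h.cond4 m l hl hm hn
      rw [← sig_eq ha, ← sig_eq hb] at h4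
      exact h4
    refine ⟨h.finite, h.rank_zero, h.signature_zero, fun m hm => ?_, h.cond1, fun m hm => ?_,
      fun m hm hm' => ?_, fun m l hl hm hn => (h4 m l hl hm hn).1,
      fun m l hl hm hn => (h4 m l hl hm hn).2.1, fun m l hl hm hn => (h4 m l hl hm hn).2.2.1,
      fun m l hl hm hn => (h4 m l hl hm hn).2.2.2⟩
    · rw [hs m hm]; exact WithTop.coe_ne_top
    · obtain ⟨a, ha, hp⟩ := h.cond2 m hm
      rw [sig_eq ha]; exact hp
    · obtain ⟨a, b, ha, hb, hp⟩ := h.cond3 m hm hm'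
      rw [sig_eq ha, sig_eq hb]; exact hp
  · intro h
    exact ⟨h.finite, h.rank_zero, h.signature_zero, h.even,
      fun m hm => ⟨_, coe_sig (h.ne_top m hm), h.par_sig m hm⟩,
      fun m hm hm' => ⟨_, _, coe_sig (h.ne_top m hm), coe_sig (h.ne_top _ hm'), h.mod4_sig m hm hm'⟩,
      fun m l hl hm hn => ⟨_, _, coe_sig (h.ne_top m hm), coe_sig (h.ne_top _ hn),
        h.zero m l hl hm hn, h.one m l hl hm hn, h.two m l hl hm hn, h.regular m l hl hm hn⟩⟩

theorem finite_support_r {T : Tableau} (h : (Function.support T).Finite) :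
    (Function.support T.r).Finite :=
  h.subset fun _ hm hT => hm (congrArg Prod.fst hT)

theorem tailRank_add {T U : Tableau} (hT : (Function.support T).Finite)
    (hU : (Function.support U).Finite) (m : ℕ) :
    (T + U).tailRank m = T.tailRank m + U.tailRank m :=
  finsum_mem_add_distrib' ((finite_support_r hT).inter_of_right _)
    ((finite_support_r hU).inter_of_right _)

theorem tailRank_eq_add {T : Tableau} (hT : (Function.support T).Finite) (m : ℕ) :
    T.tailRank m = T.r m + T.tailRank (m + 1) := by
  have : Set.Ici m = insert m (Set.Ici (m + 1)) := by
    ext k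
    simp only [Set.mem_Ici, Set.mem_insert_iff]
    omega
  rw [tailRank, this, finsum_mem_insert' _ (by simp) ((finite_support_r hT).inter_of_right _)]
  rfl

theorem tailRank_single {T : Tableau} {j n : ℕ} (h : ∀ m, T.r m = if m = j then n else 0) (m : ℕ) :
    T.tailRank m = if m ≤ j then n else 0 := by
  have h' : T.tailRank m = ∑ᶠ k ∈ Set.Ici m, if k = j then n else 0 := by
    simp only [tailRank, h]
  rw [h']
  split_ifs with hm
  · rw [finsum_eq_single _ j, finsum_eq_if]
    · rw [if_pos rfl]
      exact if_pos hm
    · intro k hk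
      rw [if_neg hk, finsum_zero]
  · apply finsum_mem_eq_zero_of_forall_eq_zero
    intro k hk
    rw [if_neg]
    rintro rfl
    exact hm hk

theorem Regular.of_add {T U : Tableau} {m : ℕ} (h : (T + U).Regular m) :
    T.Regular m ∧ U.Regular m := by
  rcases h with h | h
  · have h : T.r m + U.r m = 0 := h
    exact ⟨.inl (by omega), .inl (by omega)⟩
  · have h : T.s m + U.s m ≠ ⊤ := h
    rw [WithTop.add_ne_top] at h
    exact ⟨.inr h.1, .inr h.2⟩

theorem Adm.sig_add {T U : Tableau} (hT : T.Adm) (hU : U.Adm) {m : ℕ} (h : (T + U).Regular m) :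
    (T + U).s m = ((T.sig m + U.sig m : ZMod 8) : Z8bar) := by
  change T.s m + U.s m = _
  rw [coe_sig (hT.ne_top m h.of_add.1), coe_sig (hU.ne_top m h.of_add.2), WithTop.coe_add]

theorem adm_zero : (0 : Tableau).Adm := by
  have ht : ∀ m, (0 : Tableau).tailRank m = 0 := fun m =>
    finsum_mem_eq_zero_of_forall_eq_zero fun _ _ => rfl
  have hs : ∀ m, (0 : Tableau).sig m = 0 := fun m => rfl
  refine ⟨by simp, rfl, WithTop.coe_ne_top, fun m _ => WithTop.coe_ne_top, fun m _ => ⟨0, rfl⟩,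
    fun m _ => ?_, fun m _ _ => ?_, fun m l _ _ _ _ => ?_, fun m l _ _ _ h => ?_,
    fun m l _ _ _ h => ?_, fun m l _ _ _ _ => ?_⟩
  · simp [ht, hs]
  · simp [ht, hs]
  · simp [hs]
  · exact absurd h.2.2 WithTop.coe_ne_top
  · exact absurd h.2.2 WithTop.coe_ne_top
  · simp [hs]

theorem Adm.not_regular_of_odd {T : Tableau} (h : T.Adm) {m : ℕ} (hr : T.r m = 1) :
    T.s m = ⊤ := by
  by_contra hs
  have := h.even m (.inr hs)
  rw [hr] at this
  exact absurd this (by decide)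

/-- An index regular for the sum is regular for both summands. In condition (4) a total rank 1
splits as 1 + 0, and a total rank 2 as 2 + 0 or 1 + 1, where rank 1 forces signature `∞`. The zero
case controls the summand of rank 0, and two differences ±1 add to 0 or ±2. -/
theorem Adm.add {T U : Tableau} (hT : T.Adm) (hU : U.Adm) : (T + U).Adm := by
  have hs : ∀ m, (T + U).Regular m → (T + U).sig m = T.sig m + U.sig m := fun m hm =>
    sig_eq (hT.sig_add hU hm)
  have hr : ∀ m, (T + U).r m = T.r m + U.r m := fun _ => rfl
  refine ⟨(hT.finite.union hU.finite).subset (Function.support_add _ _), ?_, ?_, fun m hm => ?_,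
    fun m hm => ?_, fun m hm => ?_, fun m hm hm' => ?_, fun m l hl hm hn h => ?_,
    fun m l hl hm hn h => ?_, fun m l hl hm hn h => ?_, fun m l hl hm hn h => ?_⟩
  · rw [hr, hT.rank_zero, hU.rank_zero]
  · exact WithTop.add_ne_top.2 ⟨hT.signature_zero, hU.signature_zero⟩
  · rw [hT.sig_add hU hm]; exact WithTop.coe_ne_top
  · exact (hT.even m hm.of_add.1).add (hU.even m hm.of_add.2)
  · rw [hs m hm, map_add, hT.par_sig m hm.of_add.1, hU.par_sig m hm.of_add.2,
      tailRank_add hT.finite hU.finite, Nat.cast_add]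
  · rw [hs m hm, hs _ hm', add_add_add_comm, map_add, hT.mod4_sig m hm.of_add.1 hm'.of_add.1,
      hU.mod4_sig m hm.of_add.2 hm'.of_add.2, tailRank_add hT.finite hU.finite, Nat.cast_add,
      mul_add]
  · have e : ∀ k, m + 1 ≤ k → k ≤ m + l → T.r k + U.r k = 0 := h.2
    have h1 := hT.zero m l hl hm.of_add.1 hn.of_add.1
      ⟨h.1, fun k hk hk' => by have := e k hk hk'; omega⟩
    have h2 := hU.zero m l hl hm.of_add.2 hn.of_add.2
      ⟨h.1, fun k hk hk' => by have := e k hk hk'; omega⟩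
    rw [hs m hm, hs _ hn]
    linear_combination h1 + h2
  · obtain ⟨rfl, h1, -⟩ := h
    rw [hr] at h1
    rw [hs m hm, hs _ hn, add_sub_add_comm]
    have key : ∀ {V W : Tableau}, V.Adm → W.Adm → V.Regular m → W.Regular m →
        V.Regular (m + 1 + 1) → W.Regular (m + 1 + 1) → V.r (m + 1) = 1 → W.r (m + 1) = 0 →
        (V.sig m - V.sig (m + 1 + 1) = 1 ∨ V.sig m - V.sig (m + 1 + 1) = -1) ∧
        W.sig m - W.sig (m + 1 + 1) = 0 := by
      intro V W hV hW a b c d e f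
      refine ⟨hV.one m 1 le_rfl a c ⟨rfl, e, hV.not_regular_of_odd e⟩,
        hW.zero m 1 le_rfl b d ⟨odd_one, fun k hk hk' => ?_⟩⟩
      obtain rfl : k = m + 1 := by omega
      exact f
    rcases (by omega : (T.r (m + 1) = 1 ∧ U.r (m + 1) = 0) ∨
      (U.r (m + 1) = 1 ∧ T.r (m + 1) = 0)) with ⟨e, f⟩ | ⟨e, f⟩
    · obtain ⟨a, b⟩ := key hT hU hm.of_add.1 hm.of_add.2 hn.of_add.1 hn.of_add.2 e f
      rwa [b, add_zero]
    · obtain ⟨a, b⟩ := key hU hT hm.of_add.2 hm.of_add.1 hn.of_add.2 hn.of_add.1 e f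
      rwa [b, zero_add]
  · obtain ⟨rfl, h1, h2⟩ := h
    rw [hr] at h1
    rw [hs m hm, hs _ hn, add_sub_add_comm]
    have key : ∀ {V W : Tableau}, V.Adm → W.Adm → V.Regular m → W.Regular m →
        V.Regular (m + 1 + 1) → W.Regular (m + 1 + 1) → V.r (m + 1) = 2 → W.r (m + 1) = 0 →
        V.s (m + 1) + W.s (m + 1) = ⊤ →
        (V.sig m - V.sig (m + 1 + 1) = 0 ∨ V.sig m - V.sig (m + 1 + 1) = 2 ∨
          V.sig m - V.sig (m + 1 + 1) = -2) ∧
        W.sig m - W.sig (m + 1 + 1) = 0 := by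
      intro V W hV hW a b c d e f g
      refine ⟨hV.two m 1 le_rfl a c ⟨rfl, e, ?_⟩,
        hW.zero m 1 le_rfl b d ⟨odd_one, fun k hk hk' => ?_⟩⟩
      · exact (WithTop.add_eq_top.1 g).resolve_right (hW.ne_top _ (.inl f))
      · obtain rfl : k = m + 1 := by omega
        exact f
    have h2 : T.s (m + 1) + U.s (m + 1) = ⊤ := h2
    rcases (by omega : (T.r (m + 1) = 2 ∧ U.r (m + 1) = 0) ∨
      (U.r (m + 1) = 2 ∧ T.r (m + 1) = 0) ∨ (T.r (m + 1) = 1 ∧ U.r (m + 1) = 1))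
      with ⟨e, f⟩ | ⟨e, f⟩ | ⟨e, f⟩
    · obtain ⟨a, b⟩ := key hT hU hm.of_add.1 hm.of_add.2 hn.of_add.1 hn.of_add.2 e f h2
      rwa [b, add_zero]
    · obtain ⟨a, b⟩ := key hU hT hm.of_add.2 hm.of_add.1 hn.of_add.2 hn.of_add.1 e f
        (by rw [add_comm]; exact h2)
      rwa [b, zero_add]
    · have a := hT.one m 1 le_rfl hm.of_add.1 hn.of_add.1 ⟨rfl, e, hT.not_regular_of_odd e⟩
      have b := hU.one m 1 le_rfl hm.of_add.2 hn.of_add.2 ⟨rfl, f, hU.not_regular_of_odd f⟩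
      clear * - a b
      rcases a with a | a <;> rcases b with b | b <;> rw [a, b] <;> decide
  · have a := hT.regular m l hl hm.of_add.1 hn.of_add.1
      ⟨h.1, fun k hk hk' => (h.2 k hk hk').of_add.1⟩
    have b := hU.regular m l hl hm.of_add.2 hn.of_add.2
      ⟨h.1, fun k hk hk' => (h.2 k hk hk').of_add.2⟩
    rw [hs m hm, hs _ hn, add_sub_add_comm]
    clear * - a b
    rcases a with a | a <;> rcases b with b | b <;> rw [a, b] <;> decide

end Tableau

/-! ### Tableaux of symbols are admissible -/

open Tableau

/-- Delimiters of an interval of odd length have the same parity, so `4f(k + m)` takes the same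
value at both. A jump occurs only across `k + 1`, the unique irregular index, where the signature
falls from `±1` to `0`. -/
theorem Gen.adm_tab_odd (k : ℕ) (s f : Bool) : (odd k s f).tab.Adm := by
  have hr : ∀ m, (odd k s f).tab.r m = if m = k + 1 then 1 else 0 := fun _ => rfl
  have hs : ∀ m, (odd k s f).tab.s m = (odd k s f).bar m := fun _ => rfl
  have hreg : ∀ m, (odd k s f).tab.Regular m → m ≠ k + 1 := by
    rintro _ (h | h) rfl
    · rw [hr, if_pos rfl] at h
      exact one_ne_zero h
    · exact h (if_pos rfl)
  have hsig : ∀ m, m ≠ k + 1 → (odd k s f).tab.s m = ((odd k s f).sig m : Z8bar) :=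
    fun m hm => if_neg hm
  have hsig' : ∀ m, m ≠ k + 1 → (odd k s f).tab.sig m = (odd k s f).sig m :=
    fun m hm => sig_eq (hsig m hm)
  have hrank : ∀ m, (odd k s f).tab.tailRank m = if m ≤ k + 1 then 1 else 0 := tailRank_single hr
  have hodd : ∀ m l, Odd l → m ≠ k + 1 → m + l + 1 ≠ k + 1 → ¬ (m + 1 ≤ k + 1 ∧ k + 1 ≤ m + l) →
      (odd k s f).tab.sig m - (odd k s f).tab.sig (m + l + 1) = 0 := by
    rintro m l ⟨j, rfl⟩ hm hn hk
    rw [hsig' _ hm, hsig' _ hn, Gen.sig, Gen.sig]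
    by_cases h : m ≤ k
    · rw [if_pos h, if_pos (by omega)]
      push_cast
      generalize (k : ZMod 8) = k
      generalize (m : ZMod 8) = m
      generalize (j : ZMod 8) = j
      have h8 : (8 : ZMod 8) = 0 := rfl
      linear_combination (-(bit f * (j + 1))) * h8
    · rw [if_neg h, if_neg (by omega), sub_zero]
  refine ⟨?_, ?_, ?_, fun m hm => ?_, fun m hm => ?_, fun m hm => ?_, fun m hm hm' => ?_,
    fun m l hl hm hn h => ?_, fun m l hl hm hn h => ?_, fun m l hl hm hn h => ?_,
    fun m l hl hm hn h => ?_⟩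
  · refine (Set.finite_Iic (k + 1)).subset fun m hm => ?_
    by_contra hmk
    have hmk : ¬ m ≤ k + 1 := hmk
    refine hm (Prod.ext ?_ ?_)
    · exact if_neg (by omega)
    · refine (hsig m (by omega)).trans ?_
      rw [Gen.sig, if_neg (by omega)]
      rfl
  · rw [hr, if_neg (by omega)]
  · rw [hsig 0 (by omega)]; exact WithTop.coe_ne_top
  · rw [hsig m (hreg m hm)]; exact WithTop.coe_ne_top
  · rw [hr, if_neg (hreg m hm)]; exact ⟨0, rfl⟩
  · have := hreg m hm
    rw [hsig' m this, hrank, Gen.sig]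
    by_cases h : m ≤ k
    · rw [if_pos h, if_pos (by omega)]
      push_cast
      generalize (k : ZMod 8) + m = k
      clear * - s f k
      revert s f k
      decide
    · rw [if_neg h, if_neg (by omega)]
      rfl
  · have h1 := hreg m hm
    have h2 := hreg _ hm'
    rw [hsig' m h1, hsig' _ h2, hrank, Gen.sig, Gen.sig]
    by_cases h : m + 1 ≤ k
    · rw [if_pos h, if_pos (by omega), if_pos (by omega)]
      push_cast
      generalize (k : ZMod 8) = k
      generalize (m : ZMod 8) = m
      rw [show sgn s + 4 * bit f * (k + m) + (sgn s + 4 * bit f * (k + (m + 1)))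
        = 2 * sgn s + 4 * bit f * (2 * (k + m) + 1) by ring]
      generalize k + m = k
      clear * - s f k
      revert s f k
      decide
    · rw [if_neg h, if_neg (by omega), if_neg (by omega)]
      rfl
  · refine hodd m l h.1 (hreg _ hm) (hreg _ hn) fun hk => ?_
    have := h.2 (k + 1) hk.1 hk.2
    rw [hr, if_pos rfl] at this
    exact one_ne_zero this
  · obtain ⟨rfl, h1, -⟩ := h
    rw [hr] at h1
    obtain rfl : m = k := by
      by_contra hmk
      rw [if_neg (by omega)] at h1
      exact zero_ne_one h1
    rw [hsig' _ (by omega), hsig' _ (by omega), sig_odd_self, Gen.sig, if_neg (by omega), sub_zero]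
    cases s <;> decide
  · obtain ⟨rfl, h1, -⟩ := h
    rw [hr] at h1
    split_ifs at h1
    omega
  · refine .inl (hodd m l h.1 (hreg _ hm) (hreg _ hn) fun hk => ?_)
    exact hreg _ (h.2 (k + 1) hk.1 hk.2) rfl

/-- The signature takes only the values 0 and 4, which settles everything modulo 4 and the last
clause of (4). The formula `4f(k + m + 1)` remains true at `m = k + 1`, so equality holds also for
intervals ending there. -/
theorem Gen.adm_tab_even (k : ℕ) (f : Bool) : (even k f).tab.Adm := by
  have hr : ∀ m, (even k f).tab.r m = if m = k + 1 then 2 else 0 := fun _ => rfl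
  have hs : ∀ m, (even k f).tab.s m = ((even k f).sig m : Z8bar) := fun _ => rfl
  have hsig : ∀ m, (even k f).tab.sig m = (even k f).sig m := fun _ => rfl
  have hle : ∀ m, m ≤ k + 1 → (even k f).sig m = 4 * bit f * (k + m + 1) := by
    intro m hm
    rw [Gen.sig]
    split_ifs with h
    · rfl
    · obtain rfl : m = k + 1 := by omega
      push_cast
      generalize (k : ZMod 8) = k
      clear * - f k
      revert f k
      decide
  have hlt : ∀ m, ¬ m ≤ k → (even k f).sig m = 0 := fun m hm => if_neg hm
  have hrank : ∀ m, (even k f).tab.tailRank m = if m ≤ k + 1 then 2 else 0 := tailRank_single hr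
  have hfour : ∀ m, (even k f).sig m = 0 ∨ (even k f).sig m = 4 := by
    intro m
    rw [Gen.sig]
    generalize (k : ZMod 8) + m + 1 = j
    split_ifs
    · clear * - f j
      revert f j
      decide
    · exact .inl rfl
  refine ⟨?_, ?_, WithTop.coe_ne_top, fun _ _ => WithTop.coe_ne_top, fun m hm => ?_,
    fun m hm => ?_, fun m hm hm' => ?_,
    fun m l hl hm hn h => ?_, fun m l hl hm hn h => absurd h.2.2 WithTop.coe_ne_top,
    fun m l hl hm hn h => absurd h.2.2 WithTop.coe_ne_top, fun m l hl hm hn h => ?_⟩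
  · refine (Set.finite_Iic (k + 1)).subset fun m hm => ?_
    by_contra hmk
    have hmk : ¬ m ≤ k + 1 := hmk
    refine hm (Prod.ext ?_ ?_)
    · exact if_neg (by omega)
    · exact congrArg (WithTop.some) (hlt m (by omega))
  · rw [hr, if_neg (by omega)]
  · rw [hr]
    split_ifs
    · exact even_two
    · exact ⟨0, rfl⟩
  · have h0 : (((even k f).tab.tailRank (m + 1) : ℕ) : ZMod 2) = 0 := by
      rw [hrank]
      split_ifs <;> rfl
    rw [hsig, h0]
    rcases hfour m with h | h <;> rw [h] <;> decide
  · have h0 : 2 * (((even k f).tab.tailRank (m + 2) : ℕ) : ZMod 4) = 0 := by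
      rw [hrank]
      split_ifs <;> rfl
    rw [hsig, hsig, h0]
    rcases hfour m with h | h <;> rcases hfour (m + 1) with h' | h' <;> rw [h, h'] <;> decide
  · obtain ⟨⟨j, rfl⟩, h⟩ := h
    have hk : ¬ (m + 1 ≤ k + 1 ∧ k + 1 ≤ m + (2 * j + 1)) := by
      intro hk
      have := h (k + 1) hk.1 hk.2
      rw [hr, if_pos rfl] at this
      exact two_ne_zero this
    rw [hsig, hsig]
    by_cases hm : m ≤ k
    · rw [hle _ (by omega), hle _ (by omega)]
      push_cast
      generalize (k : ZMod 8) = k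
      generalize (m : ZMod 8) = m
      generalize (j : ZMod 8) = j
      have h8 : (8 : ZMod 8) = 0 := rfl
      linear_combination (-(bit f * (j + 1))) * h8
    · rw [hlt _ hm, hlt _ (by omega), sub_zero]
  · rw [hsig, hsig]
    rcases hfour m with h | h <;> rcases hfour (m + l + 1) with h' | h' <;> rw [h, h'] <;> decide

theorem adm_symTab (x : Multiset Gen) : (symTab x).Adm := by
  induction x using Multiset.induction_on with
  | empty => exact adm_zero
  | cons g x ih =>
    rw [symTab_cons]
    refine Adm.add ?_ ih
    cases g with
    | odd k s f => exact Gen.adm_tab_odd k s f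
    | even k f => exact Gen.adm_tab_even k f

/-! ### Realization of admissible tableaux -/

namespace Tableau

/-- The possible differences of the signatures at `m - 1` and `m + 1`. -/
def Step (T : Tableau) (m : ℕ) (d : ZMod 8) : Prop :=
  (T.Regular m → T.r m ≠ 0 → d = 0 ∨ d = 4) ∧
    (T.r m = 0 ∨ ¬ T.Regular m → ∃ i ≤ T.r m, d = T.r m - 2 * i)

theorem Adm.par_sig_eq {T : Tableau} (h : T.Adm) {m : ℕ} (hm : T.Regular m)
    (hm' : T.Regular (m + 2)) : par (T.sig m) = T.r (m + 1) + par (T.sig (m + 2)) := by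
  rw [h.par_sig m hm, h.par_sig _ hm', tailRank_eq_add h.finite, tailRank_eq_add h.finite (m + 1 + 1)]
  obtain ⟨j, hj⟩ := h.even _ hm'
  have h2 : ((T.r (m + 1 + 1) : ℕ) : ZMod 2) = 0 := by
    change ((T.r (m + 2) : ℕ) : ZMod 2) = 0
    rw [hj, Nat.cast_add, CharTwo.add_self_eq_zero]
  rw [Nat.cast_add, Nat.cast_add, h2, zero_add]

/-- The values `i = 0, 1, 2, 3` already give all four residues modulo 8 of the parity of `r`. -/
theorem exists_sub_two_mul_of_par {r : ℕ} (hr : 3 ≤ r) {d : ZMod 8} (hd : par d = r) :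
    ∃ i ≤ r, d = r - 2 * (i : ZMod 8) := by
  have h : ∀ d ρ : ZMod 8, par d = par ρ → d = ρ - 2 * (0 : ℕ) ∨ d = ρ - 2 * (1 : ℕ) ∨
      d = ρ - 2 * (2 : ℕ) ∨ d = ρ - 2 * (3 : ℕ) := by
    decide
  rcases h d r (by rw [hd, map_natCast]) with h | h | h | h
  exacts [⟨0, by omega, h⟩, ⟨1, by omega, h⟩, ⟨2, by omega, h⟩, ⟨3, by omega, h⟩]

/-- In the irregular case `r - 2i` is the sum of `r` signs, `i` of them negative. Condition (4)
gives ranks up to 2; from rank 3 on, the parity supplied by (2) is the only restriction. -/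
theorem Adm.step {T : Tableau} (h : T.Adm) {m : ℕ} (hm : T.Regular m) (hm' : T.Regular (m + 2)) :
    T.Step (m + 1) (T.sig m - T.sig (m + 2)) := by
  have hk : ∀ {P : ℕ → Prop}, P (m + 1) → ∀ k, m + 1 ≤ k → k ≤ m + 1 → P k := by
    intro P hP k hk hk'
    obtain rfl : k = m + 1 := by omega
    exact hP
  refine ⟨fun hr _ => h.regular m 1 le_rfl hm hm' ⟨odd_one, hk hr⟩, fun hr => ?_⟩
  by_cases h0 : T.r (m + 1) = 0
  · refine ⟨0, Nat.zero_le _, ?_⟩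
    rw [h0]
    exact (h.zero m 1 le_rfl hm hm' ⟨odd_one, hk (P := fun k => T.r k = 0) h0⟩).trans (by simp)
  have htop : T.s (m + 1) = ⊤ := by
    by_contra hs
    exact (hr.resolve_left h0) (.inr hs)
  by_cases h1 : T.r (m + 1) = 1
  · rw [h1]
    rcases h.one m 1 le_rfl hm hm' ⟨rfl, h1, htop⟩ with e | e
    · exact ⟨0, by omega, e.trans (by decide)⟩
    · exact ⟨1, by omega, e.trans (by decide)⟩
  by_cases h2 : T.r (m + 1) = 2
  · rw [h2]
    rcases h.two m 1 le_rfl hm hm' ⟨rfl, h2, htop⟩ with e | e | e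
    · exact ⟨1, by omega, e.trans (by decide)⟩
    · exact ⟨0, by omega, e.trans (by decide)⟩
    · exact ⟨2, by omega, e.trans (by decide)⟩
  refine exists_sub_two_mul_of_par (by omega) ?_
  rw [map_sub, h.par_sig_eq hm hm', add_sub_cancel_right]

/-- The condition for `T` above the index `k` to be realized by symbols of level at least `k`
with signature `σ` at `k` and total parity of factors `5` equal to `e`. -/
structure Good (T : Tableau) (k : ℕ) (σ : ZMod 8) (e : Bool) : Prop where
  self : T.Regular k → σ = T.sig k
  succ : T.Regular (k + 1) → σ = T.sig (k + 1) + 4 * Gen.bit e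
  par : par σ = T.tailRank (k + 1)
  step : T.Regular (k + 2) → T.Step (k + 1) (σ - T.sig (k + 2))

/-- The multiset `x` realizes `T` above the index `k`. -/
structure Realizes (T : Tableau) (k : ℕ) (σ : ZMod 8) (e : Bool) (x : Multiset Gen) : Prop where
  le_lvl : ∀ g ∈ x, k ≤ g.lvl
  tab : ∀ j, k < j → symTab x j = T j
  sig : symSig k x = σ
  e4 : symE4 x = 4 * Gen.bit e

/-- With `t` the rank beyond index `m + 1`, condition (3) gives the sum of the signatures as `2t`
modulo 4, and (2) gives twice the second one as `2t` modulo 4. So their difference is divisible by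
4. -/
theorem Adm.sub_sig_succ {T : Tableau} (h : T.Adm) {m : ℕ} (hm : T.Regular m)
    (hm' : T.Regular (m + 1)) : ∃ e, T.sig m = T.sig (m + 1) + 4 * Gen.bit e := by
  have h1 := h.mod4_sig m hm hm'
  have h2 := h.par_sig _ hm'
  generalize T.sig m = a at *
  generalize T.sig (m + 1) = b at *
  rw [show T.tailRank (m + 1 + 1) = T.tailRank (m + 2) from rfl] at h2
  generalize T.tailRank (m + 2) = t at *
  have key : ∀ a b n : ZMod 8, mod4 (a + b) = 2 * mod4 n → par b = par n →
      ∃ e, a = b + 4 * Gen.bit e := by decide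
  exact key a b t (by rw [h1, map_natCast]) (by rw [h2, map_natCast])

end Tableau

open Tableau

theorem symTab_add (x y : Multiset Gen) : symTab (x + y) = symTab x + symTab y := by
  rw [symTab, Multiset.map_add, Multiset.sum_add]; rfl

theorem symSig_add (m : ℕ) (x y : Multiset Gen) : symSig m (x + y) = symSig m x + symSig m y := by
  rw [symSig, Multiset.map_add, Multiset.sum_add]; rfl

theorem symE4_add (x y : Multiset Gen) : symE4 (x + y) = symE4 x + symE4 y := by
  rw [symE4, Multiset.map_add, Multiset.sum_add]; rfl

theorem Gen.tab_of_lvl_lt {g : Gen} {j : ℕ} (h : g.lvl + 1 < j) : g.tab j = 0 := by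
  cases g with
  | odd k s f =>
    have h : k + 1 < j := h
    refine Prod.ext (if_neg (by omega)) ?_
    change (odd k s f).bar j = 0
    rw [Gen.bar, if_neg (by omega), Gen.sig, if_neg (by omega)]
    rfl
  | even k f =>
    have h : k + 1 < j := h
    refine Prod.ext (if_neg (by omega)) ?_
    change (even k f).bar j = 0
    rw [Gen.bar, Gen.sig, if_neg (by omega)]
    rfl

theorem symTab_of_lvl_lt {x : Multiset Gen} {j : ℕ} (h : ∀ g ∈ x, g.lvl + 1 < j) :
    symTab x j = 0 := by
  induction x using Multiset.induction_on with
  | empty => rfl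
  | cons g x ih =>
    rw [symTab_cons, Pi.add_apply, Gen.tab_of_lvl_lt (h g (Multiset.mem_cons_self _ _)),
      ih fun g' hg' => h g' (Multiset.mem_cons_of_mem hg'), add_zero]

theorem symTab_succ_of_lt_lvl {x : Multiset Gen} {k : ℕ} (h : ∀ g ∈ x, k + 1 ≤ g.lvl) :
    symTab x (k + 1) = (0, (symSig (k + 1) x : Z8bar)) := by
  refine Prod.ext ?_ ?_
  · rw [symTab_fst]
    refine symRank_eq_zero fun g hg => ?_
    have := h g hg
    omega
  · rw [symTab_snd, if_neg]
    rintro ⟨j, hj, s, f, hm⟩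
    have : k + 1 ≤ j := h _ hm
    omega

/-- All symbols of `x` lie above level `k`, so their signature at `k` is `σ`, that at `k + 1`,
corrected by their total parity. -/
theorem Tableau.Realizes.add {T : Tableau} {k : ℕ} {σ : ZMod 8} {e e' : Bool} {x y : Multiset Gen}
    (hx : T.Realizes (k + 1) σ e x) (hy : ∀ g ∈ y, g.lvl = k)
    (ht : symTab y (k + 1) + (0, (σ : Z8bar)) = T (k + 1))
    (he : symE4 y + 4 * Gen.bit e = 4 * Gen.bit e') :
    T.Realizes k (symSig k y + σ + 4 * Gen.bit e) e' (y + x) := by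
  refine ⟨fun g hg => ?_, fun j hj => ?_, ?_, ?_⟩
  · rcases Multiset.mem_add.1 hg with hg | hg
    · exact (hy g hg).ge
    · exact (Nat.le_succ k).trans (hx.le_lvl g hg)
  · rw [symTab_add, Pi.add_apply]
    rcases (by omega : j = k + 1 ∨ k + 1 < j) with rfl | hj
    · rw [symTab_succ_of_lt_lvl hx.le_lvl, hx.sig, ht]
    · rw [symTab_of_lvl_lt fun g hg => by rw [hy g hg]; exact hj, zero_add, hx.tab j hj]
  · have h := symSig_succ_of_above (above_of_lt hx.le_lvl)
    rw [hx.sig, hx.e4] at h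
    rw [symSig_add, h, add_assoc, add_assoc, ← hx.e4, symE4_add_self, add_zero]
  · rw [symE4_add, hx.e4, he]

/-- Odd symbols with a prescribed number of minus signs and prescribed parity. -/
theorem exists_odd_symbols (k : ℕ) (f : Bool) {r : ℕ} (hr : 1 ≤ r) :
    ∀ i ≤ r, ∃ y : Multiset Gen, (∀ g ∈ y, g.lvl = k) ∧ symTab y (k + 1) = (r, ⊤) ∧
      symSig k y = r - 2 * i ∧ symE4 y = 4 * Gen.bit f := by
  have htab : ∀ s f, (Gen.odd k s f).tab (k + 1) = (1, ⊤) := fun s f =>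
    Prod.ext (if_pos rfl) (if_pos rfl)
  induction r, hr using Nat.le_induction with
  | base =>
    have key : ∀ s, ∃ y : Multiset Gen, (∀ g ∈ y, g.lvl = k) ∧ symTab y (k + 1) = (1, ⊤) ∧
        symSig k y = Gen.sgn s ∧ symE4 y = 4 * Gen.bit f := by
      intro s
      refine ⟨{.odd k s f}, fun g hg => ?_, ?_, ?_, ?_⟩
      · rw [Multiset.mem_singleton.1 hg]; rfl
      · rw [symTab, Multiset.map_singleton, Multiset.sum_singleton, htab]
      · rw [symSig, Multiset.map_singleton, Multiset.sum_singleton, Gen.sig_odd_self]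
      · rw [symE4, Multiset.map_singleton, Multiset.sum_singleton]; rfl
    intro i hi
    interval_cases i
    · obtain ⟨y, h1, h2, h3, h4⟩ := key false
      exact ⟨y, h1, h2, h3.trans (by decide), h4⟩
    · obtain ⟨y, h1, h2, h3, h4⟩ := key true
      exact ⟨y, h1, h2, h3.trans (by decide), h4⟩
  | succ r hr ih =>
    have key : ∀ s i, i ≤ r → ∃ y : Multiset Gen, (∀ g ∈ y, g.lvl = k) ∧
        symTab y (k + 1) = (r + 1, ⊤) ∧ symSig k y = Gen.sgn s + (r - 2 * i) ∧
        symE4 y = 4 * Gen.bit f := by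
      intro s i hi
      obtain ⟨y, h1, h2, h3, h4⟩ := ih i hi
      refine ⟨.odd k s false ::ₘ y, fun g hg => ?_, ?_, ?_, ?_⟩
      · rcases Multiset.mem_cons.1 hg with rfl | hg
        exacts [rfl, h1 g hg]
      · rw [symTab_cons, Pi.add_apply, htab, h2, add_comm r]
        rfl
      · rw [symSig_cons, h3, Gen.sig_odd_self]
      · rw [symE4_cons, h4]
        exact (congrArg (· + _) (mul_zero _)).trans (zero_add _)
    intro i hi
    rcases (by omega : i ≤ r ∨ i = r + 1) with hi | rfl
    · obtain ⟨y, h1, h2, h3, h4⟩ := key false i hi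
      refine ⟨y, h1, h2, h3.trans ?_, h4⟩
      rw [show Gen.sgn false = 1 from rfl]
      push_cast
      ring
    · obtain ⟨y, h1, h2, h3, h4⟩ := key true r le_rfl
      refine ⟨y, h1, h2, h3.trans ?_, h4⟩
      rw [show Gen.sgn true = -1 from rfl]
      push_cast
      ring

/-- Even symbols with prescribed parity. -/
theorem exists_even_symbols (k : ℕ) (f : Bool) {n : ℕ} (hn : 1 ≤ n) :
    ∃ y : Multiset Gen, (∀ g ∈ y, g.lvl = k) ∧ symTab y (k + 1) = (n + n, 0) ∧
      symSig k y = 4 * Gen.bit f ∧ symE4 y = 4 * Gen.bit f := by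
  have htab : ∀ f, (Gen.even k f).tab (k + 1) = (2, 0) := fun f =>
    Prod.ext (if_pos rfl) (congrArg WithTop.some (if_neg (by omega)))
  have hsig : ∀ f, (Gen.even k f).sig k = 4 * Gen.bit f := by
    intro f
    rw [Gen.sig, if_pos le_rfl]
    generalize (k : ZMod 8) = k
    clear * - f k
    revert f k
    decide
  induction n, hn using Nat.le_induction with
  | base =>
    refine ⟨{.even k f}, fun g hg => ?_, ?_, ?_, ?_⟩
    · rw [Multiset.mem_singleton.1 hg]; rfl
    · rw [symTab, Multiset.map_singleton, Multiset.sum_singleton, htab]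
    · rw [symSig, Multiset.map_singleton, Multiset.sum_singleton, hsig]
    · rw [symE4, Multiset.map_singleton, Multiset.sum_singleton]; rfl
  | succ n hn ih =>
    obtain ⟨y, h1, h2, h3, h4⟩ := ih
    refine ⟨.even k false ::ₘ y, fun g hg => ?_, ?_, ?_, ?_⟩
    · rcases Multiset.mem_cons.1 hg with rfl | hg
      exacts [rfl, h1 g hg]
    · rw [symTab_cons, Pi.add_apply, htab, h2, show n + 1 + (n + 1) = 2 + (n + n) by ring]
      rfl
    · rw [symSig_cons, h3, hsig]
      exact (congrArg (· + _) (mul_zero _)).trans (zero_add _)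
    · rw [symE4_cons, h4]
      exact (congrArg (· + _) (mul_zero _)).trans (zero_add _)

namespace Tableau

theorem Adm.apply_eq {T : Tableau} (h : T.Adm) {m : ℕ} (hm : T.Regular m) :
    T m = (T.r m, (T.sig m : Z8bar)) :=
  Prod.ext rfl (coe_sig (h.ne_top m hm))

theorem Adm.good_succ_of_regular {T : Tableau} (h : T.Adm) {k : ℕ} (hk : T.Regular (k + 1))
    {e : Bool} (he : T.Regular (k + 2) → T.sig (k + 1) = T.sig (k + 2) + 4 * Gen.bit e) :
    T.Good (k + 1) (T.sig (k + 1)) e :=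
  ⟨fun _ => rfl, he, h.par_sig _ hk, fun h3 => h.step hk h3⟩

/-- The signature at `k + 1` is prescribed, and `e'`, the parity of the part above, is chosen to
match index `k + 2` when that is regular. For positive rank, planes on level `k` supply the
remaining parity; for rank zero `Step` shows that `e` itself already matches. -/
theorem Adm.exists_realizes_of_regular {T : Tableau} (h : T.Adm) {k : ℕ}
    (ih : ∀ σ e, T.Good (k + 1) σ e → ∃ x, T.Realizes (k + 1) σ e x) {σ : ZMod 8} {e : Bool}
    (hg : T.Good k σ e) (hk : T.Regular (k + 1)) : ∃ x, T.Realizes k σ e x := by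
  have hσ := hg.succ hk
  by_cases hr : T.r (k + 1) = 0
  · have h2 : T.Regular (k + 2) → T.sig (k + 1) = T.sig (k + 2) + 4 * Gen.bit e := by
      intro h2
      obtain ⟨i, hi, hd⟩ := (hg.step h2).2 (.inl hr)
      obtain rfl : i = 0 := by omega
      rw [hr, Nat.cast_zero, mul_zero, sub_zero, hσ] at hd
      generalize T.sig (k + 1) = a at *
      generalize T.sig (k + 2) = b at *
      clear * - hd
      revert a b e
      decide
    obtain ⟨x, hx⟩ := ih _ _ (h.good_succ_of_regular hk h2)
    have := hx.add (y := 0) (e' := e) (by simp) ?_ (zero_add _)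
    · refine ⟨0 + x, ?_⟩
      rw [show symSig k 0 = 0 from rfl, zero_add, ← hσ] at this
      exact this
    · rw [h.apply_eq hk, hr]
      exact zero_add _
  · obtain ⟨n, hn⟩ := h.even _ hk
    obtain ⟨e', he'⟩ : ∃ e', T.Regular (k + 2) →
        T.sig (k + 1) = T.sig (k + 2) + 4 * Gen.bit e' := by
      by_cases h2 : T.Regular (k + 2)
      · obtain ⟨e', he'⟩ := h.sub_sig_succ hk h2
        exact ⟨e', fun _ => he'⟩
      · exact ⟨false, fun h3 => absurd h3 h2⟩
    obtain ⟨x, hx⟩ := ih _ _ (h.good_succ_of_regular hk he')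
    obtain ⟨y, h1, h2, h3, h4⟩ := exists_even_symbols k (e ^^ e') (n := n) (by omega)
    have hb : 4 * Gen.bit (e ^^ e') + 4 * Gen.bit e' = 4 * Gen.bit e := by
      clear * - e e'
      revert e e'
      decide
    have := hx.add (e' := e) h1 ?_ (by rw [h4, hb])
    · refine ⟨y + x, ?_⟩
      rw [h3, add_right_comm, hb, add_comm, ← hσ] at this
      exact this
    · rw [h.apply_eq hk, h2, hn]
      exact Prod.ext (add_zero _) (zero_add _)

/-- An irregular index leaves the signature there free. It remains to choose that signature, the
parity above, and the number `i` of minus signs on level `k` consistently. -/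
theorem Adm.exists_good_of_irregular {T : Tableau} (h : T.Adm) {k : ℕ} {σ : ZMod 8} {e : Bool}
    (hg : T.Good k σ e) (hk : ¬ T.Regular (k + 1)) : ∃ σ' e', ∃ i ≤ T.r (k + 1),
      σ = T.r (k + 1) - 2 * i + σ' + 4 * Gen.bit e' ∧ T.Good (k + 1) σ' e' := by
  have hr : T.r (k + 1) ≠ 0 := fun h0 => hk (.inl h0)
  by_cases h2 : T.Regular (k + 2)
  · obtain ⟨i, hi, hd⟩ := (hg.step h2).2 (.inr hk)
    obtain ⟨e', he'⟩ : ∃ e', T.Regular (k + 3) →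
        T.sig (k + 2) = T.sig (k + 3) + 4 * Gen.bit e' := by
      by_cases h3 : T.Regular (k + 3)
      · obtain ⟨e', he'⟩ := h.sub_sig_succ h2 h3
        exact ⟨e', fun _ => he'⟩
      · exact ⟨false, fun h3' => absurd h3' h3⟩
    -- Index `k + 2` prescribes the signature at `k + 1` up to the parity `e'`, and `i` comes from
    -- `Step`. By the choice of `e'` the next step has difference 0 if index `k + 3` is regular.
    refine ⟨T.sig (k + 2) + 4 * Gen.bit e', e', i, hi, ?_, fun h' => absurd h' hk, fun _ => rfl, ?_,
      fun h3 => ?_⟩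
    · have h8 : ∀ e, 4 * Gen.bit e + 4 * Gen.bit e = 0 := by decide
      linear_combination hd - h8 e'
    · have h0 : ∀ e, par (4 * Gen.bit e) = 0 := by decide
      rw [map_add, h0, add_zero]
      have h1 := hg.par
      have h3 := congrArg par hd
      have hp : ∀ i : ZMod 8, par (2 * i) = 0 := by decide
      rw [map_sub, map_sub, hp, sub_zero, map_natCast, h1, tailRank_eq_add h.finite,
        Nat.cast_add] at h3
      linear_combination -h3
    · have h0 : T.sig (k + 2) + 4 * Gen.bit e' - T.sig (k + 3) = 0 := by
        rw [he' h3]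
        generalize T.sig (k + 3) = a
        clear * - a e'
        revert a e'
        decide
      change T.Step (k + 2) (T.sig (k + 2) + 4 * Gen.bit e' - T.sig (k + 3))
      rw [h0]
      refine ⟨fun _ _ => .inl rfl, fun hr2 => ⟨0, Nat.zero_le _, ?_⟩⟩
      rw [hr2.resolve_right (not_not.2 h2)]
      decide
  -- With `k + 2` irregular too, `σ'` is bound only by its parity and by index `k + 3`; if that is
  -- regular, take all signs on level `k + 1` positive.
  · obtain ⟨σ', hp, hσ'⟩ : ∃ σ', par σ' = T.tailRank (k + 2) ∧
        (T.Regular (k + 3) → σ' = T.sig (k + 3) + T.r (k + 2)) := by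
      by_cases h3 : T.Regular (k + 3)
      · refine ⟨_, ?_, fun _ => rfl⟩
        obtain ⟨j, hj⟩ := h.even _ h3
        rw [map_add, map_natCast, h.par_sig _ h3, tailRank_eq_add h.finite (k + 2),
          tailRank_eq_add h.finite (k + 2 + 1), hj]
        push_cast
        rw [CharTwo.add_self_eq_zero, zero_add, add_comm]
      · refine ⟨σ - T.r (k + 1), ?_, fun h3' => absurd h3' h3⟩
        rw [map_sub, hg.par, map_natCast, tailRank_eq_add h.finite (k + 1), Nat.cast_add,
          add_sub_cancel_left]
    -- The discrepancy is even, and `-2i + 4e'` with `i ≤ 1` covers all even residues modulo 8; `i =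
    -- 1` is allowed because the rank is positive.
    have key : ∀ σ σ' ρ : ZMod 8, par σ = par ρ + par σ' →
        ∃ e', σ = ρ - 2 * (0 : ℕ) + σ' + 4 * Gen.bit e' ∨
          σ = ρ - 2 * (1 : ℕ) + σ' + 4 * Gen.bit e' := by
      decide
    obtain ⟨e', he'⟩ := key σ σ' (T.r (k + 1)) (by
      rw [hg.par, map_natCast, hp, tailRank_eq_add h.finite (k + 1), Nat.cast_add])
    have hgood : T.Good (k + 1) σ' e' := by
      refine ⟨fun h' => absurd h' hk, fun h' => absurd h' h2, hp, fun h3 => ?_⟩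
      refine ⟨fun h' => absurd h' h2, fun _ => ⟨0, Nat.zero_le _, ?_⟩⟩
      rw [hσ' h3]
      change T.sig (k + 3) + T.r (k + 2) - T.sig (k + 3) = T.r (k + 2) - 2 * (0 : ℕ)
      push_cast
      ring
    rcases he' with he' | he'
    exacts [⟨σ', e', 0, Nat.zero_le _, he', hgood⟩, ⟨σ', e', 1, by omega, he', hgood⟩]

theorem Adm.exists_realizes_of_irregular {T : Tableau} (h : T.Adm) {k : ℕ}
    (ih : ∀ σ e, T.Good (k + 1) σ e → ∃ x, T.Realizes (k + 1) σ e x) {σ : ZMod 8} {e : Bool}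
    (hg : T.Good k σ e) (hk : ¬ T.Regular (k + 1)) : ∃ x, T.Realizes k σ e x := by
  obtain ⟨σ', e', i, hi, hσ, hg'⟩ := h.exists_good_of_irregular hg hk
  obtain ⟨x, hx⟩ := ih _ _ hg'
  have hr : T.r (k + 1) ≠ 0 := fun h0 => hk (.inl h0)
  obtain ⟨y, h1, h2, h3, h4⟩ := exists_odd_symbols k (e ^^ e') (r := T.r (k + 1)) (by omega) i hi
  have hb : 4 * Gen.bit (e ^^ e') + 4 * Gen.bit e' = 4 * Gen.bit e := by
    clear * - e e'
    revert e e'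
    decide
  have := hx.add (e' := e) h1 ?_ (by rw [h4, hb])
  · rw [h3, ← hσ] at this
    exact ⟨_, this⟩
  · rw [h2]
    refine Prod.ext (add_zero _) ?_
    refine (WithTop.top_add _).trans ?_
    by_contra hs
    exact hk (.inr fun hs' => hs hs'.symm)

theorem Adm.exists_realizes {T : Tableau} (h : T.Adm) {N : ℕ} (hN : ∀ j, N ≤ j → T j = 0) (n : ℕ) :
    ∀ k, N ≤ k + n → ∀ σ e, T.Good k σ e → ∃ x, T.Realizes k σ e x := by
  induction n with
  | zero =>
    intro k hk σ e hg
    have hreg : ∀ j, N ≤ j → T.Regular j := fun j hj => .inl (congrArg Prod.fst (hN j hj))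
    have hsig : ∀ j, N ≤ j → T.sig j = 0 := fun j hj =>
      sig_eq (congrArg Prod.snd (hN j hj))
    have h1 := hg.self (hreg k hk)
    have h2 := hg.succ (hreg _ (by omega))
    rw [hsig k hk] at h1
    rw [hsig _ (by omega), h1, zero_add] at h2
    -- Beyond the support `Good` forces `σ = 0` and even parity, so the empty multiset realizes `T`.
    exact ⟨0, by simp, fun j hj => (hN j (by omega)).symm, h1.symm, h2⟩
  | succ n ih =>
    intro k hk σ e hg
    by_cases hr : T.Regular (k + 1)
    · exact h.exists_realizes_of_regular (ih (k + 1) (by omega)) hg hr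
    · exact h.exists_realizes_of_irregular (ih (k + 1) (by omega)) hg hr

theorem Adm.exists_symTab_eq {T : Tableau} (h : T.Adm) : ∃ x, symTab x = T := by
  obtain ⟨N, hN⟩ := h.finite.bddAbove
  have hN : ∀ j, N + 1 ≤ j → T j = 0 := by
    intro j hj
    by_contra h0
    have : j ≤ N := hN h0
    omega
  have h0 : T.Regular 0 := .inl h.rank_zero
  -- The total parity is dictated by the signatures at 0 and 1 if index 1 is regular and is
  -- arbitrary otherwise.
  obtain ⟨e, he⟩ : ∃ e, T.Regular 1 → T.sig 0 = T.sig 1 + 4 * Gen.bit e := by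
    by_cases h1 : T.Regular 1
    · obtain ⟨e, he⟩ := h.sub_sig_succ h0 h1
      exact ⟨e, fun _ => he⟩
    · exact ⟨false, fun h1' => absurd h1' h1⟩
  obtain ⟨x, hx⟩ := h.exists_realizes hN (N + 1) 0 (by omega) (T.sig 0) e
    ⟨fun _ => rfl, he, h.par_sig 0 h0, fun h2 => h.step h0 h2⟩
  refine ⟨x, funext fun j => ?_⟩
  cases j with
  | zero =>
    rw [h.apply_eq h0, h.rank_zero]
    refine Prod.ext ?_ ?_
    · have ha := adm_symTab x
      exact ha.rank_zero
    · rw [symTab_snd, if_neg, hx.sig]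
      rintro ⟨j, hj, -⟩
      omega
  | succ j => exact hx.tab _ (by omega)

end Tableau

/-! ### The isomorphism of monoids -/

/-- The monoid of admissible tableaux. -/
def admissibleTableaux : AddSubmonoid Tableau where
  carrier := {T | T.Admissible}
  zero_mem' := Tableau.admissible_iff_adm.2 Tableau.adm_zero
  add_mem' hT hU := Tableau.admissible_iff_adm.2
    ((Tableau.admissible_iff_adm.1 hT).add (Tableau.admissible_iff_adm.1 hU))

namespace QuadClass

theorem exists_tab (c : QuadClass.{u}) : ∃ T : Tableau, T.Admissible ∧
    ∀ q : QuadTwoGroup.{u}, q.cls = c → q.HasTableau T := by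
  obtain ⟨x, -, hx⟩ := exists_isPure_symCls_eq c
  exact ⟨symTab x, Tableau.admissible_iff_adm.2 (adm_symTab x),
    fun q hq => QuadTwoGroup.hasTableau_symTab x (hx.trans hq.symm)⟩

/-- The tableau of an isomorphism class. -/
def tab (c : QuadClass.{u}) : Tableau := (exists_tab c).choose

theorem admissible_tab (c : QuadClass.{u}) : c.tab.Admissible := (exists_tab c).choose_spec.1

theorem hasTableau_tab (q : QuadTwoGroup.{u}) : q.HasTableau q.cls.tab :=
  (exists_tab q.cls).choose_spec.2 q rfl

theorem tab_symCls (x : Multiset Gen) : (symCls.{u} x).tab = symTab x := by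
  obtain ⟨q, hq⟩ := Quotient.exists_rep (symCls.{u} x)
  have hq : q.cls = symCls x := hq
  rw [← hq]
  exact (hasTableau_tab q).unique (QuadTwoGroup.hasTableau_symTab x hq.symm)

theorem tab_add (c d : QuadClass.{u}) : (c + d).tab = c.tab + d.tab := by
  obtain ⟨x, -, rfl⟩ := exists_isPure_symCls_eq c
  obtain ⟨y, -, rfl⟩ := exists_isPure_symCls_eq d
  rw [← symCls_add, tab_symCls, tab_symCls, tab_symCls, symTab_add]

theorem tab_injective : Function.Injective (tab.{u}) := by
  intro c d h
  obtain ⟨x, hx, rfl⟩ := exists_isPure_symCls_eq c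
  obtain ⟨y, hy, rfl⟩ := exists_isPure_symCls_eq d
  rw [tab_symCls, tab_symCls] at h
  exact symCls_eq_of_symTab_eq hx hy h

theorem tab_surjective {T : Tableau} (h : T.Admissible) : ∃ c : QuadClass.{u}, c.tab = T := by
  obtain ⟨x, rfl⟩ := (Tableau.admissible_iff_adm.1 h).exists_symTab_eq
  exact ⟨symCls x, tab_symCls x⟩

/-- The isomorphism of the monoid of isomorphism classes onto the monoid of admissible tableaux. -/
def tabEquiv : QuadClass.{u} ≃+ admissibleTableaux :=
  AddEquiv.mk' (Equiv.ofBijective (fun c => ⟨c.tab, admissible_tab c⟩)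
    ⟨fun _ _ h => tab_injective (congrArg Subtype.val h),
      fun T => (tab_surjective T.2).imp fun _ h => Subtype.ext h⟩)
    fun c d => Subtype.ext (tab_add c d)

end QuadClass

end

theorem mainTheorem4 :
    ∃ S : AddSubmonoid Tableau,
      (∀ T : Tableau, T ∈ S ↔ T.Admissible) ∧
      ∃ e : QuadClass.{u} ≃+ S,
        ∀ (q : QuadTwoGroup.{u}) (T : Tableau),
          q.HasTableau T ↔ ((e q.cls : S) : Tableau) = T := by
  refine ⟨admissibleTableaux, fun T => Iff.rfl, QuadClass.tabEquiv, fun q T => ?_⟩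
  constructor
  · exact fun h => (QuadClass.hasTableau_tab q).unique h
  · rintro rfl
    exact QuadClass.hasTableau_tab q
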